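/- Let $d\in\mathbb N$ and let $p_{\rm data}$ be a probability density on $\mathbb{R}^d$ with finite second moment, everywhere positive with $\log p_{\rm data}$ differentiable. For $t>0$ let $p_t=e^{dt}p_{\rm data}(e^t\,\cdot)\ast\mathcal N(0,(1-e^{-2t})I_d)$ be the law at time $t$ of the Ornstein–Uhlenbeck process started from $p_0=p_{\rm data}$. Let $T>0$ and assume that $\nabla\log p_t$ is $L_s$-Lipschitz for every $t\in[0,T]$, where $L_s\ge 1$. Let $0<\delta=t_1<t_2<\dots<t_N=T$, $h_k=t_{k+1}-t_k$, be a schedule for which there are $h$ and $1\le N_1\le N$ such that $h_k=h$ for $N_1\le k\le N-1$, $(N-N_1)h<T\le (N-N_1+1)h$ (equivalently $0<t_{N_1}\le h$), $h_k=2^{-(N_1-k)}h$ for $2\le k\le N_1-1$, and $2^{-(N_1-2)}h\le 2\delta$ (so that the first step, which is what remains, satisfies $h_1\le\delta$ if $N_1\ge2$). Let $s_\phi$ be a score model (measurable in $x$ at each $t_n$) with $$\mathbb E_{x\sim p_{t_n}}\|s_\phi(x,t_n)-\nabla\log p_{t_n}(x)\|_2^2\le\varepsilon_{sc}^2,\qquad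 1\le n\le N,$$ and let $f_\theta$ be a consistency model with $f_\theta(x,\delta)=x$ for all $x$, such that $f_\theta(\cdot,t_n)$ is $L_f$-Lipschitz, $L_f>1$, for $1\le n\le N$, and $$\mathbb E_{x\sim p_{t_{n+1}}}\|f_\theta(x,t_{n+1})-f_\theta(\hat x_{t_n},t_n)\|_2^2\le\varepsilon_{cm}^2h_n^2,\qquad 1\le n\le N-1,$$ where $\hat x_{t_n}=e^{h_n}x+(e^{h_n}-1)s_\phi(x,t_{n+1})$ is the exponential integrator step, and $\varepsilon_{sc},\varepsilon_{cm}\ge 0$. For $t\in[\delta,T]$ let $f^{ex}(\cdot,t)$ be the backward map of the probability flow ODE $dx_s=(-x_s-\nabla\log p_s(x_s))\,ds$, that is, $f^{ex}(x,t)=x_\delta$ for the solution on $[\delta,t]$ with $x_t=x$. Then, for $1\le n\le N-1$, the value $f^{ex}(x,t_n)$ exists and is unique for every $x\in\mathbb R^d$. Moreover, for every $H>0$ there is a constant $C>0$, depending only on $H$, such that whenever $h\le H$, for all $1\le n\le N-1$, $$\Bigl(\mathbb E_{x\sim p_{t_n}}\|f_\theta(x,t_n)-f^{ex}(x,t_n)\|_2^2\Bigr)^{1/2}\le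 C\Bigl(t_n\bigl(\varepsilon_{cm}+L_f\varepsilon_{sc}+L_fL_s^{3/2}d^{1/2}h\bigr)+t_n^{1/2}L_fL_sd^{1/2}h\Bigr).$$ -/

import Mathlib

open MeasureTheory Set
open scoped NNReal ENNReal

noncomputable section

namespace ConsistencyModel

/-- `ℝ^d` with the Euclidean norm. -/
abbrev Vec (d : ℕ) : Type := EuclideanSpace ℝ (Fin d)

/-- The density of the centred Gaussian `N(0, v I_d)` on `ℝ^d`, for a variance `v > 0`. -/
def gaussianDensity {d : ℕ} (v : ℝ) (u : Vec d) : ℝ :=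
  (2 * Real.pi * v) ^ (-(d : ℝ) / 2) * Real.exp (-‖u‖ ^ 2 / (2 * v))

/-- The density `p_t` of the Ornstein-Uhlenbeck process `dx = -x dt + √2 dw` at time `t ≥ 0`, when
the data density at time `0` is `p`: it is `p` itself at `t = 0`, and for `t > 0` the convolution
of `e^{dt} p(e^t ·)` with the density of `N(0, (1 - e^{-2t}) I_d)`. -/
def ouDensity {d : ℕ} (p : Vec d → ℝ) (t : ℝ) (x : Vec d) : ℝ :=
  if t = 0 then p x
  else ∫ u : Vec d, (Real.exp (d * t) * p (Real.exp t • (x - u))) *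
    gaussianDensity (1 - Real.exp (-2 * t)) u

/-- The probability measure with density `p_t`. -/
def ouLaw {d : ℕ} (p : Vec d → ℝ) (t : ℝ) : Measure (Vec d) :=
  (volume : Measure (Vec d)).withDensity fun x => ENNReal.ofReal (ouDensity p t x)

/-- The score function `∇ log p_t`. -/
def score {d : ℕ} (p : Vec d → ℝ) (t : ℝ) (x : Vec d) : Vec d :=
  gradient (fun y => Real.log (ouDensity p t y)) x

/-- The vector field `v(x, t) = -x - ∇ log p_t(x)` of the probability flow ODE. -/
def exactField {d : ℕ} (p : Vec d → ℝ) (x : Vec d) (t : ℝ) : Vec d :=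
  -x - score p t x

/-- `z` is the value at time `δ` of a solution on `[δ, t]` of `dx_s = v(x_s, s) ds` with
`x_t = x`. -/
def IsBackwardValue {d : ℕ} (v : Vec d → ℝ → Vec d) (δ t : ℝ) (x z : Vec d) : Prop :=
  ∃ y : ℝ → Vec d,
    (∀ s ∈ Icc δ t, HasDerivWithinAt y (v (y s) s) (Icc δ t) s) ∧ y t = x ∧ y δ = z

/-- The backward mapping `(x_t, t) ↦ x_δ` of the ODE `dx_s = v(x_s, s) ds`. -/
def backwardMap {d : ℕ} (v : Vec d → ℝ → Vec d) (δ : ℝ) (x : Vec d) (t : ℝ) : Vec d :=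
  Classical.epsilon (IsBackwardValue v δ t x)

/-- One step of the exponential integrator for `dx = (-x - s(x, t)) dt`, backwards from time `t'`
(where the state is `x`) to the earlier time `t`. -/
def expIntegrator {d : ℕ} (s : Vec d → ℝ → Vec d) (x : Vec d) (t' t : ℝ) : Vec d :=
  Real.exp (t' - t) • x + (Real.exp (t' - t) - 1) • s x t'

/-- `p` is a probability density on `ℝ^d` with finite second moment, whose scores `∇ log p_t` are
`Ls`-Lipschitz for all `t ∈ [0, T]`. That the score exists at time `0` is part of this; for
`t > 0`, `p_t` is automatically positive and smooth. -/
structure IsDataDensity {d : ℕ} (p : Vec d → ℝ) (Ls : ℝ≥0) (T : ℝ) : Prop where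
  pos : ∀ x, 0 < p x
  integral_eq_one : ∫ x, p x = 1
  second_moment : Integrable fun x => ‖x‖ ^ 2 * p x
  differentiable_log : Differentiable ℝ fun x => Real.log (p x)
  lipschitz_score : ∀ t ∈ Icc (0 : ℝ) T, LipschitzWith Ls (score p t)

/-- The two-stage schedule `0 < δ = t_1 < ⋯ < t_N = T`: the last steps, from `t_{N₁}` on, have
length `h`, where `t_{N₁} ≤ h`; below `t_{N₁}` the steps are halved successively, and the first
one is what remains. -/
structure IsSchedule (N N₁ : ℕ) (δ T h : ℝ) (t : ℕ → ℝ) : Prop where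
  one_le : 1 ≤ N₁
  le : N₁ ≤ N
  delta_pos : 0 < δ
  t_one : t 1 = δ
  t_last : t N = T
  lt_succ : ∀ k, 1 ≤ k → k < N → t k < t (k + 1)
  step_uniform : ∀ k, N₁ ≤ k → k < N → t (k + 1) - t k = h
  number_uniform : ((N : ℝ) - N₁) * h < T ∧ T ≤ ((N : ℝ) - N₁ + 1) * h
  step_halving : ∀ k, 2 ≤ k → k < N₁ → t (k + 1) - t k = (2 : ℝ) ^ (-((N₁ : ℤ) - k)) * h
  second_step : (2 : ℝ) ^ (-((N₁ : ℤ) - 2)) * h ≤ 2 * δ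

end ConsistencyModel

end

open scoped ContDiff InnerProductSpace Topology

set_option linter.unusedSectionVars false

/-! Write `u = log p_t`. For positive times `u` is smooth and solves `∂_t u = Δu + |∇u|² + x·∇u +
d`. Smoothness comes from completing the square: `p_t` is a Gaussian factor times a Laplace
transform of the data law (`IsDataDensity.ouDensity_eq`), and the equation (`dt_logDensity`) is the
Hopf–Cole form of the heat equation for that transform.

The probability flow `Φ` starting at time `δ` carries `p_δ` to `p_t`, because `exp u` times the
Jacobian is constant along trajectories (`IsLogOU.measurePreserving_flow`). Since the backward map
inverts `Φ`, the error at `t_n` is the `L²(p_δ)` norm of `f_θ(Φ_{t_n} z, t_n) - z`. This vanishes at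
`δ`, and one step adds at most the consistency error plus `L_f` times the score error and the local
error of the integrator (`IsLogOU.eLpNorm_step_le`).

The integrator would be exact if the score were constant along the trajectory, so its local error is
controlled by the speed of the score. Differentiating the equation for `u` shows that this speed is
`G∇u + ∇u`, where `G = Δ + ∇u·∇` is symmetric with respect to `exp u`. The Lipschitz hypothesis
controls only two derivatives of `u`, while `G∇u` contains three. The missing one comes from an
energy identity: formally, the time derivative of `∫ |∇²u|² p_t` is `-2 ∫ |G∇u|² p_t` plus terms of
size `(4 + 2L) ∫ |∇²u|² p_t`. Integrating in time bounds the total of `|G∇u|²` by `dL²(1 + (4 +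
2L)(b - a))` (`IsLogOU.lintegral_genSq_le`). Cutoffs make this rigorous without assuming any
integrability in advance.

The steps share this one energy budget. Cauchy–Schwarz within each step and then over the steps
turns it into `h √t_n √(dL² + t_n dL³)` up to a constant, which produces both discretization terms
of the theorem (`sum_step_error_le`). -/

namespace ConsistencyModel

/-! ### Smoothness of Gaussian Laplace transforms of finite measures -/

section Laplace

variable {V : Type} [NormedAddCommGroup V] [InnerProductSpace ℝ V]

/-- The linear form `(b, a) ↦ ⟪a, z⟫ - b ‖z‖²`, the exponent of a Gaussian Laplace transform. -/
noncomputable def gaussExponent (z : V) : ℝ × V →L[ℝ] ℝ :=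
  (innerSL ℝ z).comp (ContinuousLinearMap.snd ℝ ℝ V) - ‖z‖ ^ 2 • ContinuousLinearMap.fst ℝ ℝ V

theorem gaussExponent_apply (z : V) (θ : ℝ × V) :
    gaussExponent z θ = ⟪z, θ.2⟫_ℝ - ‖z‖ ^ 2 * θ.1 := by
  simp [gaussExponent]

theorem continuous_gaussExponent : Continuous (gaussExponent : V → ℝ × V →L[ℝ] ℝ) := by
  unfold gaussExponent
  fun_prop

theorem norm_gaussExponent_le (z : V) : ‖gaussExponent z‖ ≤ 2 * (1 + ‖z‖) ^ 2 := by
  refine ContinuousLinearMap.opNorm_le_bound _ (by positivity) fun θ => ?_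
  rw [gaussExponent_apply]
  have h1 : ‖θ.1‖ ≤ ‖θ‖ := norm_fst_le θ
  have h2 : ‖θ.2‖ ≤ ‖θ‖ := norm_snd_le θ
  have h3 : ‖⟪z, θ.2⟫_ℝ‖ ≤ ‖z‖ * ‖θ.2‖ := norm_inner_le_norm z θ.2
  have h4 : ‖‖z‖ ^ 2 * θ.1‖ ≤ ‖z‖ ^ 2 * ‖θ‖ := by
    rw [norm_mul, norm_pow, norm_norm]; gcongr
  calc _ ≤ ‖⟪z, θ.2⟫_ℝ‖ + ‖‖z‖ ^ 2 * θ.1‖ := norm_sub_le _ _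
    _ ≤ ‖z‖ * ‖θ‖ + ‖z‖ ^ 2 * ‖θ‖ := by gcongr; exact h3.trans (by gcongr)
    _ ≤ _ := by nlinarith [norm_nonneg z, norm_nonneg θ, mul_nonneg (norm_nonneg z) (norm_nonneg θ),
                  mul_nonneg (mul_nonneg (norm_nonneg z) (norm_nonneg z)) (norm_nonneg θ)]

/-- Two losses are taken: the polynomial is absorbed by `(1 + r)^m ≤ m! e^{1+r}`, and the remaining
exponent `(A + 1) r - b r²` is maximized by completing the square. The bound does not involve `r`,
so a constant can serve as dominating function. -/
theorem one_add_pow_mul_exp_le {m : ℕ} {A b r : ℝ} (hb : 0 < b) (hr : 0 ≤ r) :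
    (1 + r) ^ m * Real.exp (A * r - b * r ^ 2) ≤
      m.factorial * Real.exp (1 + (A + 1) ^ 2 / (4 * b)) := by
  have h1 : (1 + r) ^ m / m.factorial ≤ Real.exp (1 + r) :=
    Real.pow_div_factorial_le_exp _ (by positivity) m
  have hm : (0 : ℝ) < m.factorial := by positivity
  rw [div_le_iff₀ hm] at h1
  calc (1 + r) ^ m * Real.exp (A * r - b * r ^ 2)
      ≤ (Real.exp (1 + r) * m.factorial) * Real.exp (A * r - b * r ^ 2) := by gcongr
    _ = m.factorial * Real.exp ((1 + r) + (A * r - b * r ^ 2)) := by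
      rw [Real.exp_add (1 + r)]; ring
    _ ≤ _ := by
      refine mul_le_mul_of_nonneg_left (Real.exp_le_exp.2 ?_) hm.le
      have : (A + 1) * r - b * r ^ 2 ≤ (A + 1) ^ 2 / (4 * b) := by
        rw [le_div_iff₀ (by positivity)]
        nlinarith [sq_nonneg ((A + 1) - 2 * b * r)]
      linarith

variable [MeasurableSpace V] [BorelSpace V] [SecondCountableTopology V]

/-- The Gaussian Laplace transform `(b, a) ↦ ∫ exp (⟪a, z⟫ - b ‖z‖²) φ(z) dμ(z)`. -/
noncomputable def gaussLaplace {G : Type} [NormedAddCommGroup G] [NormedSpace ℝ G] (μ : Measure V)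
    (φ : V → G) (θ : ℝ × V) : G :=
  ∫ z, Real.exp (gaussExponent z θ) • φ z ∂μ

variable {G : Type} [NormedAddCommGroup G] [NormedSpace ℝ G] {μ : Measure V} [IsFiniteMeasure μ]

theorem norm_exp_gaussExponent_smul_le {φ : V → G} {C : ℝ} {k : ℕ} (hC : 0 ≤ C)
    (hφ : ∀ z, ‖φ z‖ ≤ C * (1 + ‖z‖) ^ k) {A b : ℝ} (hb : 0 < b) {θ : ℝ × V} (h1 : b ≤ θ.1)
    (h2 : ‖θ.2‖ ≤ A) (z : V) :
    ‖Real.exp (gaussExponent z θ) • φ z‖ ≤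
      C * (k.factorial * Real.exp (1 + (A + 1) ^ 2 / (4 * b))) := by
  rw [norm_smul, Real.norm_of_nonneg (Real.exp_nonneg _)]
  have h3 : gaussExponent z θ ≤ A * ‖z‖ - b * ‖z‖ ^ 2 := by
    rw [gaussExponent_apply]
    have : ⟪z, θ.2⟫_ℝ ≤ ‖z‖ * ‖θ.2‖ := real_inner_le_norm _ _
    nlinarith [norm_nonneg z, mul_le_mul_of_nonneg_left h2 (norm_nonneg z),
      mul_le_mul_of_nonneg_left h1 (sq_nonneg ‖z‖)]
  calc Real.exp (gaussExponent z θ) * ‖φ z‖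
      ≤ Real.exp (A * ‖z‖ - b * ‖z‖ ^ 2) * (C * (1 + ‖z‖) ^ k) := by
        gcongr
        exact hφ z
    _ = C * ((1 + ‖z‖) ^ k * Real.exp (A * ‖z‖ - b * ‖z‖ ^ 2)) := by ring
    _ ≤ _ := mul_le_mul_of_nonneg_left (one_add_pow_mul_exp_le hb (norm_nonneg z)) hC

theorem aestronglyMeasurable_exp_gaussExponent_smul {φ : V → G} (hφ : Continuous φ)
    (θ : ℝ × V) : AEStronglyMeasurable (fun z => Real.exp (gaussExponent z θ) • φ z) μ := by
  have : Continuous fun z => Real.exp (gaussExponent z θ) • φ z := by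
    simp only [gaussExponent_apply]; fun_prop
  exact this.aestronglyMeasurable

theorem integrable_exp_gaussExponent_smul {φ : V → G} (hc : Continuous φ) {C : ℝ} {k : ℕ}
    (hC : 0 ≤ C) (hφ : ∀ z, ‖φ z‖ ≤ C * (1 + ‖z‖) ^ k) {θ : ℝ × V} (hθ : 0 < θ.1) :
    Integrable (fun z => Real.exp (gaussExponent z θ) • φ z) μ :=
  .of_bound (aestronglyMeasurable_exp_gaussExponent_smul hc θ) _
    (.of_forall fun z => norm_exp_gaussExponent_smul_le hC hφ hθ le_rfl le_rfl z)

theorem norm_smulRight_gaussExponent_le {φ : V → G} {C : ℝ} {k : ℕ}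
    (hφ : ∀ z, ‖φ z‖ ≤ C * (1 + ‖z‖) ^ k) (z : V) :
    ‖(gaussExponent z).smulRight (φ z)‖ ≤ (2 * C) * (1 + ‖z‖) ^ (k + 2) := by
  rw [ContinuousLinearMap.norm_smulRight_apply]
  calc _ ≤ (2 * (1 + ‖z‖) ^ 2) * (C * (1 + ‖z‖) ^ k) := by
        gcongr
        · exact norm_gaussExponent_le z
        · exact hφ z
    _ = _ := by ring

theorem continuous_smulRight_gaussExponent {φ : V → G} (hc : Continuous φ) :
    Continuous fun z => (gaussExponent z).smulRight (φ z) := by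
  have := continuous_gaussExponent (V := V)
  exact (ContinuousLinearMap.smulRightL ℝ (ℝ × V) G).continuous₂.comp (this.prodMk hc)

/-- The parameter enters through the exponential of a linear form, so differentiation only
multiplies the weight by that form. The domination is uniform on a ball whose radius is half the
quadratic parameter, which keeps that parameter away from zero. -/
theorem hasFDerivAt_gaussLaplace {φ : V → G} (hc : Continuous φ) {C : ℝ} {k : ℕ}
    (hC : 0 ≤ C) (hφ : ∀ z, ‖φ z‖ ≤ C * (1 + ‖z‖) ^ k) {θ : ℝ × V} (hθ : 0 < θ.1) :
    HasFDerivAt (gaussLaplace μ φ)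
      (gaussLaplace μ (fun z => (gaussExponent z).smulRight (φ z)) θ) θ := by
  have hb : (0 : ℝ) < θ.1 / 2 := by positivity
  have key : ∀ θ' ∈ Metric.ball θ (θ.1 / 2), θ.1 / 2 ≤ θ'.1 ∧ ‖θ'.2‖ ≤ ‖θ.2‖ + θ.1 / 2 := by
    intro θ' h
    rw [Metric.mem_ball, dist_eq_norm] at h
    have h1 := (norm_fst_le (θ' - θ)).trans_lt h
    have h2 := (norm_snd_le (θ' - θ)).trans_lt h
    rw [Prod.fst_sub, Real.norm_eq_abs, abs_lt] at h1
    rw [Prod.snd_sub] at h2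
    refine ⟨by linarith [h1.1], ?_⟩
    linarith [norm_le_norm_add_norm_sub θ.2 θ'.2, norm_sub_rev θ.2 θ'.2]
  refine hasFDerivAt_integral_of_dominated_of_fderiv_le
    (F' := fun θ z => Real.exp (gaussExponent z θ) • (gaussExponent z).smulRight (φ z)) (Metric.ball_mem_nhds θ hb)
    (.of_forall fun θ' => aestronglyMeasurable_exp_gaussExponent_smul hc θ')
    (integrable_exp_gaussExponent_smul hc hC hφ hθ)
    (aestronglyMeasurable_exp_gaussExponent_smul (continuous_smulRight_gaussExponent hc) θ)
    (.of_forall fun z θ' h => norm_exp_gaussExponent_smul_le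
      (φ := fun z => (gaussExponent z).smulRight (φ z)) (C := 2 * C) (by positivity)
      (norm_smulRight_gaussExponent_le hφ) hb (key θ' h).1 (key θ' h).2 z)
    (integrable_const _) (.of_forall fun z θ' _ => ?_)
  have h1 : HasFDerivAt (fun θ'' => Real.exp (gaussExponent z θ''))
      (Real.exp (gaussExponent z θ') • gaussExponent z) θ' :=
    (gaussExponent z).hasFDerivAt.exp
  convert h1.smul_const (φ z) using 1
  ext w <;> simp [smul_smul]

theorem isOpen_posTime : IsOpen {θ : ℝ × V | 0 < θ.1} := isOpen_lt continuous_const continuous_fst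

/-- The derivative is again a transform of the same kind, but its weight takes values in a space of
linear maps and grows with exponent `k + 2`. The induction therefore quantifies over the target
space and the growth constants. -/
theorem contDiffOn_gaussLaplace (n : ℕ) : ∀ {G : Type} [NormedAddCommGroup G] [NormedSpace ℝ G]
    {φ : V → G} (_ : Continuous φ) {C : ℝ} {k : ℕ} (_ : 0 ≤ C)
    (_ : ∀ z, ‖φ z‖ ≤ C * (1 + ‖z‖) ^ k),
    ContDiffOn ℝ n (gaussLaplace μ φ) {θ : ℝ × V | 0 < θ.1} := by
  induction n with
  | zero =>
    intro G _ _ φ hc C k hC hφ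
    refine contDiffOn_zero.2 fun θ hθ => ?_
    exact (hasFDerivAt_gaussLaplace hc hC hφ hθ).continuousAt.continuousWithinAt
  | succ n ih =>
    intro G _ _ φ hc C k hC hφ
    push_cast
    rw [contDiffOn_succ_iff_fderiv_of_isOpen isOpen_posTime]
    refine ⟨fun θ hθ => (hasFDerivAt_gaussLaplace hc hC hφ
      hθ).differentiableAt.differentiableWithinAt, by simp, ?_⟩
    refine (ih (continuous_smulRight_gaussExponent hc) (by positivity : 0 ≤ 2 * C)
      (norm_smulRight_gaussExponent_le hφ)).congr fun θ hθ => ?_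
    exact (hasFDerivAt_gaussLaplace hc hC hφ hθ).fderiv

theorem contDiffOn_infty_gaussLaplace
    {φ : V → G} (hc : Continuous φ) {C : ℝ} {k : ℕ} (hC : 0 ≤ C)
    (hφ : ∀ z, ‖φ z‖ ≤ C * (1 + ‖z‖) ^ k) :
    ContDiffOn ℝ ∞ (gaussLaplace μ φ) {θ : ℝ × V | 0 < θ.1} :=
  contDiffOn_infty.2 fun n => contDiffOn_gaussLaplace n hc hC hφ

end Laplace

/-! ### Directional derivatives of scalar functions -/

section Calculus

variable {W : Type} [NormedAddCommGroup W] [NormedSpace ℝ W]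

/-- The derivative of `f` in the direction `w`, as a function of the point. -/
noncomputable def pd (w : W) (f : W → ℝ) (z : W) : ℝ := fderiv ℝ f z w

variable {U : Set W} {f g : W → ℝ} {z w : W}

theorem _root_.HasFDerivAt.pd_eq {f' : W →L[ℝ] ℝ} (h : HasFDerivAt f f' z) : pd w f z = f' w := by
  rw [pd, h.fderiv]

theorem contDiffOn_pd (hU : IsOpen U) (hf : ContDiffOn ℝ ∞ f U) (w : W) :
    ContDiffOn ℝ ∞ (pd w f) U :=
  ((hf.fderiv_of_isOpen hU (by simp)).clm_apply contDiffOn_const)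

theorem differentiableAt_of_contDiffOn (hU : IsOpen U) (hf : ContDiffOn ℝ ∞ f U) (hz : z ∈ U) :
    DifferentiableAt ℝ f z :=
  (hf.contDiffAt (hU.mem_nhds hz)).differentiableAt (by simp)

theorem pd_congr (hU : IsOpen U) (h : EqOn f g U) : EqOn (pd w f) (pd w g) U := fun z hz => by
  rw [pd, pd, (h.eventuallyEq_of_mem (hU.mem_nhds hz)).fderiv_eq]

theorem pd_comm (hU : IsOpen U) (hf : ContDiffOn ℝ ∞ f U) (w₁ w₂ : W) :
    EqOn (pd w₁ (pd w₂ f)) (pd w₂ (pd w₁ f)) U := fun z hz => by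
  have h1 : ContDiffAt ℝ ∞ f z := hf.contDiffAt (hU.mem_nhds hz)
  have h2 : DifferentiableAt ℝ (fderiv ℝ f) z :=
    (h1.fderiv_right (m := ∞) (by simp)).differentiableAt (by simp)
  have h3 : ∀ w w' : W, pd w (pd w' f) z = fderiv ℝ (fderiv ℝ f) z w w' := fun w w' => by
    have : HasFDerivAt (pd w' f) _ z := h2.hasFDerivAt.clm_apply (hasFDerivAt_const w' z)
    rw [this.pd_eq]
    simp
  rw [h3, h3]
  exact (h1.isSymmSndFDerivAt (by simp only [minSmoothness_of_isRCLikeNormedField]; exact WithTop.coe_le_coe.2 le_top)) _ _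

theorem pd_add (hf : DifferentiableAt ℝ f z) (hg : DifferentiableAt ℝ g z) :
    pd w (fun y => f y + g y) z = pd w f z + pd w g z :=
  (hf.hasFDerivAt.add hg.hasFDerivAt).pd_eq

theorem pd_mul (hf : DifferentiableAt ℝ f z) (hg : DifferentiableAt ℝ g z) :
    pd w (fun y => f y * g y) z = pd w f z * g z + f z * pd w g z := by
  have h : HasFDerivAt (fun y => f y * g y) _ z := hf.hasFDerivAt.mul hg.hasFDerivAt
  rw [h.pd_eq]
  simp [pd]
  ring

theorem pd_sq (hf : DifferentiableAt ℝ f z) :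
    pd w (fun y => f y ^ 2) z = 2 * f z * pd w f z := by
  simp_rw [sq]
  rw [pd_mul hf hf]
  ring

theorem pd_const (c : ℝ) : pd w (fun _ => c) z = 0 := by
  simp [pd]

theorem pd_sum {ι : Type} {s : Finset ι} {f : ι → W → ℝ}
    (hf : ∀ i ∈ s, DifferentiableAt ℝ (f i) z) :
    pd w (fun y => ∑ i ∈ s, f i y) z = ∑ i ∈ s, pd w (f i) z := by
  have h : HasFDerivAt (fun y => ∑ i ∈ s, f i y) _ z :=
    HasFDerivAt.fun_sum fun i hi => (hf i hi).hasFDerivAt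
  rw [h.pd_eq]
  simp [pd]

theorem pd_log (hf : DifferentiableAt ℝ f z) (h0 : f z ≠ 0) :
    pd w (fun y => Real.log (f y)) z = pd w f z / f z := by
  rw [(hf.hasFDerivAt.log h0).pd_eq]
  simp [pd]
  ring

end Calculus

/-! ### Coordinates on space-time -/

section SpaceTime

variable {d : ℕ}

/-- The open half space `{(t, x) | 0 < t}` of space-time. -/
def posTime (d : ℕ) : Set (ℝ × Vec d) := {z | 0 < z.1}

theorem isOpen_posTime' : IsOpen (posTime d) := isOpen_posTime

/-- The time derivative. -/
noncomputable abbrev dt (f : ℝ × Vec d → ℝ) : ℝ × Vec d → ℝ := pd (1, 0) f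

/-- The unit vector in the `i`-th direction of space. -/
noncomputable abbrev unitVec (i : Fin d) : Vec d := EuclideanSpace.single i 1

/-- The `i`-th partial derivative in space. -/
noncomputable abbrev dx (i : Fin d) (f : ℝ × Vec d → ℝ) : ℝ × Vec d → ℝ := pd (0, unitVec i) f

theorem sum_smul_unitVec (x : Vec d) : x = ∑ i, x i • unitVec i := by
  conv_lhs => rw [← (EuclideanSpace.basisFun (Fin d) ℝ).sum_repr x]
  simp

theorem pd_eq_dt_add_sum_dx (f : ℝ × Vec d → ℝ) (z w : ℝ × Vec d) :
    pd w f z = w.1 * dt f z + ∑ i, w.2 i * dx i f z := by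
  have h : w = w.1 • ((1 : ℝ), (0 : Vec d)) + ∑ i, w.2 i • ((0 : ℝ), unitVec i) := by
    ext1
    · simp [Prod.fst_sum]
    · simpa [Prod.snd_sum] using sum_smul_unitVec w.2
  conv_lhs => rw [pd, h]
  simp only [map_add, map_smul, map_sum, smul_eq_mul, pd]

end SpaceTime

/-! ### The backward heat equation of the Laplace transform and its logarithm -/

section LaplaceDensity

variable {d : ℕ} {μ : Measure (Vec d)} [IsFiniteMeasure μ]

theorem pd_gaussLaplace {φ : Vec d → ℝ} (hc : Continuous φ) {C : ℝ} {k : ℕ}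
    (hC : 0 ≤ C) (hφ : ∀ z, ‖φ z‖ ≤ C * (1 + ‖z‖) ^ k) {θ w : ℝ × Vec d} (hθ : θ ∈ posTime d) :
    pd w (gaussLaplace μ φ) θ = gaussLaplace μ (fun z => gaussExponent z w * φ z) θ := by
  rw [(hasFDerivAt_gaussLaplace hc hC hφ hθ).pd_eq, gaussLaplace,
    ContinuousLinearMap.integral_apply]
  · simp [gaussLaplace]
  · exact integrable_exp_gaussExponent_smul (continuous_smulRight_gaussExponent hc)
      (C := 2 * C) (by positivity) (norm_smulRight_gaussExponent_le hφ) hθ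

variable (μ) in
/-- The Gaussian Laplace transform of a measure. -/
noncomputable def laplace (θ : ℝ × Vec d) : ℝ := gaussLaplace μ (fun _ => (1 : ℝ)) θ

theorem contDiffOn_laplace : ContDiffOn ℝ ∞ (laplace μ) (posTime d) :=
  contDiffOn_infty_gaussLaplace (k := 0) continuous_const zero_le_one (by simp)

theorem laplace_pos [NeZero μ] {θ : ℝ × Vec d} (hθ : θ ∈ posTime d) : 0 < laplace μ θ := by
  have hi : Integrable (fun z => Real.exp (gaussExponent z θ) • (1 : ℝ)) μ :=
    integrable_exp_gaussExponent_smul continuous_const zero_le_one (k := 0) (by simp) hθ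
  simp only [smul_eq_mul, mul_one] at hi
  simp only [laplace, gaussLaplace, smul_eq_mul, mul_one]
  exact integral_exp_pos hi

theorem norm_apply_le_one_add (z : Vec d) (i : Fin d) : ‖z i‖ ≤ 1 * (1 + ‖z‖) ^ 1 := by
  have := PiLp.norm_apply_le z i
  simp only [pow_one, one_mul]
  linarith

theorem dx_laplace (i : Fin d) :
    EqOn (dx i (laplace μ)) (gaussLaplace μ fun z => z i) (posTime d) := fun θ hθ => by
  rw [dx]
  unfold laplace
  rw [pd_gaussLaplace continuous_const zero_le_one (k := 0) (by simp) hθ]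
  simp [gaussExponent_apply, unitVec, EuclideanSpace.inner_single_right]

/-- Differentiating the exponential in the quadratic parameter brings down `-‖z‖²`, and applying the
Laplacian in the tilt brings down `‖z‖²`. -/
theorem dt_laplace {θ : ℝ × Vec d} (hθ : θ ∈ posTime d) :
    dt (laplace μ) θ = - ∑ i, dx i (dx i (laplace μ)) θ := by
  have h1 : ∀ i, dx i (dx i (laplace μ)) θ = gaussLaplace μ (fun z => z i * z i) θ := fun i => by
    rw [dx, pd_congr isOpen_posTime' (dx_laplace i) hθ,
      pd_gaussLaplace (by fun_prop) zero_le_one (fun z => norm_apply_le_one_add z i) hθ]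
    simp [gaussExponent_apply, unitVec, EuclideanSpace.inner_single_right]
  simp_rw [h1, gaussLaplace]
  rw [← integral_finsetSum, dt]
  · unfold laplace
    rw [pd_gaussLaplace continuous_const zero_le_one (k := 0) (by simp) hθ, ← integral_neg]
    have h2 : ∀ z : Vec d, ∑ i, z i * z i = ‖z‖ ^ 2 := fun z => by
      simp_rw [EuclideanSpace.norm_sq_eq, Real.norm_eq_abs, sq_abs, sq]
    simp [gaussExponent_apply, gaussLaplace, ← Finset.mul_sum, h2]
  · intro i _
    refine integrable_exp_gaussExponent_smul (by fun_prop) zero_le_one (k := 2) (fun z => ?_) hθ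
    have := norm_apply_le_one_add z i
    rw [norm_mul]
    nlinarith [norm_nonneg (z i), norm_nonneg z]

/-- The logarithm of the Laplace transform. -/
noncomputable def logLaplace (μ : Measure (Vec d)) (θ : ℝ × Vec d) : ℝ := Real.log (laplace μ θ)

variable [NeZero μ]

theorem contDiffOn_logLaplace : ContDiffOn ℝ ∞ (logLaplace μ) (posTime d) :=
  contDiffOn_laplace.log fun _ hθ => (laplace_pos hθ).ne'

/-- Hopf–Cole: for `F = exp Λ` one has `ΔF / F = ΔΛ + |∇Λ|²`, which turns the linear backward heat
equation into this one. -/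
theorem dt_logLaplace {θ : ℝ × Vec d} (hθ : θ ∈ posTime d) :
    dt (logLaplace μ) θ =
      - ∑ i, (dx i (dx i (logLaplace μ)) θ + dx i (logLaplace μ) θ ^ 2) := by
  have hF : ∀ θ ∈ posTime d, DifferentiableAt ℝ (laplace μ) θ := fun θ hθ =>
    differentiableAt_of_contDiffOn isOpen_posTime' contDiffOn_laplace hθ
  have h1 : ∀ w, ∀ θ ∈ posTime d, pd w (logLaplace μ) θ = pd w (laplace μ) θ / laplace μ θ :=
    fun w θ hθ => pd_log (hF θ hθ) (laplace_pos hθ).ne'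
  have h2 : ∀ i, dx i (dx i (logLaplace μ)) θ + dx i (logLaplace μ) θ ^ 2
      = dx i (dx i (laplace μ)) θ / laplace μ θ := fun i => by
    have h3 : EqOn (dx i (laplace μ)) (fun y => dx i (logLaplace μ) y * laplace μ y)
        (posTime d) := fun y hy => by
      simp only [dx]
      rw [h1 _ y hy, div_mul_cancel₀ _ (laplace_pos hy).ne']
    have h4 : dx i (dx i (laplace μ)) θ = _ := pd_congr isOpen_posTime' h3 hθ
    rw [pd_mul (differentiableAt_of_contDiffOn isOpen_posTime'
      (contDiffOn_pd isOpen_posTime' contDiffOn_logLaplace _) hθ) (hF θ hθ)] at h4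
    rw [h4, eq_div_iff (laplace_pos hθ).ne']
    have := h3 hθ
    simp only at this
    rw [show pd (0, unitVec i) (laplace μ) θ = _ from this]
    ring
  simp_rw [h2, ← Finset.sum_div]
  rw [dt, h1 _ θ hθ, ← dt, dt_laplace hθ]
  ring

end LaplaceDensity

/-! ### The logarithmic Fokker–Planck equation -/

section LogDensity

variable {d : ℕ}

/-- The variance of the noise at time `t`. -/
noncomputable def ouVar (t : ℝ) : ℝ := 1 - Real.exp (-2 * t)

/-- The factor of `x` in the tilting parameter of the Laplace transform. -/
noncomputable def ouTilt (t : ℝ) : ℝ := Real.exp (-t) / ouVar t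

/-- The quadratic parameter of the Laplace transform. -/
noncomputable def ouQuad (t : ℝ) : ℝ := Real.exp (-2 * t) / (2 * ouVar t)

theorem ouVar_pos {t : ℝ} (ht : 0 < t) : 0 < ouVar t := by
  rw [ouVar, sub_pos, Real.exp_lt_one_iff]
  linarith

theorem hasDerivAt_ouVar (t : ℝ) : HasDerivAt ouVar (2 * (1 - ouVar t)) t := by
  have h : HasDerivAt ouVar _ t := (((hasDerivAt_id t).const_mul (-2)).exp).const_sub 1
  convert h using 1
  simp [ouVar]
  ring

theorem hasDerivAt_ouTilt {t : ℝ} (ht : 0 < t) :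
    HasDerivAt ouTilt (ouTilt t - 2 * ouTilt t / ouVar t) t := by
  have h : HasDerivAt ouTilt _ t :=
    (hasDerivAt_neg t).exp.div (hasDerivAt_ouVar t) (ouVar_pos ht).ne'
  convert h using 1
  have := (ouVar_pos ht).ne'
  rw [ouTilt]
  field_simp
  ring

/-- The derivative is minus the square of the spatial scaling. Hence the backward heat part of the
Laplace transform becomes, in the original variables, a forward equation with unit diffusion. -/
theorem hasDerivAt_ouQuad {t : ℝ} (ht : 0 < t) : HasDerivAt ouQuad (-ouTilt t ^ 2) t := by
  have h : HasDerivAt ouQuad _ t := (((hasDerivAt_id t).const_mul (-2)).exp).div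
    ((hasDerivAt_ouVar t).const_mul 2) (mul_pos two_pos (ouVar_pos ht)).ne'
  convert h using 1
  have h1 := (ouVar_pos ht).ne'
  have h2 : Real.exp (-t) ^ 2 = Real.exp (-2 * t) := by rw [← Real.exp_nat_mul]; ring_nf
  have h3 : Real.exp (-2 * t) = 1 - ouVar t := by simp [ouVar]
  simp only [id]
  rw [ouTilt, div_pow, h2, h3]
  field_simp
  ring

theorem ouQuad_pos {t : ℝ} (ht : 0 < t) : 0 < ouQuad t := by
  have := ouVar_pos ht
  unfold ouQuad
  positivity

theorem _root_.HasDerivAt.hasFDerivAt_comp_fst {f : ℝ → ℝ} {f' : ℝ} {z : ℝ × Vec d}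
    (h : HasDerivAt f f' z.1) : HasFDerivAt (fun y : ℝ × Vec d => f y.1)
      (f' • ContinuousLinearMap.fst ℝ ℝ (Vec d)) z := by
  have h0 : HasFDerivAt (Prod.fst : ℝ × Vec d → ℝ) (ContinuousLinearMap.fst ℝ ℝ (Vec d)) z :=
    hasFDerivAt_fst
  exact h.comp_hasFDerivAt z h0

/-- The change of space-time variables that turns `log p_t` into a log-Laplace transform. -/
noncomputable def ouMap (z : ℝ × Vec d) : ℝ × Vec d := (ouQuad z.1, ouTilt z.1 • z.2)

theorem ouMap_mem {z : ℝ × Vec d} (hz : z ∈ posTime d) : ouMap z ∈ posTime d := ouQuad_pos hz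

theorem pd_comp_ouMap {f : ℝ × Vec d → ℝ} {z w : ℝ × Vec d} (hz : z ∈ posTime d)
    (hf : DifferentiableAt ℝ f (ouMap z)) :
    pd w (fun y => f (ouMap y)) z = pd (-ouTilt z.1 ^ 2 * w.1,
      ((ouTilt z.1 - 2 * ouTilt z.1 / ouVar z.1) * w.1) • z.2 + ouTilt z.1 • w.2) f (ouMap z) := by
  have h1 : HasFDerivAt (fun y : ℝ × Vec d => ouQuad y.1) _ z :=
    (hasDerivAt_ouQuad hz).hasFDerivAt_comp_fst
  have h2 : HasFDerivAt (fun y : ℝ × Vec d => ouTilt y.1) _ z :=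
    (hasDerivAt_ouTilt hz).hasFDerivAt_comp_fst
  have h3 : HasFDerivAt (fun y => f (ouMap y)) _ z :=
    hf.hasFDerivAt.comp z (h1.prodMk (h2.smul hasFDerivAt_snd))
  rw [h3.pd_eq, pd]
  simp only [ContinuousLinearMap.comp_apply]
  congr 1
  simp [add_comm]

theorem contDiffOn_ouMap : ContDiffOn ℝ ∞ (ouMap : ℝ × Vec d → ℝ × Vec d) (posTime d) := by
  have h0 : ContDiffOn ℝ ∞ (fun z : ℝ × Vec d => ouVar z.1) (posTime d) := by
    unfold ouVar; fun_prop
  have h1 : ContDiffOn ℝ ∞ (fun z : ℝ × Vec d => ouTilt z.1) (posTime d) :=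
    ContDiffOn.div (by fun_prop) h0 fun z hz => (ouVar_pos hz).ne'
  refine ContDiffOn.prodMk ?_ (h1.smul contDiff_snd.contDiffOn)
  exact ContDiffOn.div (by fun_prop) (contDiffOn_const.mul h0)
    fun z hz => (mul_pos two_pos (ouVar_pos hz)).ne'

/-- The logarithm of the Gaussian prefactor of `p_t`. -/
noncomputable def logGauss (z : ℝ × Vec d) : ℝ :=
  (-d / 2) * Real.log (2 * Real.pi * ouVar z.1) - ‖z.2‖ ^ 2 / (2 * ouVar z.1)

theorem hasFDerivAt_logGauss {z : ℝ × Vec d} (hz : z ∈ posTime d) :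
    HasFDerivAt (logGauss : ℝ × Vec d → ℝ)
      ((-d * (1 - ouVar z.1) / ouVar z.1 + ‖z.2‖ ^ 2 * (1 - ouVar z.1) / ouVar z.1 ^ 2) •
        ContinuousLinearMap.fst ℝ ℝ (Vec d) - (ouVar z.1)⁻¹ •
          (innerSL ℝ z.2).comp (ContinuousLinearMap.snd ℝ ℝ (Vec d))) z := by
  have hv : 0 < ouVar z.1 := ouVar_pos hz
  have h1 : HasFDerivAt (fun y : ℝ × Vec d => ouVar y.1) _ z :=
    (hasDerivAt_ouVar z.1).hasFDerivAt_comp_fst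
  have h2 : HasFDerivAt (fun y : ℝ × Vec d => Real.log (2 * Real.pi * ouVar y.1)) _ z :=
    (h1.const_mul (2 * Real.pi)).log (by positivity)
  have h3 : HasFDerivAt (fun y : ℝ × Vec d => ‖y.2‖ ^ 2) _ z := hasFDerivAt_snd.norm_sq
  have h4 : HasFDerivAt (fun y : ℝ × Vec d => ‖y.2‖ ^ 2 / (2 * ouVar y.1)) _ z :=
    h3.mul (((hasDerivAt_ouVar z.1).const_mul 2).fun_inv (by positivity)).hasFDerivAt_comp_fst
  have h5 : HasFDerivAt (logGauss : ℝ × Vec d → ℝ) _ z := (h2.const_mul (-d / 2)).sub h4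
  refine h5.congr_fderiv ?_
  ext w
  · simp
    field_simp
    ring
  · simp
    field_simp

theorem contDiffOn_logGauss : ContDiffOn ℝ ∞ (logGauss : ℝ × Vec d → ℝ) (posTime d) := by
  have h0 : ContDiffOn ℝ ∞ (fun z : ℝ × Vec d => ouVar z.1) (posTime d) := by
    unfold ouVar; fun_prop
  refine ContDiffOn.sub (contDiffOn_const.mul (ContDiffOn.log (contDiffOn_const.mul h0) ?_))
    (ContDiffOn.div ?_ (contDiffOn_const.mul h0) ?_)
  · intro z hz
    have := ouVar_pos hz
    positivity
  · exact (contDiffOn_snd.norm_sq ℝ)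
  · intro z hz
    exact (mul_pos two_pos (ouVar_pos hz)).ne'

/-- The logarithm of the density of the Ornstein-Uhlenbeck process started from `μ`. -/
noncomputable def logDensity (μ : Measure (Vec d)) (z : ℝ × Vec d) : ℝ :=
  logGauss z + logLaplace μ (ouMap z)

variable {μ : Measure (Vec d)} [IsFiniteMeasure μ] [NeZero μ]

theorem contDiffOn_logDensity : ContDiffOn ℝ ∞ (logDensity μ) (posTime d) :=
  contDiffOn_logGauss.add (contDiffOn_logLaplace.comp contDiffOn_ouMap fun _ hz => ouMap_mem hz)

/-- The log-density solves `∂_t u = Δu + |∇u|² + x · ∇u + d`. -/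
theorem dt_logDensity {z : ℝ × Vec d} (hz : z ∈ posTime d) :
    dt (logDensity μ) z = (∑ i, (dx i (dx i (logDensity μ)) z + dx i (logDensity μ) z ^ 2
      + z.2 i * dx i (logDensity μ) z)) + d := by
  have hU := isOpen_posTime' (d := d)
  have hΛ : ∀ z ∈ posTime d, DifferentiableAt ℝ (logLaplace μ) (ouMap z) := fun z hz =>
    differentiableAt_of_contDiffOn hU contDiffOn_logLaplace (ouMap_mem hz)
  have hΛ' : ∀ i, ∀ z ∈ posTime d, DifferentiableAt ℝ (dx i (logLaplace μ)) (ouMap z) :=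
    fun i z hz => differentiableAt_of_contDiffOn hU
      (contDiffOn_pd hU contDiffOn_logLaplace _) (ouMap_mem hz)
  have hm : ∀ z ∈ posTime d, DifferentiableAt ℝ (ouMap : ℝ × Vec d → ℝ × Vec d) z :=
    fun z hz => (contDiffOn_ouMap.contDiffAt (hU.mem_nhds hz)).differentiableAt (by simp)
  have hg : ∀ z ∈ posTime d, DifferentiableAt ℝ (logGauss : ℝ × Vec d → ℝ) z :=
    fun z hz => (hasFDerivAt_logGauss hz).differentiableAt
  have hu : ∀ w, ∀ z ∈ posTime d, pd w (logDensity μ) z =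
      pd w logGauss z + pd w (fun y => logLaplace μ (ouMap y)) z := fun w z hz =>
    pd_add (hg z hz) ((hΛ z hz).comp z (hm z hz))
  have hx : ∀ i, ∀ f : ℝ × Vec d → ℝ, ∀ z ∈ posTime d, DifferentiableAt ℝ f (ouMap z) →
      dx i (fun y => f (ouMap y)) z = ouTilt z.1 * dx i f (ouMap z) := fun i f z hz hf => by
    rw [dx, pd_comp_ouMap hz hf, dx, pd, pd]
    have : ((-ouTilt z.1 ^ 2 * (0, unitVec i).1,
      ((ouTilt z.1 - 2 * ouTilt z.1 / ouVar z.1) * ((0 : ℝ), unitVec i).1) • z.2 +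
        ouTilt z.1 • ((0 : ℝ), unitVec i).2) : ℝ × Vec d)
        = ouTilt z.1 • ((0 : ℝ), unitVec i) := by
      ext1 <;> simp
    rw [this, map_smul, smul_eq_mul]
  have h1 : ∀ i, EqOn (dx i (logDensity μ)) (fun z => -((ouVar z.1)⁻¹ * z.2 i) +
      ouTilt z.1 * dx i (logLaplace μ) (ouMap z)) (posTime d) := fun i z hz => by
    rw [dx, hu _ z hz, ← dx, ← dx, hx i _ z hz (hΛ z hz), dx, (hasFDerivAt_logGauss hz).pd_eq]
    simp [EuclideanSpace.inner_single_right]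
  have hv : 0 < ouVar z.1 := ouVar_pos hz
  have h2 : ∀ i, dx i (dx i (logDensity μ)) z = -(ouVar z.1)⁻¹ +
      ouTilt z.1 ^ 2 * dx i (dx i (logLaplace μ)) (ouMap z) := fun i => by
    have e1 : HasFDerivAt (fun y : ℝ × Vec d => (ouVar y.1)⁻¹ * y.2 i) _ z :=
      ((hasDerivAt_ouVar z.1).fun_inv hv.ne').hasFDerivAt_comp_fst.mul
        ((EuclideanSpace.proj (𝕜 := ℝ) i).hasFDerivAt.comp z hasFDerivAt_snd)
    have e2 : HasFDerivAt (fun y : ℝ × Vec d => ouTilt y.1) _ z :=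
      (hasDerivAt_ouTilt hz).hasFDerivAt_comp_fst
    have e3 : DifferentiableAt ℝ (fun y => dx i (logLaplace μ) (ouMap y)) z :=
      (hΛ' i z hz).comp z (hm z hz)
    rw [dx, pd_congr hU (h1 i) hz,
      pd_add e1.fun_neg.differentiableAt (e2.differentiableAt.fun_mul e3),
      pd_mul e2.differentiableAt e3, e2.pd_eq, e1.fun_neg.pd_eq,
      show pd (0, unitVec i) (fun y => dx i (logLaplace μ) (ouMap y)) z = _ from
        hx i _ z hz (hΛ' i z hz)]
    simp
    ring
  have h3 : dt (logDensity μ) z = (-d * (1 - ouVar z.1) / ouVar z.1 +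
      ‖z.2‖ ^ 2 * (1 - ouVar z.1) / ouVar z.1 ^ 2) +
      (-ouTilt z.1 ^ 2 * dt (logLaplace μ) (ouMap z) + ∑ i,
        (ouTilt z.1 - 2 * ouTilt z.1 / ouVar z.1) * z.2 i * dx i (logLaplace μ) (ouMap z)) := by
    rw [dt, hu _ z hz, pd_comp_ouMap hz (hΛ z hz), pd_eq_dt_add_sum_dx (logLaplace μ),
      (hasFDerivAt_logGauss hz).pd_eq]
    simp
  rw [h3, dt_logLaplace (ouMap_mem hz)]
  simp_rw [h2, fun i => h1 i hz]
  -- Once `‖x‖²` and `d` are also written as sums over coordinates, the two sides agree summand by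
  -- summand, and only an algebraic identity in the variance and the tilt remains.
  have h4 : ‖z.2‖ ^ 2 = ∑ i, z.2 i ^ 2 := by
    simp_rw [EuclideanSpace.norm_sq_eq, Real.norm_eq_abs, sq_abs]
  have h5 : (d : ℝ) = ∑ i : Fin d, (1 : ℝ) := by simp
  rw [h4]
  simp_rw [h5]
  simp only [← Finset.sum_neg_distrib, Finset.sum_mul, Finset.mul_sum, Finset.sum_div,
    ← Finset.sum_add_distrib]
  refine Finset.sum_congr rfl fun i _ => ?_
  field_simp
  ring

end LogDensity

/-! ### From the convolution density to the smooth log-density -/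

section Link

variable {d : ℕ}

theorem continuous_gaussianDensity (v : ℝ) :
    Continuous (gaussianDensity v : Vec d → ℝ) := by
  unfold gaussianDensity; fun_prop

theorem gaussianDensity_pos {v : ℝ} (hv : 0 < v) (u : Vec d) : 0 < gaussianDensity v u := by
  unfold gaussianDensity; positivity

theorem integral_gaussianDensity {v : ℝ} (hv : 0 < v) :
    ∫ u : Vec d, gaussianDensity v u = 1 := by
  have h := GaussianFourier.integral_rexp_neg_mul_sq_norm (V := Vec d) (b := 1 / (2 * v))
    (by positivity)
  have h2 : ∀ u : Vec d, gaussianDensity v u =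
      (2 * Real.pi * v) ^ (-(d : ℝ) / 2) * Real.exp (-(1 / (2 * v)) * ‖u‖ ^ 2) := fun u => by
    rw [gaussianDensity]; congr 2; ring
  simp_rw [h2]
  rw [integral_const_mul, h, finrank_euclideanSpace_fin,
    show Real.pi / (1 / (2 * v)) = 2 * Real.pi * v by field_simp,
    ← Real.rpow_add (by positivity)]
  ring_nf
  simp

theorem integrable_gaussianDensity {v : ℝ} (hv : 0 < v) :
    Integrable (gaussianDensity v : Vec d → ℝ) := by
  by_contra h
  have := integral_gaussianDensity (d := d) hv
  rw [integral_undef h] at this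
  exact zero_ne_one this

theorem lintegral_gaussianDensity {v : ℝ} (hv : 0 < v) (y : Vec d) :
    ∫⁻ u : Vec d, ENNReal.ofReal (gaussianDensity v (u - y)) = 1 := by
  rw [lintegral_sub_right_eq_self (fun u => ENNReal.ofReal (gaussianDensity v u)),
    ← ofReal_integral_eq_lintegral_ofReal (integrable_gaussianDensity hv)
    (.of_forall fun u => (gaussianDensity_pos hv u).le), integral_gaussianDensity hv]
  simp

/-- The substitution `w = e^t (x - u)` has a Jacobian that cancels the prefactor `e^{dt}`. The
integral is then taken directly against the initial density. -/
theorem ouDensity_eq_integral (p : Vec d → ℝ) {t : ℝ} (ht : 0 < t) (x : Vec d) :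
    ouDensity p t x = ∫ w, p w * gaussianDensity (ouVar t) (x - Real.exp (-t) • w) := by
  rw [ouDensity, if_neg ht.ne']
  have h1 := integral_sub_left_eq_self (fun y : Vec d =>
    (Real.exp (d * t) * p (Real.exp t • y)) * gaussianDensity (ouVar t) (x - y)) volume x
  have h2 := Measure.integral_comp_smul (volume : Measure (Vec d)) (fun w =>
    Real.exp (d * t) * p w * gaussianDensity (ouVar t) (x - Real.exp (-t) • w)) (Real.exp t)
  simp only [sub_sub_cancel] at h1
  simp only [smul_smul, ← Real.exp_add, neg_add_cancel, Real.exp_zero, one_smul,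
    finrank_euclideanSpace_fin] at h2
  change ∫ u : Vec d, (Real.exp (d * t) * p (Real.exp t • (x - u))) *
    gaussianDensity (ouVar t) u = _
  rw [h1, h2, ← Real.exp_nat_mul, abs_of_pos (by positivity), smul_eq_mul, ← integral_const_mul]
  congr 1 with w
  rw [← mul_assoc, ← mul_assoc, inv_mul_cancel₀ (Real.exp_pos _).ne', one_mul]

/-- Expanding `‖x - e^{-t} w‖²` separates a factor depending on `x` alone from the exponential of a
form linear in `w` and `‖w‖²`. This is where the values of the tilt and of the quadratic parameter
come from. -/
theorem gaussianDensity_eq_exp {t : ℝ} (ht : 0 < t) (x w : Vec d) :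
    gaussianDensity (ouVar t) (x - Real.exp (-t) • w) =
      Real.exp (logGauss (t, x)) * Real.exp (gaussExponent w (ouMap (t, x))) := by
  have hv := ouVar_pos ht
  have h2 : Real.exp (-2 * t) = Real.exp (-t) ^ 2 := by rw [← Real.exp_nat_mul]; ring_nf
  rw [gaussianDensity, Real.rpow_def_of_pos (by positivity), ← Real.exp_add, ← Real.exp_add,
    gaussExponent_apply, ouMap, logGauss, norm_sub_sq_real, norm_smul, inner_smul_right,
    inner_smul_right, real_inner_comm w x, ouTilt, ouQuad, h2, Real.norm_of_nonneg (Real.exp_nonneg _)]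
  congr 1
  simp only
  field_simp
  ring

/-- The data distribution. -/
noncomputable abbrev dataLaw (p : Vec d → ℝ) : Measure (Vec d) :=
  (volume : Measure (Vec d)).withDensity fun x => ENNReal.ofReal (p x)

namespace IsDataDensity

variable {p : Vec d → ℝ} {Ls : ℝ≥0} {T : ℝ} (hp : IsDataDensity p Ls T)

include hp

theorem continuous : Continuous p := by
  have : p = fun x => Real.exp (Real.log (p x)) := by
    ext x; rw [Real.exp_log (hp.pos x)]
  rw [this]
  exact hp.differentiable_log.continuous.rexp

theorem integrable : Integrable p := by
  by_contra h
  have := hp.integral_eq_one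
  rw [integral_undef h] at this
  exact zero_ne_one this

theorem lintegral_eq_one : ∫⁻ x, ENNReal.ofReal (p x) = 1 := by
  rw [← ofReal_integral_eq_lintegral_ofReal hp.integrable (.of_forall fun x => (hp.pos x).le),
    hp.integral_eq_one, ENNReal.ofReal_one]

theorem isProbabilityMeasure_dataLaw : IsProbabilityMeasure (dataLaw p) :=
  ⟨by simp [hp.lintegral_eq_one]⟩

theorem ouDensity_eq {t : ℝ} (ht : 0 < t) (x : Vec d) :
    ouDensity p t x = Real.exp (logDensity (dataLaw p) (t, x)) := by
  have := hp.isProbabilityMeasure_dataLaw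
  rw [ouDensity_eq_integral p ht, logDensity, Real.exp_add, logLaplace,
    Real.exp_log (laplace_pos (ouMap_mem (z := (t, x)) ht)), laplace, gaussLaplace,
    integral_withDensity_eq_integral_toReal_smul hp.continuous.measurable.ennreal_ofReal
      (.of_forall fun x => ENNReal.ofReal_lt_top), ← integral_const_mul]
  congr 1 with w
  rw [gaussianDensity_eq_exp ht, ENNReal.toReal_ofReal (hp.pos w).le]
  simp only [smul_eq_mul]
  ring

theorem lintegral_ouDensity {t : ℝ} (ht : 0 < t) :
    ∫⁻ x, ENNReal.ofReal (ouDensity p t x) = 1 := by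
  have hv := ouVar_pos ht
  have hc := continuous_gaussianDensity (d := d) (ouVar t)
  have hpc := hp.continuous
  have h1 : ∀ x, ENNReal.ofReal (ouDensity p t x) = ∫⁻ w, ENNReal.ofReal (p w) *
      ENNReal.ofReal (gaussianDensity (ouVar t) (x - Real.exp (-t) • w)) := fun x => by
    rw [ouDensity_eq_integral p ht, ofReal_integral_eq_lintegral_ofReal]
    · simp_rw [ENNReal.ofReal_mul (hp.pos _).le]
    -- Without integrability the Bochner integral would take the default value `0`, whereas the
    -- density has been identified with an exponential.
    · by_contra h
      have h2 := hp.ouDensity_eq ht x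
      rw [ouDensity_eq_integral p ht, integral_undef h] at h2
      exact (Real.exp_pos _).ne h2
    · exact .of_forall fun w => (mul_pos (hp.pos w) (gaussianDensity_pos hv _)).le
  simp_rw [h1]
  rw [lintegral_lintegral_swap]
  · simp_rw [lintegral_const_mul' _ _ ENNReal.ofReal_ne_top, lintegral_gaussianDensity hv, mul_one]
    exact hp.lintegral_eq_one
  · have : Continuous fun q : Vec d × Vec d =>
        gaussianDensity (ouVar t) (q.1 - Real.exp (-t) • q.2) := hc.comp (by fun_prop)
    refine (Measurable.mul ?_ this.measurable.ennreal_ofReal).aemeasurable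
    exact (hpc.comp continuous_snd).measurable.ennreal_ofReal

end IsDataDensity

/-- The spatial gradient of a function on space-time. -/
noncomputable def spaceGrad (u : ℝ × Vec d → ℝ) (z : ℝ × Vec d) : Vec d :=
  WithLp.toLp 2 fun i => dx i u z

@[simp]
theorem spaceGrad_apply (u : ℝ × Vec d → ℝ) (z : ℝ × Vec d) (i : Fin d) :
    spaceGrad u z i = dx i u z := rfl

theorem hasFDerivAt_slice {G : Type} [NormedAddCommGroup G] [NormedSpace ℝ G]
    {u : ℝ × Vec d → G} {t : ℝ} {x : Vec d} {u' : ℝ × Vec d →L[ℝ] G}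
    (h : HasFDerivAt u u' (t, x)) :
    HasFDerivAt (fun y => u (t, y)) (u'.comp (ContinuousLinearMap.inr ℝ ℝ (Vec d))) x :=
  h.comp x (hasFDerivAt_prodMk_right t x)

theorem gradient_slice {u : ℝ × Vec d → ℝ} {t : ℝ} {x : Vec d}
    (h : DifferentiableAt ℝ u (t, x)) : gradient (fun y => u (t, y)) x = spaceGrad u (t, x) := by
  ext i
  have h1 : ⟪gradient (fun y => u (t, y)) x, unitVec i⟫_ℝ = dx i u (t, x) := by
    rw [gradient, InnerProductSpace.toDual_symm_apply, (hasFDerivAt_slice h.hasFDerivAt).fderiv]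
    simp [pd]
  rw [spaceGrad_apply, ← h1, EuclideanSpace.inner_single_right]
  simp

theorem IsDataDensity.score_eq {p : Vec d → ℝ} {Ls : ℝ≥0} {T : ℝ} (hp : IsDataDensity p Ls T)
    {t : ℝ} (ht : 0 < t) (x : Vec d) :
    score p t x = spaceGrad (logDensity (dataLaw p)) (t, x) := by
  have := hp.isProbabilityMeasure_dataLaw
  rw [score]
  simp_rw [hp.ouDensity_eq ht, Real.log_exp]
  exact gradient_slice
    (differentiableAt_of_contDiffOn isOpen_posTime' contDiffOn_logDensity ht)

/-- The measure with density `exp u(t, ·)`. -/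
noncomputable def sliceLaw (u : ℝ × Vec d → ℝ) (t : ℝ) : Measure (Vec d) :=
  (volume : Measure (Vec d)).withDensity fun x => ENNReal.ofReal (Real.exp (u (t, x)))

/-- `u` is the logarithm of a smooth solution of the Fokker-Planck equation of the
Ornstein-Uhlenbeck process on the time interval `[a, b]`, of mass one and with `L`-Lipschitz
spatial gradient. -/
structure IsLogOU (u : ℝ × Vec d → ℝ) (L : ℝ≥0) (a b : ℝ) : Prop where
  pos : 0 < a
  contDiffOn : ContDiffOn ℝ ∞ u (posTime d)
  dt_eq : ∀ z ∈ posTime d, dt u z =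
    (∑ i, (dx i (dx i u) z + dx i u z ^ 2 + z.2 i * dx i u z)) + d
  lipschitz : ∀ t ∈ Icc a b, LipschitzWith L fun x => spaceGrad u (t, x)
  isProbabilityMeasure : ∀ t ∈ Icc a b, IsProbabilityMeasure (sliceLaw u t)

theorem IsDataDensity.ouLaw_eq {p : Vec d → ℝ} {Ls : ℝ≥0} {T : ℝ} (hp : IsDataDensity p Ls T)
    {t : ℝ} (ht : 0 < t) : ouLaw p t = sliceLaw (logDensity (dataLaw p)) t := by
  rw [ouLaw, sliceLaw]
  simp_rw [hp.ouDensity_eq ht]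

/-- This packages what the flow and energy estimates need, so that they can be carried out for `u`
with no further reference to the convolution. Starting at `a > 0` avoids any question of smoothness
at time zero. -/
theorem IsDataDensity.isLogOU {p : Vec d → ℝ} {Ls : ℝ≥0} {T a : ℝ} (hp : IsDataDensity p Ls T)
    (ha : 0 < a) : IsLogOU (logDensity (dataLaw p)) Ls a T := by
  have := hp.isProbabilityMeasure_dataLaw
  refine ⟨ha, contDiffOn_logDensity, fun z hz => dt_logDensity hz, fun t ht => ?_, fun t ht => ?_⟩
  · have h := hp.lipschitz_score t ⟨ha.le.trans ht.1, ht.2⟩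
    rwa [show score p t = _ from funext fun x => hp.score_eq (ha.trans_le ht.1) x] at h
  · rw [← hp.ouLaw_eq (ha.trans_le ht.1)]
    exact ⟨by simp [ouLaw, hp.lintegral_ouDensity (ha.trans_le ht.1)]⟩

end Link

/-! ### Global flows of Lipschitz fields and their spatial derivatives -/

section ODE

variable {E : Type} [NormedAddCommGroup E] [NormedSpace ℝ E]

/-- A time-dependent vector field on `[a, b]`, continuous in time and `K`-Lipschitz in space. -/
structure IsLipschitzField (f : ℝ → E → E) (K : ℝ≥0) (a b : ℝ) : Prop where
  lipschitz : ∀ t ∈ Icc a b, LipschitzWith K (f t)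
  continuousOn : ∀ x, ContinuousOn (fun t => f t x) (Icc a b)

variable {f : ℝ → E → E} {K : ℝ≥0} {a b c t₀ : ℝ}

theorem IsLipschitzField.mono (hf : IsLipschitzField f K a b) {a' b' : ℝ}
    (h : Icc a' b' ⊆ Icc a b) : IsLipschitzField f K a' b' :=
  ⟨fun t ht => hf.lipschitz t (h ht), fun x => (hf.continuousOn x).mono h⟩

theorem _root_.IsIntegralCurveOn.glue {y₁ y₂ : ℝ → E} (h₁ : IsIntegralCurveOn y₁ f (Icc a c))
    (h₂ : IsIntegralCurveOn y₂ f (Icc c b)) (hc : y₁ c = y₂ c) (hac : a ≤ c) (hcb : c ≤ b) :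
    ∃ y : ℝ → E, EqOn y y₁ (Icc a c) ∧ EqOn y y₂ (Icc c b) ∧ IsIntegralCurveOn y f (Icc a b) := by
  classical
  set y : ℝ → E := fun t => if t ≤ c then y₁ t else y₂ t with hy
  have e₁ : EqOn y y₁ (Icc a c) := fun t ht => by simp [hy, ht.2]
  have e₂ : EqOn y y₂ (Icc c b) := fun t ht => by
    rcases ht.1.eq_or_lt with rfl | h
    · simp [hy, hc]
    · simp [hy, h.not_ge]
  refine ⟨y, e₁, e₂, fun t ht => ?_⟩
  have d₁ : t ∈ Icc a c → HasDerivWithinAt y (f t (y t)) (Icc a c) t := fun h => by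
    rw [e₁ h]; exact (h₁ t h).congr_of_mem e₁ h
  have d₂ : t ∈ Icc c b → HasDerivWithinAt y (f t (y t)) (Icc c b) t := fun h => by
    rw [e₂ h]; exact (h₂ t h).congr_of_mem e₂ h
  rcases lt_trichotomy t c with h | h | h
  · refine (d₁ ⟨ht.1, h.le⟩).mono_of_mem_nhdsWithin ?_
    filter_upwards [self_mem_nhdsWithin, mem_nhdsWithin_of_mem_nhds (Iio_mem_nhds h)] with s hs hs'
    exact ⟨hs.1, le_of_lt hs'⟩
  · rw [← Icc_union_Icc_eq_Icc hac hcb]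
    exact (d₁ ⟨ht.1, h.le⟩).union (d₂ ⟨h.ge, ht.2⟩)
  · refine (d₂ ⟨h.le, ht.2⟩).mono_of_mem_nhdsWithin ?_
    filter_upwards [self_mem_nhdsWithin, mem_nhdsWithin_of_mem_nhds (Ioi_mem_nhds h)] with s hs hs'
    exact ⟨le_of_lt hs', hs.2⟩

variable [CompleteSpace E]

/-- On the ball of radius `1 + ‖x‖` around `x` the field is at most `2 (M + K + 1) (1 + ‖x‖)`.
Radius and bound scale alike in `x`, so the admissible length of the interval is independent of the
initial value and the argument can be iterated. -/
theorem IsLipschitzField.exists_integralCurve_of_short (hf : IsLipschitzField f K a b) {M : ℝ≥0}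
    (hM : ∀ t ∈ Icc a b, ‖f t 0‖ ≤ M) (ht₀ : t₀ ∈ Icc a b)
    (hab : (b - a) * (2 * (M + K + 1)) ≤ 1) (x : E) :
    ∃ y : ℝ → E, y t₀ = x ∧ IsIntegralCurveOn y f (Icc a b) := by
  have h : IsPicardLindelof f ⟨t₀, ht₀⟩ x (1 + ‖x‖₊) 0 (2 * (M + K + 1) * (1 + ‖x‖₊)) K := by
    refine ⟨fun t ht => (hf.lipschitz t ht).lipschitzOnWith, fun x _ => hf.continuousOn x,
      fun t ht z hz => ?_, ?_⟩
    · have h1 : ‖f t z‖ ≤ M + K * ‖z‖ := by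
        have h2 := (hf.lipschitz t ht).dist_le_mul z 0
        rw [dist_eq_norm, dist_zero_right] at h2
        linarith [norm_le_norm_add_norm_sub (f t 0) (f t z), hM t ht,
          norm_sub_rev (f t 0) (f t z)]
      have h2 : ‖z‖ ≤ 2 * ‖x‖ + 1 := by
        rw [mem_closedBall_iff_norm] at hz
        push_cast at hz
        linarith [norm_le_norm_add_norm_sub x z, norm_sub_rev x z]
      refine h1.trans ?_
      push_cast
      have := mul_le_mul_of_nonneg_left h2 K.2
      simp only [NNReal.val_eq_coe] at this
      nlinarith [M.2, K.2, norm_nonneg x, mul_nonneg M.2 (norm_nonneg x)]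
    · push_cast
      have h1 : max (b - t₀) (t₀ - a) ≤ b - a :=
        max_le (by linarith [ht₀.1]) (by linarith [ht₀.2])
      have h2 : (0 : ℝ) ≤ 2 * (M + K + 1) * (1 + ‖x‖) := by positivity
      calc _ ≤ (2 * (M + K + 1) * (1 + ‖x‖)) * (b - a) := mul_le_mul_of_nonneg_left h1 h2
        _ = ((b - a) * (2 * (M + K + 1))) * (1 + ‖x‖) := by ring
        _ ≤ 1 * (1 + ‖x‖) := by gcongr
        _ = _ := by ring
  exact h.exists_eq_forall_mem_Icc_hasDerivWithinAt₀

theorem IsLipschitzField.exists_integralCurve_aux (n : ℕ) : ∀ {a b t₀ : ℝ},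
    IsLipschitzField f K a b → ∀ {M : ℝ≥0}, (∀ t ∈ Icc a b, ‖f t 0‖ ≤ M) → t₀ ∈ Icc a b →
    (b - a) * (2 * (M + K + 1)) ≤ n + 1 → ∀ x : E,
    ∃ y : ℝ → E, y t₀ = x ∧ IsIntegralCurveOn y f (Icc a b) := by
  induction n with
  | zero => exact fun hf _ hM ht h x => hf.exists_integralCurve_of_short hM ht (by simpa using h) x
  | succ n ih =>
    intro a b t₀ hf M hM ht h x
    push_cast at h
    have hab : a ≤ b := ht.1.trans ht.2
    obtain ⟨c, hac, hcb, h1, h2⟩ : ∃ c, a ≤ c ∧ c ≤ b ∧ (c - a) * (2 * (M + K + 1)) ≤ n + 1 ∧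
        (b - c) * (2 * (M + K + 1)) ≤ 1 := by
      have hn : (0 : ℝ) < n + 2 := by positivity
      -- The last of `n + 2` equal pieces is short enough for Picard–Lindelöf, and the rest is
      -- within reach of the induction hypothesis. The solution is built first on the side
      -- containing `t₀` and then continued from the cut point.
      refine ⟨b - (b - a) / (n + 2), ?_, ?_, ?_, ?_⟩
      · have : (b - a) / (n + 2) ≤ b - a := div_le_self (by linarith) (by linarith)
        linarith
      · have : 0 ≤ (b - a) / (n + 2) := div_nonneg (by linarith) hn.le
        linarith
      · have : (b - (b - a) / (n + 2) - a) * (2 * (M + K + 1)) =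
            ((b - a) * (2 * (M + K + 1))) * ((n + 1) / (n + 2)) := by field_simp; ring
        rw [this]
        calc _ ≤ (n + 1 + 1 : ℝ) * ((n + 1) / (n + 2)) := by gcongr
          _ = n + 1 := by field_simp; ring
      · have : (b - (b - (b - a) / (n + 2))) * (2 * (M + K + 1)) =
            ((b - a) * (2 * (M + K + 1))) / (n + 2) := by field_simp; ring
        rw [this, div_le_one hn]
        linarith
    have s1 : Icc a c ⊆ Icc a b := Icc_subset_Icc_right hcb
    have s2 : Icc c b ⊆ Icc a b := Icc_subset_Icc_left hac
    rcases le_total t₀ c with h0 | h0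
    · obtain ⟨y₁, e₁, h₁⟩ := ih (hf.mono s1) (fun t ht => hM t (s1 ht)) ⟨ht.1, h0⟩ h1 x
      obtain ⟨y₂, e₂, h₂⟩ := (hf.mono s2).exists_integralCurve_of_short
        (fun t ht => hM t (s2 ht)) ⟨le_rfl, hcb⟩ h2 (y₁ c)
      obtain ⟨y, g₁, -, hy⟩ := IsIntegralCurveOn.glue h₁ h₂ e₂.symm hac hcb
      exact ⟨y, (g₁ ⟨ht.1, h0⟩).trans e₁, hy⟩
    · obtain ⟨y₂, e₂, h₂⟩ := (hf.mono s2).exists_integralCurve_of_short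
        (fun t ht => hM t (s2 ht)) ⟨h0, ht.2⟩ h2 x
      obtain ⟨y₁, e₁, h₁⟩ := ih (hf.mono s1) (fun t ht => hM t (s1 ht)) ⟨hac, le_rfl⟩ h1 (y₂ c)
      obtain ⟨y, -, g₂, hy⟩ := IsIntegralCurveOn.glue h₁ h₂ e₁ hac hcb
      exact ⟨y, (g₂ ⟨h0, ht.2⟩).trans e₂, hy⟩

/-- Global existence for Lipschitz vector fields. -/
theorem IsLipschitzField.exists_integralCurve (hf : IsLipschitzField f K a b)
    (ht₀ : t₀ ∈ Icc a b) (x : E) :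
    ∃ y : ℝ → E, y t₀ = x ∧ IsIntegralCurveOn y f (Icc a b) := by
  obtain ⟨M, hM⟩ := isCompact_Icc.exists_bound_of_continuousOn (hf.continuousOn 0)
  have hM' : ∀ t ∈ Icc a b, ‖f t 0‖ ≤ M.toNNReal := fun t ht => (hM t ht).trans (le_max_left _ _)
  obtain ⟨n, hn⟩ := exists_nat_ge ((b - a) * (2 * (M.toNNReal + K + 1)))
  exact hf.exists_integralCurve_aux n hM' ht₀ (by linarith) x

omit [CompleteSpace E]

theorem _root_.IsIntegralCurveOn.hasDerivWithinAt_Ici {y : ℝ → E} (hy : IsIntegralCurveOn y f (Icc a b))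
    {t : ℝ} (ht : t ∈ Ico a b) : HasDerivWithinAt y (f t (y t)) (Ici t) t :=
  (hy t (Ico_subset_Icc_self ht)).mono_of_mem_nhdsWithin (Icc_mem_nhdsGE_of_mem ht)

theorem _root_.IsIntegralCurveOn.hasDerivWithinAt_Iic {y : ℝ → E} (hy : IsIntegralCurveOn y f (Icc a b))
    {t : ℝ} (ht : t ∈ Ioc a b) : HasDerivWithinAt y (f t (y t)) (Iic t) t :=
  (hy t (Ioc_subset_Icc_self ht)).mono_of_mem_nhdsWithin (Icc_mem_nhdsLE_of_mem ht)

theorem IsLipschitzField.dist_le (hf : IsLipschitzField f K a b) {y₁ y₂ : ℝ → E}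
    (h₁ : IsIntegralCurveOn y₁ f (Icc a b)) (h₂ : IsIntegralCurveOn y₂ f (Icc a b)) {t : ℝ}
    (ht : t ∈ Icc a b) : dist (y₁ t) (y₂ t) ≤ dist (y₁ a) (y₂ a) * Real.exp (K * (t - a)) :=
  dist_le_of_trajectories_ODE_of_mem (v := f) (s := fun _ => univ)
    (fun t ht => (hf.lipschitz t (Ico_subset_Icc_self ht)).lipschitzOnWith)
    (fun t ht => (h₁ t ht).continuousWithinAt) (fun _ ht => h₁.hasDerivWithinAt_Ici ht)
    (fun _ _ => mem_univ _) (fun t ht => (h₂ t ht).continuousWithinAt)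
    (fun _ ht => h₂.hasDerivWithinAt_Ici ht) (fun _ _ => mem_univ _) le_rfl t ht

theorem IsLipschitzField.eqOn_of_eq_right (hf : IsLipschitzField f K a b) {y₁ y₂ : ℝ → E}
    (h₁ : IsIntegralCurveOn y₁ f (Icc a b)) (h₂ : IsIntegralCurveOn y₂ f (Icc a b))
    (h : y₁ b = y₂ b) : EqOn y₁ y₂ (Icc a b) :=
  ODE_solution_unique_of_mem_Icc_left (v := f) (s := fun _ => univ)
    (fun t ht => (hf.lipschitz t (Ioc_subset_Icc_self ht)).lipschitzOnWith)
    (fun t ht => (h₁ t ht).continuousWithinAt) (fun _ ht => h₁.hasDerivWithinAt_Iic ht)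
    (fun _ _ => mem_univ _) (fun t ht => (h₂ t ht).continuousWithinAt)
    (fun _ ht => h₂.hasDerivWithinAt_Iic ht) (fun _ _ => mem_univ _) h

theorem IsLipschitzField.eq_left_of_eq (hf : IsLipschitzField f K a b) {y₁ y₂ : ℝ → E}
    (h₁ : IsIntegralCurveOn y₁ f (Icc a b)) (h₂ : IsIntegralCurveOn y₂ f (Icc a b)) {t : ℝ}
    (ht : t ∈ Icc a b) (h : y₁ t = y₂ t) : y₁ a = y₂ a := by
  have s : Icc a t ⊆ Icc a b := Icc_subset_Icc_right ht.2
  exact (hf.mono s).eqOn_of_eq_right (h₁.mono s) (h₂.mono s) h ⟨le_rfl, ht.1⟩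

theorem gronwallBound_zero_eq_mul (K e x : ℝ) :
    gronwallBound 0 K e x = e * gronwallBound 0 K 1 x := by
  by_cases h : K = 0
  · simp [h, gronwallBound_K0]
  · simp [gronwallBound_of_K_ne_0 h]
    ring

/-- Differentiable dependence of the solutions on the initial value. -/
theorem IsLipschitzField.exists_hasFDerivAt [CompleteSpace E] [ProperSpace E]
    (hf : IsLipschitzField f K a b)
    {A : ℝ → E → E →L[ℝ] E} (hA : ∀ t ∈ Icc a b, ∀ x, HasFDerivAt (f t) (A t x) x)
    (hAc : ContinuousOn (fun z : ℝ × E => A z.1 z.2) (Icc a b ×ˢ univ)) {Φ : ℝ → E → E}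
    (hΦa : ∀ x, Φ a x = x) (hΦ : ∀ x, IsIntegralCurveOn (fun t => Φ t x) f (Icc a b)) (x : E) :
    ∃ J : ℝ → E →L[ℝ] E, J a = .id ℝ E ∧
      (∀ t ∈ Icc a b, HasDerivWithinAt J ((A t (Φ t x)).comp (J t)) (Icc a b) t) ∧
      ∀ t ∈ Icc a b, HasFDerivAt (Φ t) (J t) x := by
  rcases lt_or_ge b a with hba | hab
  · exact ⟨fun _ => .id ℝ E, rfl, by simp [hba], by simp [hba]⟩
  have hAK : ∀ t ∈ Icc a b, ∀ x, ‖A t x‖ ≤ K := fun t ht x =>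
    (hA t ht x).le_of_lipschitz (hf.lipschitz t ht)
  have hcurve : ContinuousOn (fun t => Φ t x) (Icc a b) :=
    fun t ht => (hΦ x t ht).continuousWithinAt
  -- The candidate derivative solves the variational equation `J' = A(t, Φ_t x) J`. This equation is
  -- linear in `J`, and it has Lipschitz constant `K` because the operators `A` are bounded by `K`.
  have hg : IsLipschitzField (fun t (M : E →L[ℝ] E) => (A t (Φ t x)).comp M) K a b := by
    refine ⟨fun t ht => LipschitzWith.of_dist_le_mul fun M N => ?_, fun M => ?_⟩
    · rw [dist_eq_norm, dist_eq_norm, ← ContinuousLinearMap.comp_sub]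
      exact (ContinuousLinearMap.opNorm_comp_le _ _).trans
        (mul_le_mul_of_nonneg_right (hAK t ht _) (norm_nonneg _))
    · have h1 : ContinuousOn (fun t => A t (Φ t x)) (Icc a b) :=
        hAc.comp (f := fun t => (t, Φ t x)) (continuousOn_id.prodMk hcurve)
          fun t ht => ⟨ht, mem_univ _⟩
      exact h1.clm_comp continuousOn_const
  obtain ⟨J, hJa, hJ⟩ := hg.exists_integralCurve (left_mem_Icc.2 hab) (.id ℝ E)
  refine ⟨J, hJa, hJ, ?_⟩
  -- uniform differentiability along the curve
  obtain ⟨R, hR⟩ := isCompact_Icc.exists_bound_of_continuousOn hcurve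
  have hcpt : IsCompact (Icc a b ×ˢ Metric.closedBall (0 : E) (R + 1)) :=
    isCompact_Icc.prod (isCompact_closedBall _ _)
  have huc := hcpt.uniformContinuousOn_of_continuous
    (hAc.mono (prod_mono_right (subset_univ _)))
  have key : ∀ ε > 0, ∃ η > 0, ∀ t ∈ Icc a b, ∀ y, ‖y - Φ t x‖ ≤ η →
      ‖f t y - f t (Φ t x) - A t (Φ t x) (y - Φ t x)‖ ≤ ε * ‖y - Φ t x‖ := by
    intro ε hε
    obtain ⟨η, hη, h⟩ := Metric.uniformContinuousOn_iff_le.1 huc ε hε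
    refine ⟨min η 1, by positivity, fun t ht y hy => ?_⟩
    have hb : ∀ z ∈ Metric.closedBall (Φ t x) (min η 1), ‖A t z - A t (Φ t x)‖ ≤ ε := by
      intro z hz
      have hz1 : dist z (Φ t x) ≤ 1 := (Metric.mem_closedBall.1 hz).trans (min_le_right _ _)
      have hz2 : dist z (Φ t x) ≤ η := (Metric.mem_closedBall.1 hz).trans (min_le_left _ _)
      have := h (t, z) ⟨ht, ?_⟩ (t, Φ t x) ⟨ht, ?_⟩ ?_
      · rwa [dist_eq_norm] at this
      · rw [mem_closedBall_zero_iff]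
        rw [dist_eq_norm] at hz1
        linarith [norm_le_norm_add_norm_sub (Φ t x) z, hR t ht, norm_sub_rev z (Φ t x)]
      · rw [mem_closedBall_zero_iff]
        linarith [hR t ht]
      · rw [Prod.dist_eq, dist_self]
        exact max_le hη.le hz2
    exact (convex_closedBall _ _).norm_image_sub_le_of_norm_hasFDerivWithin_le'
      (fun z _ => (hA t ht z).hasFDerivWithinAt) hb
      (Metric.mem_closedBall_self (by positivity)) (mem_closedBall_iff_norm.2 hy)
  intro t ht
  rw [hasFDerivAt_iff_isLittleO_nhds_zero, Asymptotics.isLittleO_iff]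
  intro ε hε
  set C := gronwallBound 0 K 1 (b - a) with hC
  have hC0 : 0 ≤ C := by
    have := gronwallBound_mono (K := K) le_rfl zero_le_one K.2 (sub_nonneg.2 hab)
    rwa [gronwallBound_x0] at this
  set M := Real.exp (K * (b - a)) with hM
  have hM0 : 0 < M := Real.exp_pos _
  -- `M` is the growth factor of the difference of two trajectories and `C` is the Gronwall factor
  -- for the inhomogeneous term. Dividing by `M * C + 1` leaves at most `ε` in total.
  obtain ⟨η, hη, hk⟩ := key (ε / (M * C + 1)) (by positivity)
  filter_upwards [Metric.closedBall_mem_nhds (0 : E) (div_pos hη hM0)] with k hk0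
  rw [mem_closedBall_zero_iff, le_div_iff₀ hM0] at hk0
  have hd : ∀ s ∈ Icc a b, ‖Φ s (x + k) - Φ s x‖ ≤ ‖k‖ * M := fun s hs => by
    have := hf.dist_le (hΦ (x + k)) (hΦ x) hs
    simp only [hΦa, dist_eq_norm, add_sub_cancel_left] at this
    exact this.trans (by rw [hM]; gcongr; exact hs.2)
  have hgr := norm_le_gronwallBound_of_norm_deriv_right_le
    (f := fun s => Φ s (x + k) - Φ s x - J s k)
    (f' := fun s => f s (Φ s (x + k)) - f s (Φ s x) - (A s (Φ s x)).comp (J s) k)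
    (δ := 0) (K := K) (ε := ε / (M * C + 1) * (‖k‖ * M)) (a := a) (b := b) ?_ ?_ ?_ ?_ t ht
  · rw [gronwallBound_zero_eq_mul] at hgr
    calc _ ≤ _ := hgr
      _ ≤ (ε / (M * C + 1) * (‖k‖ * M)) * C := by
        refine mul_le_mul_of_nonneg_left ?_ (by positivity)
        exact gronwallBound_mono le_rfl zero_le_one K.2 (by linarith [ht.2])
      _ = ε * ‖k‖ * ((M * C) / (M * C + 1)) := by ring
      _ ≤ ε * ‖k‖ * 1 := by
        gcongr
        rw [div_le_one (by positivity)]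
        linarith
      _ = _ := by ring
  · intro s hs
    exact (((hΦ (x + k) s hs).continuousWithinAt.sub (hΦ x s hs).continuousWithinAt).sub
      ((hJ s hs).continuousWithinAt.clm_apply continuousWithinAt_const))
  · intro s hs
    have h3 : HasDerivWithinAt (fun s => J s k) ((A s (Φ s x)).comp (J s) k) (Ici s) s := by
      have := (IsIntegralCurveOn.hasDerivWithinAt_Ici hJ hs).clm_apply
        (hasDerivWithinAt_const s (Ici s) k)
      simpa using this
    exact (((hΦ (x + k)).hasDerivWithinAt_Ici hs).sub ((hΦ x).hasDerivWithinAt_Ici hs)).sub h3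
  · simp [hΦa, hJa]
  · intro s hs
    have hs' := Ico_subset_Icc_self hs
    -- The error `Φ(x + k) - Φ(x) - J k` solves the linearized equation up to the Taylor remainder
    -- of the field, which is the small inhomogeneity in Gronwall's inequality.
    have e : f s (Φ s (x + k)) - f s (Φ s x) - (A s (Φ s x)).comp (J s) k =
        (f s (Φ s (x + k)) - f s (Φ s x) - A s (Φ s x) (Φ s (x + k) - Φ s x)) +
          A s (Φ s x) (Φ s (x + k) - Φ s x - J s k) := by
      simp
    rw [e, add_comm]
    refine (norm_add_le _ _).trans (add_le_add ?_ ?_)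
    · exact ((A s (Φ s x)).le_opNorm _).trans
        (mul_le_mul_of_nonneg_right (hAK s hs' _) (norm_nonneg _))
    · refine (hk s hs' _ ((hd s hs').trans hk0)).trans ?_
      gcongr
      exact hd s hs'

end ODE

/-! ### The derivative of the determinant -/

section Det

variable {d : ℕ}

theorem differentiable_matrix_det :
    Differentiable ℝ fun M : Fin d → Fin d → ℝ => Matrix.det (Matrix.of M) := by
  simp only [Matrix.det_apply, Matrix.of_apply]
  fun_prop

/-- The trace of an endomorphism of `ℝ^d`, in coordinates. -/
noncomputable def coordTrace (A : Vec d →L[ℝ] Vec d) : ℝ := ∑ i, A (unitVec i) i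

theorem hasDerivAt_det_one_add_smul (B : Matrix (Fin d) (Fin d) ℝ) :
    HasDerivAt (fun s : ℝ => (1 + s • B).det) B.trace 0 := by
  rw [funext fun s : ℝ => Matrix.det_one_add_smul s B]
  have h := ((hasDerivAt_id (0 : ℝ)).const_mul B.trace).const_add 1
  have h2 := ((Polynomial.hasDerivAt
    (Matrix.det (1 + (Polynomial.X : Polynomial ℝ) • B.map Polynomial.C)).divX.divX (0 : ℝ)).mul
      (hasDerivAt_pow 2 (0 : ℝ)))
  refine (h.add h2).congr_deriv ?_
  simp

/-- The determinant is a polynomial in the entries, hence differentiable. Only the direction `B ∘ A`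
is needed, and there the factorization `A + s B A = (1 + s B) A` reduces the computation to the
identity, with no invertibility of `A`. -/
theorem hasFDerivAt_clm_det (A B : Vec d →L[ℝ] Vec d) :
    ∃ D : (Vec d →L[ℝ] Vec d) →L[ℝ] ℝ, HasFDerivAt (fun A : Vec d →L[ℝ] Vec d => A.det) D A ∧
      D (B.comp A) = coordTrace B * A.det := by
  set b := (EuclideanSpace.basisFun (Fin d) ℝ).toBasis with hb
  let T : (Vec d →L[ℝ] Vec d) →ₗ[ℝ] (Fin d → Fin d → ℝ) :=
    { toFun := fun A => LinearMap.toMatrix b b (A : Vec d →ₗ[ℝ] Vec d)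
      map_add' := fun A B => by simp; rfl
      map_smul' := fun c A => by simp; rfl }
  have hT : ∀ A : Vec d →L[ℝ] Vec d, A.det = Matrix.det (Matrix.of (T A)) := fun A =>
    (LinearMap.det_toMatrix b (A : Vec d →ₗ[ℝ] Vec d)).symm
  have hT' : DifferentiableAt ℝ (fun A : Vec d →L[ℝ] Vec d => T A) A :=
    (LinearMap.toContinuousLinearMap T).differentiableAt
  have h1 : DifferentiableAt ℝ (fun A : Vec d →L[ℝ] Vec d => A.det) A := by
    simp_rw [hT]
    exact (differentiable_matrix_det (d := d)).differentiableAt.comp A hT'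
  refine ⟨_, h1.hasFDerivAt, ?_⟩
  have h2 : HasDerivAt (fun s : ℝ => A + s • B.comp A) (B.comp A) 0 := by
    simpa using ((hasDerivAt_id (0 : ℝ)).smul_const (B.comp A)).const_add A
  have h0 : A = A + (0 : ℝ) • B.comp A := by ext; simp
  have h3 := h1.hasFDerivAt.comp_hasDerivAt_of_eq (0 : ℝ) h2 h0
  have h4 : HasDerivAt (fun s : ℝ => (1 + s • LinearMap.toMatrix b b
      (B : Vec d →ₗ[ℝ] Vec d)).det * A.det) (Matrix.trace (LinearMap.toMatrix b b
      (B : Vec d →ₗ[ℝ] Vec d)) * A.det) 0 := (hasDerivAt_det_one_add_smul _).mul_const _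
  have h5 : (fun s : ℝ => (1 + s • LinearMap.toMatrix b b
      (B : Vec d →ₗ[ℝ] Vec d)).det * A.det) =
      (fun A : Vec d →L[ℝ] Vec d => A.det) ∘ fun s : ℝ => A + s • B.comp A := by
    ext s
    have e1 : A + s • B.comp A = (ContinuousLinearMap.id ℝ _ + s • B).comp A := by
      ext; simp
    have e2 : ((ContinuousLinearMap.id ℝ _ + s • B).comp A).det =
        (ContinuousLinearMap.id ℝ _ + s • B).det * A.det := LinearMap.det_comp _ _
    simp only [Function.comp]
    rw [e1, e2]
    congr 1
    rw [ContinuousLinearMap.det, ← LinearMap.det_toMatrix b]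
    simp
  rw [h5] at h4
  rw [h3.unique h4]
  congr 1

theorem hasDerivWithinAt_clm_det {J : ℝ → Vec d →L[ℝ] Vec d} {B : Vec d →L[ℝ] Vec d} {s : Set ℝ}
    {t : ℝ} (h : HasDerivWithinAt J (B.comp (J t)) s t) :
    HasDerivWithinAt (fun t => (J t).det) (coordTrace B * (J t).det) s t := by
  obtain ⟨D, hD, e⟩ := hasFDerivAt_clm_det (J t) B
  rw [← e]
  exact hD.comp_hasDerivWithinAt t h

end Det

/-! ### The probability flow transports the laws -/

section Flow

variable {d : ℕ}

/-- The vector field `-x - ∇u` of the probability flow. -/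
noncomputable def ouField (u : ℝ × Vec d → ℝ) (t : ℝ) (x : Vec d) : Vec d :=
  -x - spaceGrad u (t, x)

/-- The spatial derivative of the vector field of the probability flow. -/
noncomputable def ouFieldDeriv (u : ℝ × Vec d → ℝ) (t : ℝ) (x : Vec d) : Vec d →L[ℝ] Vec d :=
  (fderiv ℝ (fun z : ℝ × Vec d => ouField u z.1 z.2) (t, x)).comp
    (ContinuousLinearMap.inr ℝ ℝ (Vec d))

theorem prodMk_mem_posTime {t : ℝ} (ht : 0 < t) (x : Vec d) : (t, x) ∈ posTime d := ht

variable {u : ℝ × Vec d → ℝ} {L : ℝ≥0} {a b t : ℝ}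

theorem contDiffOn_spaceGrad (hu : ContDiffOn ℝ ∞ u (posTime d)) :
    ContDiffOn ℝ ∞ (spaceGrad u) (posTime d) := by
  rw [contDiffOn_piLp]
  exact fun i => contDiffOn_pd isOpen_posTime' hu _

theorem contDiffOn_ouField (hu : ContDiffOn ℝ ∞ u (posTime d)) :
    ContDiffOn ℝ ∞ (fun z : ℝ × Vec d => ouField u z.1 z.2) (posTime d) :=
  contDiff_snd.contDiffOn.neg.sub (contDiffOn_spaceGrad hu)

theorem hasFDerivAt_ouField (hu : ContDiffOn ℝ ∞ u (posTime d)) (ht : 0 < t) (x : Vec d) :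
    HasFDerivAt (ouField u t) (ouFieldDeriv u t x) x :=
  hasFDerivAt_slice (u := fun z : ℝ × Vec d => ouField u z.1 z.2)
    (((contDiffOn_ouField hu).contDiffAt
      (isOpen_posTime'.mem_nhds (prodMk_mem_posTime ht x))).differentiableAt
        (by simp)).hasFDerivAt

theorem ouFieldDeriv_unitVec (hu : ContDiffOn ℝ ∞ u (posTime d)) (ht : 0 < t) (x : Vec d)
    (i j : Fin d) : ouFieldDeriv u t x (unitVec i) j =
      -(unitVec i : Vec d) j - dx i (dx j u) (t, x) := by
  have h1 : HasFDerivAt (fun y => ouField u t y j) _ x :=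
    ((EuclideanSpace.proj (𝕜 := ℝ) j).hasFDerivAt).comp x (hasFDerivAt_ouField hu ht x)
  have h2 : HasFDerivAt (fun y : Vec d => -y j - dx j u (t, y)) _ x :=
    ((EuclideanSpace.proj (𝕜 := ℝ) j).hasFDerivAt.neg).sub (hasFDerivAt_slice
      (differentiableAt_of_contDiffOn isOpen_posTime' (contDiffOn_pd isOpen_posTime' hu _)
        (prodMk_mem_posTime ht x)).hasFDerivAt)
  have h3 := congrArg (fun D : Vec d →L[ℝ] ℝ => D (unitVec i)) (h1.unique h2)
  simpa [pd] using h3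

theorem coordTrace_ouFieldDeriv (hu : ContDiffOn ℝ ∞ u (posTime d)) (ht : 0 < t) (x : Vec d) :
    coordTrace (ouFieldDeriv u t x) = -d - ∑ i, dx i (dx i u) (t, x) := by
  simp [coordTrace, ouFieldDeriv_unitVec hu ht]

/-- The derivative of a space-time function along a curve. -/
theorem hasDerivWithinAt_comp_curve {f : ℝ × Vec d → ℝ} {y : ℝ → Vec d} {y' : Vec d} {s : Set ℝ}
    (hf : DifferentiableAt ℝ f (t, y t)) (hy : HasDerivWithinAt y y' s t) :
    HasDerivWithinAt (fun r => f (r, y r)) (dt f (t, y t) + ∑ i, y' i * dx i f (t, y t)) s t := by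
  have h := hf.hasFDerivAt.comp_hasDerivWithinAt_of_eq t ((hasDerivWithinAt_id t s).prodMk hy) rfl
  have e := pd_eq_dt_add_sum_dx f (t, y t) (1, y')
  simp only [one_mul] at e
  rw [← e]
  exact h

/-- A flow of the probability flow equation, parametrized by the value at time `a`. -/
structure IsOUFlow (u : ℝ × Vec d → ℝ) (a b : ℝ) (Φ : ℝ → Vec d → Vec d) : Prop where
  init : ∀ x, Φ a x = x
  curve : ∀ x, IsIntegralCurveOn (fun t => Φ t x) (ouField u) (Icc a b)

namespace IsLogOU

variable (h : IsLogOU u L a b)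

include h

theorem isLipschitzField : IsLipschitzField (ouField u) (1 + L) a b := by
  refine ⟨fun t ht => ?_, fun x t ht => ?_⟩
  · exact (LipschitzWith.id.neg).sub (h.lipschitz t ht)
  · have := (contDiffOn_ouField h.contDiffOn).continuousOn.continuousAt
      (isOpen_posTime'.mem_nhds (prodMk_mem_posTime (h.pos.trans_le ht.1) x))
    exact (this.comp (f := fun t => (t, x)) (by fun_prop)).continuousWithinAt

theorem exists_flow (hab : a ≤ b) : ∃ Φ, IsOUFlow u a b Φ := by
  choose y h1 h2 using fun x => h.isLipschitzField.exists_integralCurve (left_mem_Icc.2 hab) x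
  exact ⟨fun t x => y x t, h1, h2⟩

theorem continuousOn_ouFieldDeriv :
    ContinuousOn (fun z : ℝ × Vec d => ouFieldDeriv u z.1 z.2) (Icc a b ×ˢ univ) := by
  have h1 : ContinuousOn (fderiv ℝ (fun z : ℝ × Vec d => ouField u z.1 z.2)) (posTime d) :=
    ((contDiffOn_ouField h.contDiffOn).fderiv_of_isOpen (m := ∞) isOpen_posTime'
      (by simp)).continuousOn
  exact (h1.mono fun z hz => h.pos.trans_le hz.1.1).clm_comp continuousOn_const

theorem continuous_slice (ht : 0 < t) : Continuous fun x => u (t, x) := by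
  refine continuous_iff_continuousAt.2 fun x => ?_
  have := h.contDiffOn.continuousOn.continuousAt
    (isOpen_posTime'.mem_nhds (prodMk_mem_posTime ht x))
  exact this.comp (f := fun x => (t, x)) (by fun_prop)

variable {Φ : ℝ → Vec d → Vec d} (hΦ : IsOUFlow u a b Φ)

include hΦ

/-- Injectivity is uniqueness backwards in time. For surjectivity, the solution prescribed at time
`t` exists on the whole interval, and its value at `a` is the preimage. -/
theorem bijective_flow (ht : t ∈ Icc a b) : Function.Bijective (Φ t) := by
  constructor
  · intro x y hxy
    have := h.isLipschitzField.eq_left_of_eq (hΦ.curve x) (hΦ.curve y) ht hxy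
    simpa only [hΦ.init] using this
  · intro z
    obtain ⟨y, hy, hc⟩ := h.isLipschitzField.exists_integralCurve ht z
    refine ⟨y a, ?_⟩
    have hl := h.isLipschitzField.dist_le (hΦ.curve (y a)) hc ht
    simp only [hΦ.init, dist_self, zero_mul] at hl
    rw [dist_le_zero.1 hl, hy]

theorem dist_flow_le (ht : t ∈ Icc a b) (x y : Vec d) :
    dist (Φ t x) (Φ t y) ≤ dist x y * Real.exp ((1 + L : ℝ≥0) * (b - a)) := by
  have := h.isLipschitzField.dist_le (hΦ.curve x) (hΦ.curve y) ht
  simp only [hΦ.init] at this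
  refine this.trans ?_
  gcongr
  exact ht.2

theorem continuousOn_flow :
    ContinuousOn (fun z : ℝ × Vec d => Φ z.1 z.2) (Icc a b ×ˢ univ) := by
  refine continuousOn_prod_of_continuousOn_lipschitzOnWith' _
    (Real.exp ((1 + L : ℝ≥0) * (b - a))).toNNReal (fun t ht => ?_) (fun x _ => ?_)
  · refine LipschitzOnWith.of_dist_le_mul fun x _ y _ => ?_
    rw [Real.coe_toNNReal _ (Real.exp_nonneg _), mul_comm]
    exact h.dist_flow_le hΦ ht x y
  · exact fun t ht => (hΦ.curve x t ht).continuousWithinAt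

theorem continuous_flow (ht : t ∈ Icc a b) : Continuous (Φ t) := by
  have := (h.continuousOn_flow hΦ).comp_continuous (f := fun x => (t, x)) (by fun_prop)
    fun x => ⟨ht, mem_univ _⟩
  exact this

/-- Along a trajectory the equation for `u` gives `du/dt = Δu + d`, since the terms `|∇u|² + x·∇u`
are cancelled by the transport. This is minus the trace of the linearized field, so the product of
`exp u` and the Jacobian determinant has derivative zero. Its initial value is positive, which also
fixes the sign of the determinant. -/
theorem exp_mul_det_flow (x : Vec d) : ∃ J : ℝ → Vec d →L[ℝ] Vec d,
    (∀ t ∈ Icc a b, HasFDerivAt (Φ t) (J t) x) ∧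
    ∀ t ∈ Icc a b, Real.exp (u (t, Φ t x)) * |(J t).det| = Real.exp (u (a, x)) := by
  obtain ⟨J, hJa, hJ, hd⟩ := h.isLipschitzField.exists_hasFDerivAt
    (fun t ht x => hasFDerivAt_ouField h.contDiffOn (h.pos.trans_le ht.1) x)
    h.continuousOn_ouFieldDeriv hΦ.init hΦ.curve x
  refine ⟨J, hd, fun t ht => ?_⟩
  have hab : a ≤ b := ht.1.trans ht.2
  have h1 : ∀ t ∈ Icc a b, HasDerivWithinAt (fun t => Real.exp (u (t, Φ t x)) * (J t).det) 0
      (Icc a b) t := fun t ht => by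
    have ht0 : 0 < t := h.pos.trans_le ht.1
    have hz := prodMk_mem_posTime ht0 (Φ t x)
    have e1 := (hasDerivWithinAt_comp_curve (y := fun t => Φ t x)
      (differentiableAt_of_contDiffOn isOpen_posTime' h.contDiffOn hz) (hΦ.curve x t ht)).exp
    have e2 := hasDerivWithinAt_clm_det (hJ t ht)
    refine (e1.mul e2).congr_deriv ?_
    rw [coordTrace_ouFieldDeriv h.contDiffOn ht0, h.dt_eq _ hz]
    have e3 : ∀ i, ouField u t (Φ t x) i * dx i u (t, Φ t x) =
        -(dx i u (t, Φ t x) ^ 2 + (Φ t x) i * dx i u (t, Φ t x)) := fun i => by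
      simp [ouField]; ring
    simp_rw [e3, add_assoc, Finset.sum_add_distrib, Finset.sum_neg_distrib,
      Finset.sum_add_distrib]
    ring
  have h2 : Real.exp (u (t, Φ t x)) * (J t).det = Real.exp (u (a, x)) := by
    have := constant_of_has_deriv_right_zero (fun t ht => (h1 t ht).continuousWithinAt)
      (fun t ht => (h1 t (Ico_subset_Icc_self ht)).mono_of_mem_nhdsWithin
        (Icc_mem_nhdsGE_of_mem ht)) t ht
    rw [this, hΦ.init, hJa, show (ContinuousLinearMap.id ℝ (Vec d)).det = 1 from LinearMap.det_id,
      mul_one]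
  rw [← h2, abs_of_pos]
  by_contra hn
  have := mul_nonpos_of_nonneg_of_nonpos (Real.exp_pos (u (t, Φ t x))).le (not_lt.1 hn)
  rw [h2] at this
  exact absurd (Real.exp_pos (u (a, x))) (not_lt.2 this)

theorem measurePreserving_flow (ht : t ∈ Icc a b) :
    MeasurePreserving (Φ t) (sliceLaw u a) (sliceLaw u t) := by
  have hc := h.continuous_flow hΦ ht
  refine ⟨hc.measurable, ?_⟩
  choose J hJ hdet using h.exp_mul_det_flow hΦ
  ext s hs
  rw [Measure.map_apply hc.measurable hs, sliceLaw, sliceLaw,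
    withDensity_apply _ (hc.measurable hs), withDensity_apply _ hs]
  have h1 := lintegral_image_eq_lintegral_abs_det_fderiv_mul volume (hc.measurable hs)
    (fun x _ => (hJ x t ht).hasFDerivWithinAt) (h.bijective_flow hΦ ht).1.injOn
    (fun x => ENNReal.ofReal (Real.exp (u (t, x))))
  rw [image_preimage_eq _ (h.bijective_flow hΦ ht).2] at h1
  rw [h1]
  refine lintegral_congr fun x => ?_
  rw [← ENNReal.ofReal_mul (abs_nonneg _), mul_comm, hdet x t ht]

end IsLogOU

end Flow

/-! ### Logarithmic cutoffs -/

section Cutoff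

theorem exists_bound_deriv_smoothTransition :
    ∃ M : ℝ, 0 ≤ M ∧ ∀ s, |deriv Real.smoothTransition s| ≤ M := by
  have hc : Continuous (deriv Real.smoothTransition) :=
    (Real.smoothTransition.contDiff (n := 1)).continuous_deriv (by simp)
  obtain ⟨M, hM⟩ := isCompact_Icc.exists_bound_of_continuousOn
    (s := Icc (0 : ℝ) 1) hc.continuousOn
  refine ⟨max M 0, le_max_right _ _, fun s => ?_⟩
  by_cases hs : s ∈ Icc (0 : ℝ) 1
  · exact (hM s hs).trans (le_max_left _ _)
  · have : deriv Real.smoothTransition s = 0 := by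
      rcases lt_or_ge s 0 with h0 | h0
      · have : Real.smoothTransition =ᶠ[𝓝 s] fun _ => 0 := by
          filter_upwards [Iio_mem_nhds h0] with r hr
          exact Real.smoothTransition.zero_of_nonpos (le_of_lt hr)
        rw [this.deriv_eq]
        simp
      · have h1 : 1 < s := by
          by_contra h1
          exact hs ⟨h0, not_lt.1 h1⟩
        have : Real.smoothTransition =ᶠ[𝓝 s] fun _ => 1 := by
          filter_upwards [Ioi_mem_nhds h1] with r hr
          exact Real.smoothTransition.one_of_one_le (le_of_lt hr)
        rw [this.deriv_eq]
        simp
    rw [this, abs_zero]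
    exact le_max_right _ _

/-- Smooth cutoffs whose gradient is small compared with `1 / (1 + ‖x‖)`. -/
structure IsCutoff {d : ℕ} (ε R : ℝ) (ψ : Vec d → ℝ) : Prop where
  contDiff : ContDiff ℝ ∞ ψ
  hasCompactSupport : HasCompactSupport ψ
  nonneg : ∀ x, 0 ≤ ψ x
  le_one : ∀ x, ψ x ≤ 1
  eq_one : ∀ x, ‖x‖ ≤ R → ψ x = 1
  norm_fderiv_le : ∀ x, ‖fderiv ℝ ψ x‖ * (1 + ‖x‖) ≤ ε

/-- The probability flow field grows linearly, so a gradient that is merely small would not do. A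
cutoff in the variable `log (1 + ‖x‖²)`, descending with small slope `η`, has gradient of order `η /
‖x‖` at infinity. -/
theorem exists_isCutoff (d : ℕ) {ε : ℝ} (R : ℝ) (hε : 0 < ε) :
    ∃ ψ : Vec d → ℝ, IsCutoff ε R ψ := by
  obtain ⟨M, hM0, hM⟩ := exists_bound_deriv_smoothTransition
  set η : ℝ := ε / (4 * M + 1) with hη
  have hη0 : 0 < η := by positivity
  set ℓ : Vec d → ℝ := fun x => 1 + η * (Real.log (1 + R ^ 2) - Real.log (1 + ‖x‖ ^ 2)) with hℓ
  have hpos : ∀ x : Vec d, 0 < 1 + ‖x‖ ^ 2 := fun x => by positivity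
  have hder : ∀ x, HasFDerivAt ℓ
      (η • -((1 + ‖x‖ ^ 2)⁻¹ • (2 : ℕ) • innerSL ℝ x)) x := fun x => by
    have h1 : HasFDerivAt (fun x : Vec d => 1 + ‖x‖ ^ 2) ((2 : ℕ) • innerSL ℝ x) x := by
      have := ((hasFDerivAt_id x).norm_sq).const_add 1
      simpa using this
    exact (((h1.log (hpos x).ne').const_sub _).const_mul η).const_add 1
  refine ⟨fun x => Real.smoothTransition (ℓ x), ?_, ?_, fun x => Real.smoothTransition.nonneg _,
    fun x => Real.smoothTransition.le_one _, fun x hx => ?_, fun x => ?_⟩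
  · refine Real.smoothTransition.contDiff.comp ?_
    exact contDiff_const.add (contDiff_const.mul (contDiff_const.sub
      ((contDiff_const.add (contDiff_norm_sq ℝ)).log fun x => (hpos x).ne')))
  · set r := Real.exp (Real.log (1 + R ^ 2) + η⁻¹) with hr
    refine HasCompactSupport.of_support_subset_isCompact
      (isCompact_closedBall (0 : Vec d) (1 + r)) fun x hx => ?_
    rw [mem_closedBall_zero_iff]
    by_contra hlt
    rw [not_le] at hlt
    refine hx (Real.smoothTransition.zero_of_nonpos ?_)
    have hr0 : 0 < r := Real.exp_pos _
    have h2 : r ≤ 1 + ‖x‖ ^ 2 := by nlinarith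
    have h3 : Real.log (1 + R ^ 2) + η⁻¹ ≤ Real.log (1 + ‖x‖ ^ 2) := by
      rwa [Real.le_log_iff_exp_le (hpos x)]
    have h4 : η * (Real.log (1 + R ^ 2) - Real.log (1 + ‖x‖ ^ 2)) ≤ η * (-η⁻¹) :=
      mul_le_mul_of_nonneg_left (by linarith) hη0.le
    rw [mul_neg, mul_inv_cancel₀ hη0.ne'] at h4
    simp only [hℓ]
    linarith
  · refine Real.smoothTransition.one_of_one_le ?_
    have : Real.log (1 + ‖x‖ ^ 2) ≤ Real.log (1 + R ^ 2) := by gcongr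
    simp only [hℓ]
    nlinarith
  · have h1 : HasFDerivAt (fun x => Real.smoothTransition (ℓ x)) _ x :=
      ((Real.smoothTransition.contDiff (n := 1)).differentiable (by simp)
        (ℓ x)).hasDerivAt.comp_hasFDerivAt x (hder x)
    rw [h1.fderiv, norm_smul, norm_smul, norm_neg, norm_smul, Real.norm_of_nonneg hη0.le,
      Real.norm_of_nonneg (inv_pos.2 (hpos x)).le, Real.norm_eq_abs]
    have h2 : ‖(2 : ℕ) • innerSL ℝ x‖ ≤ 2 * ‖x‖ := by
      refine (norm_nsmul_le).trans ?_
      simp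
    have h3 : (1 + ‖x‖ ^ 2)⁻¹ * (2 * ‖x‖) * (1 + ‖x‖) ≤ 4 := by
      rw [mul_assoc, inv_mul_le_iff₀ (hpos x)]
      nlinarith [sq_nonneg (‖x‖ - 1), norm_nonneg x]
    calc |deriv Real.smoothTransition (ℓ x)| *
          (η * ((1 + ‖x‖ ^ 2)⁻¹ * ‖(2 : ℕ) • innerSL ℝ x‖)) * (1 + ‖x‖)
        ≤ M * (η * ((1 + ‖x‖ ^ 2)⁻¹ * (2 * ‖x‖))) * (1 + ‖x‖) := by
          gcongr
          exact hM _
      _ = M * η * ((1 + ‖x‖ ^ 2)⁻¹ * (2 * ‖x‖) * (1 + ‖x‖)) := by ring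
      _ ≤ M * η * 4 := by gcongr
      _ = ε * ((4 * M) / (4 * M + 1)) := by rw [hη]; ring
      _ ≤ ε * 1 := by
          gcongr
          rw [div_le_one (by positivity)]
          linarith
      _ = ε := mul_one ε

end Cutoff

/-! ### Evolution of the score and of the Hessian along the flow -/

section Identities

variable {d : ℕ} {u : ℝ × Vec d → ℝ}

/-- The generator `Δ + ∇u · ∇` applied to the `j`-th component of the score. -/
noncomputable def genScore (u : ℝ × Vec d → ℝ) (j : Fin d) (z : ℝ × Vec d) : ℝ :=
  ∑ i, (dx i (dx i (dx j u)) z + dx i u z * dx i (dx j u) z)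

theorem contDiffOn_genScore (hu : ContDiffOn ℝ ∞ u (posTime d)) (j : Fin d) :
    ContDiffOn ℝ ∞ (genScore u j) (posTime d) := by
  have hU := isOpen_posTime' (d := d)
  refine ContDiffOn.sum fun i _ => ContDiffOn.add ?_ (ContDiffOn.mul ?_ ?_)
  · exact contDiffOn_pd hU (contDiffOn_pd hU (contDiffOn_pd hU hu _) _) _
  · exact contDiffOn_pd hU hu _
  · exact contDiffOn_pd hU (contDiffOn_pd hU hu _) _

/-- The derivative along the probability flow. -/
noncomputable def flowDeriv (u f : ℝ × Vec d → ℝ) (z : ℝ × Vec d) : ℝ :=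
  pd (1, ouField u z.1 z.2) f z

theorem flowDeriv_eq (f : ℝ × Vec d → ℝ) (z : ℝ × Vec d) :
    flowDeriv u f z = dt f z - ∑ i, (z.2 i + dx i u z) * dx i f z := by
  rw [flowDeriv, pd_eq_dt_add_sum_dx, sub_eq_add_neg, ← Finset.sum_neg_distrib, one_mul]
  congr 1
  refine Finset.sum_congr rfl fun i _ => ?_
  simp [ouField]
  ring

theorem dx_coord (i j : Fin d) (z : ℝ × Vec d) :
    pd (0, unitVec i) (fun z : ℝ × Vec d => z.2 j) z = if i = j then 1 else 0 := by
  have h : HasFDerivAt (fun z : ℝ × Vec d => z.2 j) _ z :=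
    (EuclideanSpace.proj (𝕜 := ℝ) j).hasFDerivAt.comp z hasFDerivAt_snd
  rw [h.pd_eq]
  simp [eq_comm]

theorem differentiableAt_coord (j : Fin d) (z : ℝ × Vec d) :
    DifferentiableAt ℝ (fun z : ℝ × Vec d => z.2 j) z :=
  ((EuclideanSpace.proj (𝕜 := ℝ) j).hasFDerivAt.comp z hasFDerivAt_snd).differentiableAt

variable {L : ℝ≥0} {a b : ℝ}

/-- Differentiating the equation for `u` produces `2 ∇u·∇∂_j u` and `x·∇∂_j u`. The transport
removes the second and one copy of the first, and what remains besides the generator is `∂_j u`,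
from differentiating the coefficient `x`. -/
theorem IsLogOU.flowDeriv_dx (h : IsLogOU u L a b) (j : Fin d) {z : ℝ × Vec d}
    (hz : z ∈ posTime d) : flowDeriv u (dx j u) z = genScore u j z + dx j u z := by
  have hU := isOpen_posTime' (d := d)
  have hd : ∀ {f : ℝ × Vec d → ℝ}, ContDiffOn ℝ ∞ f (posTime d) → DifferentiableAt ℝ f z :=
    fun hf => differentiableAt_of_contDiffOn hU hf hz
  have s1 : ∀ i, ContDiffOn ℝ ∞ (dx i u) (posTime d) := fun i => contDiffOn_pd hU h.contDiffOn _
  have s2 : ∀ i j, ContDiffOn ℝ ∞ (dx i (dx j u)) (posTime d) := fun i j => contDiffOn_pd hU (s1 j) _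
  have e1 : dt (dx j u) z = dx j (dt u) z := pd_comm hU h.contDiffOn _ _ hz
  have e2 : dx j (dt u) z = _ := pd_congr hU (fun z hz => h.dt_eq z hz) hz
  have e3 : ∀ i, dx j (dx i u) z = dx i (dx j u) z := fun i => pd_comm hU h.contDiffOn _ _ hz
  have e4 : ∀ i, dx j (dx i (dx i u)) z = dx i (dx i (dx j u)) z := fun i => by
    rw [show dx j (dx i (dx i u)) z = dx i (dx j (dx i u)) z from pd_comm hU (s1 i) _ _ hz]
    exact pd_congr hU (fun z hz => pd_comm hU h.contDiffOn _ _ hz) hz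
  have d1 : ∀ i, DifferentiableAt ℝ (fun z => dx i (dx i u) z + dx i u z ^ 2) z := fun i =>
    (hd (s2 i i)).fun_add ((hd (s1 i)).fun_pow 2)
  have d2 : ∀ i, DifferentiableAt ℝ (fun z : ℝ × Vec d => z.2 i * dx i u z) z := fun i =>
    (differentiableAt_coord i z).fun_mul (hd (s1 i))
  have e5 : dx j (dt u) z = ∑ i, (dx i (dx i (dx j u)) z + 2 * dx i u z * dx i (dx j u) z
      + ((if j = i then 1 else 0) * dx i u z + z.2 i * dx i (dx j u) z)) := by
    rw [e2, pd_add (DifferentiableAt.fun_sum fun i _ => (d1 i).fun_add (d2 i))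
      (differentiableAt_const _), pd_const, add_zero,
      pd_sum fun i _ => (d1 i).fun_add (d2 i)]
    refine Finset.sum_congr rfl fun i _ => ?_
    rw [pd_add (d1 i) (d2 i), pd_add (hd (s2 i i)) ((hd (s1 i)).fun_pow 2), pd_sq (hd (s1 i)),
      pd_mul (differentiableAt_coord i z) (hd (s1 i)), dx_coord]
    rw [show pd (0, unitVec j) (dx i (dx i u)) z = _ from e4 i,
      show pd (0, unitVec j) (dx i u) z = _ from e3 i]
  rw [flowDeriv_eq, e1, e5, genScore]
  have e6 : dx j u z = ∑ i, (if j = i then 1 else 0) * dx i u z := by simp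
  conv_rhs => rw [e6]
  rw [← Finset.sum_sub_distrib, ← Finset.sum_add_distrib]
  refine Finset.sum_congr rfl fun i _ => ?_
  ring

/-- The derivative `∂_k` fails to commute with the flow derivative by the gradient of the velocity,
which is minus the identity minus the Hessian. This accounts for the second copy of `∂_k ∂_j u` and
for the quadratic term. -/
theorem IsLogOU.flowDeriv_dx_dx (h : IsLogOU u L a b) (k j : Fin d) {z : ℝ × Vec d}
    (hz : z ∈ posTime d) : flowDeriv u (dx k (dx j u)) z =
      dx k (genScore u j) z + 2 * dx k (dx j u) z + ∑ i, dx k (dx i u) z * dx i (dx j u) z := by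
  have hU := isOpen_posTime' (d := d)
  have hd : ∀ {f : ℝ × Vec d → ℝ}, ContDiffOn ℝ ∞ f (posTime d) → DifferentiableAt ℝ f z :=
    fun hf => differentiableAt_of_contDiffOn hU hf hz
  have s1 : ∀ i, ContDiffOn ℝ ∞ (dx i u) (posTime d) := fun i => contDiffOn_pd hU h.contDiffOn _
  have s2 : ∀ i j, ContDiffOn ℝ ∞ (dx i (dx j u)) (posTime d) := fun i j => contDiffOn_pd hU (s1 j) _
  have sg := contDiffOn_genScore h.contDiffOn j
  have e1 : dt (dx k (dx j u)) z = dx k (dt (dx j u)) z := pd_comm hU (s1 j) _ _ hz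
  have e0 : EqOn (dt (dx j u)) (fun z => (genScore u j z + dx j u z) +
      ∑ i, (z.2 i + dx i u z) * dx i (dx j u) z) (posTime d) := fun z hz => by
    have := h.flowDeriv_dx j hz
    rw [flowDeriv_eq] at this
    simp only
    linarith
  have e2 : dx k (dt (dx j u)) z = _ := pd_congr hU e0 hz
  have d0 : ∀ i, DifferentiableAt ℝ (fun z : ℝ × Vec d => z.2 i + dx i u z) z := fun i =>
    (differentiableAt_coord i z).fun_add (hd (s1 i))
  have d1 : ∀ i, DifferentiableAt ℝ
      (fun z : ℝ × Vec d => (z.2 i + dx i u z) * dx i (dx j u) z) z := fun i =>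
    (d0 i).fun_mul (hd (s2 i j))
  rw [pd_add ((hd sg).fun_add (hd (s1 j))) (DifferentiableAt.fun_sum fun i _ => d1 i),
    pd_add (hd sg) (hd (s1 j)), pd_sum fun i _ => d1 i] at e2
  rw [flowDeriv_eq, e1, e2]
  have e3 : ∀ i, pd (0, unitVec k) (fun z : ℝ × Vec d => (z.2 i + dx i u z) * dx i (dx j u) z) z =
      (if k = i then 1 else 0) * dx i (dx j u) z + dx k (dx i u) z * dx i (dx j u) z +
        (z.2 i + dx i u z) * dx i (dx k (dx j u)) z := fun i => by
    rw [pd_mul (d0 i) (hd (s2 i j)), pd_add (differentiableAt_coord i z) (hd (s1 i)), dx_coord,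
      show pd (0, unitVec k) (dx i (dx j u)) z = dx i (dx k (dx j u)) z from
        pd_comm hU (s1 j) _ _ hz]
    ring
  simp_rw [e3, Finset.sum_add_distrib]
  simp
  ring

/-- The squared Frobenius norm of the Hessian. -/
noncomputable def hessSq (u : ℝ × Vec d → ℝ) (z : ℝ × Vec d) : ℝ :=
  ∑ k, ∑ j, dx k (dx j u) z ^ 2

/-- The squared norm of `genScore`. -/
noncomputable def genSq (u : ℝ × Vec d → ℝ) (z : ℝ × Vec d) : ℝ := ∑ j, genScore u j z ^ 2

/-- The trace of the third power of the Hessian. -/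
noncomputable def hessCube (u : ℝ × Vec d → ℝ) (z : ℝ × Vec d) : ℝ :=
  ∑ k, ∑ j, dx k (dx j u) z * ∑ i, dx k (dx i u) z * dx i (dx j u) z

theorem contDiffOn_hessSq (hu : ContDiffOn ℝ ∞ u (posTime d)) :
    ContDiffOn ℝ ∞ (hessSq u) (posTime d) :=
  ContDiffOn.sum fun _ _ => ContDiffOn.sum fun _ _ =>
    (contDiffOn_pd isOpen_posTime' (contDiffOn_pd isOpen_posTime' hu _) _).pow 2

theorem IsLogOU.flowDeriv_hessSq (h : IsLogOU u L a b) {z : ℝ × Vec d} (hz : z ∈ posTime d) :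
    flowDeriv u (hessSq u) z = 2 * (∑ k, ∑ j, dx k (dx j u) z * dx k (genScore u j) z) +
      4 * hessSq u z + 2 * hessCube u z := by
  have hU := isOpen_posTime' (d := d)
  have d2 : ∀ k j, DifferentiableAt ℝ (dx k (dx j u)) z := fun k j =>
    differentiableAt_of_contDiffOn hU (contDiffOn_pd hU (contDiffOn_pd hU h.contDiffOn _) _) hz
  rw [flowDeriv]
  unfold hessSq
  rw [pd_sum fun k _ => DifferentiableAt.fun_sum fun j _ => (d2 k j).fun_pow 2]
  rw [hessCube, Finset.mul_sum, Finset.mul_sum, Finset.mul_sum, ← Finset.sum_add_distrib,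
    ← Finset.sum_add_distrib]
  refine Finset.sum_congr rfl fun k _ => ?_
  rw [pd_sum fun j _ => (d2 k j).fun_pow 2, Finset.mul_sum, Finset.mul_sum, Finset.mul_sum,
    ← Finset.sum_add_distrib, ← Finset.sum_add_distrib]
  refine Finset.sum_congr rfl fun j _ => ?_
  rw [pd_sq (d2 k j), ← flowDeriv, h.flowDeriv_dx_dx k j hz]
  ring

end Identities

/-! ### Hessian bounds and weighted integration by parts -/

section Energy

variable {d : ℕ} {u : ℝ × Vec d → ℝ} {L : ℝ≥0} {a b : ℝ}

theorem norm_sq_eq_sum (x : Vec d) : ‖x‖ ^ 2 = ∑ i, x i ^ 2 := by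
  simp_rw [EuclideanSpace.norm_sq_eq, Real.norm_eq_abs, sq_abs]

theorem norm_unitVec (i : Fin d) : ‖unitVec i‖ = 1 := by simp [unitVec]

theorem clm_apply_coord (D : Vec d →L[ℝ] Vec d) (x : Vec d) (j : Fin d) :
    D x j = ∑ i, x i * D (unitVec i) j := by
  conv_lhs => rw [sum_smul_unitVec x]
  simp [map_sum, map_smul]

theorem hessSq_nonneg (u : ℝ × Vec d → ℝ) (z : ℝ × Vec d) : 0 ≤ hessSq u z :=
  Finset.sum_nonneg fun _ _ => Finset.sum_nonneg fun _ _ => sq_nonneg _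

namespace IsLogOU

variable (h : IsLogOU u L a b) {z : ℝ × Vec d}

include h

theorem mem_posTime (hz : z.1 ∈ Icc a b) : z ∈ posTime d := h.pos.trans_le hz.1

theorem exists_hessian (hz : z.1 ∈ Icc a b) : ∃ D : Vec d →L[ℝ] Vec d, ‖D‖ ≤ L ∧
    ∀ k j, D (unitVec k) j = dx k (dx j u) z := by
  obtain ⟨t, x⟩ := z
  have hU := isOpen_posTime' (d := d)
  have hzp : (t, x) ∈ posTime d := h.mem_posTime hz
  have h0 := hasFDerivAt_slice (((contDiffOn_spaceGrad h.contDiffOn).contDiffAt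
    (hU.mem_nhds hzp)).differentiableAt (by simp)).hasFDerivAt
  refine ⟨_, h0.le_of_lipschitz (h.lipschitz t hz), fun k j => ?_⟩
  have h1 : HasFDerivAt (fun y => spaceGrad u (t, y) j) _ x :=
    ((EuclideanSpace.proj (𝕜 := ℝ) j).hasFDerivAt).comp x h0
  have h2 : HasFDerivAt (fun y : Vec d => dx j u (t, y)) _ x := hasFDerivAt_slice
      (differentiableAt_of_contDiffOn hU (contDiffOn_pd hU h.contDiffOn _) hzp).hasFDerivAt
  have h3 := congrArg (fun D : Vec d →L[ℝ] ℝ => D (unitVec k)) (h1.unique h2)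
  simpa [pd] using h3

theorem abs_dx_dx_le (hz : z.1 ∈ Icc a b) (k j : Fin d) : |dx k (dx j u) z| ≤ L := by
  obtain ⟨D, hD, e⟩ := h.exists_hessian hz
  rw [← e]
  refine (PiLp.norm_apply_le (D (unitVec k)) j).trans ((D.le_opNorm _).trans ?_)
  rwa [norm_unitVec, mul_one]

theorem hessSq_le (hz : z.1 ∈ Icc a b) : hessSq u z ≤ d * L ^ 2 := by
  obtain ⟨D, hD, e⟩ := h.exists_hessian hz
  have h1 : ∀ k, ∑ j, dx k (dx j u) z ^ 2 ≤ (L : ℝ) ^ 2 := fun k => by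
    simp_rw [← e, ← norm_sq_eq_sum]
    gcongr
    refine (D.le_opNorm _).trans ?_
    rwa [norm_unitVec, mul_one]
  calc hessSq u z ≤ ∑ _k : Fin d, (L : ℝ) ^ 2 := Finset.sum_le_sum fun k _ => h1 k
    _ = _ := by simp

/-- The cubic trace is `∑ ⟪D (D e_k), D e_k⟫`. Applying the operator norm to the outer `D` costs a
factor `L` without any dependence on the dimension. -/
theorem abs_hessCube_le (hz : z.1 ∈ Icc a b) : |hessCube u z| ≤ L * hessSq u z := by
  obtain ⟨D, hD, e⟩ := h.exists_hessian hz
  have h1 : hessCube u z = ∑ k, ⟪D (D (unitVec k)), D (unitVec k)⟫_ℝ := by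
    refine Finset.sum_congr rfl fun k _ => ?_
    rw [PiLp.inner_apply]
    refine Finset.sum_congr rfl fun j _ => ?_
    rw [clm_apply_coord D (D (unitVec k))]
    simp [e]
  have h2 : hessSq u z = ∑ k, ‖D (unitVec k)‖ ^ 2 := by
    simp_rw [norm_sq_eq_sum, e]
    rfl
  rw [h1, h2, Finset.mul_sum]
  refine (Finset.abs_sum_le_sum_abs _ _).trans (Finset.sum_le_sum fun k _ => ?_)
  refine (abs_real_inner_le_norm _ _).trans ?_
  calc ‖D (D (unitVec k))‖ * ‖D (unitVec k)‖ ≤ (L * ‖D (unitVec k)‖) * ‖D (unitVec k)‖ := by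
        gcongr
        exact (D.le_opNorm _).trans (by gcongr)
    _ = _ := by ring

theorem exists_bound_ouField :
    ∃ C : ℝ, 0 ≤ C ∧ ∀ z : ℝ × Vec d, z.1 ∈ Icc a b → ‖ouField u z.1 z.2‖ ≤ C * (1 + ‖z.2‖) := by
  obtain ⟨M, hM⟩ := isCompact_Icc.exists_bound_of_continuousOn
    (h.isLipschitzField.continuousOn 0)
  refine ⟨max M 0 + (1 + L), by positivity, fun z hz => ?_⟩
  have h2 := (h.isLipschitzField.lipschitz z.1 hz).dist_le_mul z.2 0
  rw [dist_eq_norm, dist_zero_right] at h2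
  push_cast at h2
  have h3 := norm_le_norm_add_norm_sub (ouField u z.1 0) (ouField u z.1 z.2)
  rw [norm_sub_rev] at h2
  have h4 := (hM z.1 hz).trans (le_max_left M 0)
  rw [norm_sub_rev] at h3
  have h5 : (0 : ℝ) ≤ L := L.2
  have h6 := norm_sub_rev (ouField u z.1 0) (ouField u z.1 z.2)
  nlinarith [norm_nonneg z.2, mul_nonneg (le_max_right M 0) (norm_nonneg z.2)]

end IsLogOU

/-- Continuous functions on the half space with spatial support in `K`. -/
structure IsTest (K : Set (Vec d)) (f : ℝ × Vec d → ℝ) : Prop where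
  continuousOn : ContinuousOn f (posTime d)
  eq_zero : ∀ z, z.2 ∉ K → f z = 0

variable {K : Set (Vec d)} {f g : ℝ × Vec d → ℝ}

theorem IsTest.mul_left (hf : IsTest K f) (hg : ContinuousOn g (posTime d)) :
    IsTest K (fun z => g z * f z) :=
  ⟨hg.mul hf.continuousOn, fun z hz => by simp [hf.eq_zero z hz]⟩

theorem IsTest.add (hf : IsTest K f) (hg : IsTest K g) : IsTest K (fun z => f z + g z) :=
  ⟨hf.continuousOn.add hg.continuousOn, fun z hz => by simp [hf.eq_zero z hz, hg.eq_zero z hz]⟩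

theorem IsTest.sum {ι : Type} {s : Finset ι} {f : ι → ℝ × Vec d → ℝ}
    (hf : ∀ i ∈ s, IsTest K (f i)) : IsTest K (fun z => ∑ i ∈ s, f i z) :=
  ⟨continuousOn_finsetSum s fun i hi => (hf i hi).continuousOn,
    fun z hz => Finset.sum_eq_zero fun i hi => (hf i hi).eq_zero z hz⟩

theorem pd_eq_zero_of_eq_zero (hK : IsClosed K) (hf : ∀ z : ℝ × Vec d, z.2 ∉ K → f z = 0)
    {z : ℝ × Vec d} (hz : z.2 ∉ K) (w : ℝ × Vec d) : pd w f z = 0 := by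
  have ho : IsOpen {z : ℝ × Vec d | z.2 ∉ K} := hK.isOpen_compl.preimage continuous_snd
  rw [pd_congr (g := fun _ => 0) ho (fun z hz => hf z hz) hz, pd_const]

theorem IsTest.pd (hK : IsClosed K) (hf : ContDiffOn ℝ ∞ f (posTime d))
    (h0 : ∀ z, z.2 ∉ K → f z = 0) (w : ℝ × Vec d) : IsTest K (pd w f) :=
  ⟨(contDiffOn_pd isOpen_posTime' hf w).continuousOn,
    fun _ hz => pd_eq_zero_of_eq_zero hK h0 hz w⟩

theorem IsTest.continuous_slice (hf : IsTest K f) {t : ℝ} (ht : 0 < t) :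
    Continuous fun x => f (t, x) := by
  refine continuous_iff_continuousAt.2 fun x => ?_
  have := hf.continuousOn.continuousAt (isOpen_posTime'.mem_nhds (prodMk_mem_posTime ht x))
  exact this.comp (f := fun x => (t, x)) (by fun_prop)

theorem IsTest.hasCompactSupport (hf : IsTest K f) (hK : IsCompact K) (t : ℝ) :
    HasCompactSupport fun x => f (t, x) :=
  HasCompactSupport.intro hK fun x hx => hf.eq_zero (t, x) hx

theorem IsTest.integrable_slice (hf : IsTest K f) (hK : IsCompact K) {t : ℝ} (ht : 0 < t)
    (μ : Measure (Vec d)) [IsFiniteMeasure μ] : Integrable (fun x => f (t, x)) μ :=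
  (hf.continuous_slice ht).integrable_of_hasCompactSupport (hf.hasCompactSupport hK t)

theorem IsTest.exists_bound (hf : IsTest K f) (hK : IsCompact K) (ha : 0 < a) :
    ∃ C, 0 ≤ C ∧ ∀ z : ℝ × Vec d, z.1 ∈ Icc a b → |f z| ≤ C := by
  obtain ⟨C, hC⟩ := (isCompact_Icc (a := a) (b := b)).prod hK |>.exists_bound_of_continuousOn
    (hf.continuousOn.mono fun z hz => ha.trans_le hz.1.1)
  refine ⟨max C 0, le_max_right _ _, fun z hz => ?_⟩
  by_cases hzK : z.2 ∈ K
  · exact (hC z ⟨hz, hzK⟩).trans (le_max_left _ _)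
  · rw [hf.eq_zero z hzK, abs_zero]
    exact le_max_right _ _

theorem IsLogOU.integral_sliceLaw (h : IsLogOU u L a b) {t : ℝ} (ht : t ∈ Icc a b)
    (f : Vec d → ℝ) : ∫ x, f x ∂(sliceLaw u t) = ∫ x, Real.exp (u (t, x)) * f x := by
  rw [sliceLaw, integral_withDensity_eq_integral_toReal_smul
    (h.continuous_slice (h.pos.trans_le ht.1)).rexp.measurable.ennreal_ofReal
      (.of_forall fun x => ENNReal.ofReal_lt_top)]
  simp_rw [ENNReal.toReal_ofReal (Real.exp_nonneg _), smul_eq_mul]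

/-- Integration by parts against `exp u`. -/
theorem IsLogOU.integral_dx_add_eq_zero (h : IsLogOU u L a b) {t : ℝ} (ht : t ∈ Icc a b)
    (hK : IsCompact K) (hf : ContDiffOn ℝ ∞ f (posTime d)) (h0 : ∀ z, z.2 ∉ K → f z = 0)
    (k : Fin d) : ∫ x, (dx k f (t, x) + dx k u (t, x) * f (t, x)) ∂(sliceLaw u t) = 0 := by
  have hU := isOpen_posTime' (d := d)
  have ht0 := h.pos.trans_le ht.1
  rw [h.integral_sliceLaw ht]
  have hg : ContDiffOn ℝ ∞ (fun z => Real.exp (u z) * f z) (posTime d) := h.contDiffOn.exp.mul hf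
  have hg0 : ∀ z : ℝ × Vec d, z.2 ∉ K → Real.exp (u z) * f z = 0 := fun z hz => by simp [h0 z hz]
  have t1 : IsTest K (fun z => Real.exp (u z) * f z) := ⟨hg.continuousOn, hg0⟩
  have t2 : IsTest K (dx k (fun z => Real.exp (u z) * f z)) := .pd hK.isClosed hg hg0 _
  have hd : ∀ x, HasFDerivAt (fun x => Real.exp (u (t, x)) * f (t, x)) _ x := fun x =>
    hasFDerivAt_slice (u := fun z => Real.exp (u z) * f z)
      (differentiableAt_of_contDiffOn hU hg (prodMk_mem_posTime ht0 x)).hasFDerivAt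
  have e1 : ∀ x, fderiv ℝ (fun x => Real.exp (u (t, x)) * f (t, x)) x (unitVec k) =
      dx k (fun z => Real.exp (u z) * f z) (t, x) := fun x => by
    rw [(hd x).fderiv]
    simp [pd]
  have e2 : ∀ x, dx k (fun z => Real.exp (u z) * f z) (t, x) =
      Real.exp (u (t, x)) * (dx k f (t, x) + dx k u (t, x) * f (t, x)) := fun x => by
    have hu := differentiableAt_of_contDiffOn hU h.contDiffOn (prodMk_mem_posTime ht0 x)
    rw [dx, pd_mul hu.exp (differentiableAt_of_contDiffOn hU hf (prodMk_mem_posTime ht0 x)),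
      hu.hasFDerivAt.exp.pd_eq]
    simp [pd]
    ring
  -- Integration by parts against the constant `1`: the integral of a derivative of the compactly
  -- supported function `exp u * f` vanishes.
  have key := integral_mul_fderiv_eq_neg_fderiv_mul_of_integrable (𝕜 := ℝ)
    (μ := (volume : Measure (Vec d))) (f := fun _ => (1 : ℝ))
    (g := fun x => Real.exp (u (t, x)) * f (t, x)) (v := unitVec k) (by simp)
    (by
      simp_rw [one_mul, e1]
      exact (t2.continuous_slice ht0).integrable_of_hasCompactSupport (t2.hasCompactSupport hK t))
    (by
      simp_rw [one_mul]
      exact (t1.continuous_slice ht0).integrable_of_hasCompactSupport (t1.hasCompactSupport hK t))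
    (fun x _ => differentiableAt_const _) (fun x _ => (hd x).differentiableAt)
  simpa [e1, e2] using key

end Energy

/-! ### The localized energy inequality, pointwise -/

section Pointwise

variable {d : ℕ} {u : ℝ × Vec d → ℝ} {L : ℝ≥0} {a b : ℝ} {ψ : Vec d → ℝ}

theorem pd_comp_snd (hψ : ContDiff ℝ ∞ ψ) (z w : ℝ × Vec d) :
    pd w (fun z : ℝ × Vec d => ψ z.2) z = fderiv ℝ ψ z.2 w.2 := by
  have h1 : HasFDerivAt (Prod.snd : ℝ × Vec d → Vec d) (ContinuousLinearMap.snd ℝ ℝ (Vec d)) z :=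
    hasFDerivAt_snd
  have : HasFDerivAt (fun z : ℝ × Vec d => ψ z.2) _ z :=
    (hψ.differentiable (by simp) z.2).hasFDerivAt.comp z h1
  rw [this.pd_eq]
  simp

theorem contDiffOn_comp_snd (hψ : ContDiff ℝ ∞ ψ) :
    ContDiffOn ℝ ∞ (fun z : ℝ × Vec d => ψ z.2) (posTime d) :=
  (hψ.comp contDiff_snd).contDiffOn

/-- The field whose weighted divergence enters the energy identity. -/
noncomputable def energyFlux (u : ℝ × Vec d → ℝ) (ψ : Vec d → ℝ) (k : Fin d) (z : ℝ × Vec d) : ℝ :=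
  ψ z.2 ^ 2 * ∑ j, dx k (dx j u) z * genScore u j z

/-- The divergence of the energy flux with respect to the weight `exp u`. -/
noncomputable def energyDiv (u : ℝ × Vec d → ℝ) (ψ : Vec d → ℝ) (z : ℝ × Vec d) : ℝ :=
  ∑ k, (dx k (energyFlux u ψ k) z + dx k u z * energyFlux u ψ k z)

/-- The localized squared Hessian. -/
noncomputable def cutHess (u : ℝ × Vec d → ℝ) (ψ : Vec d → ℝ) (z : ℝ × Vec d) : ℝ :=
  ψ z.2 ^ 2 * hessSq u z

theorem contDiffOn_energyFlux (hu : ContDiffOn ℝ ∞ u (posTime d)) (hψ : ContDiff ℝ ∞ ψ)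
    (k : Fin d) : ContDiffOn ℝ ∞ (energyFlux u ψ k) (posTime d) :=
  ((contDiffOn_comp_snd hψ).pow 2).mul (ContDiffOn.sum fun j _ =>
    (contDiffOn_pd isOpen_posTime' (contDiffOn_pd isOpen_posTime' hu _) _).mul
      (contDiffOn_genScore hu j))

theorem contDiffOn_cutHess (hu : ContDiffOn ℝ ∞ u (posTime d)) (hψ : ContDiff ℝ ∞ ψ) :
    ContDiffOn ℝ ∞ (cutHess u ψ) (posTime d) :=
  ((contDiffOn_comp_snd hψ).pow 2).mul (contDiffOn_hessSq hu)

/-- The weighted divergence `∑_k (∂_k + ∂_k u)` sends the column `∂_k ∂_j u` to the generator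
applied to `∂_j u`. Besides the pairing of the Hessian with `∇(G∇u)` it therefore produces the
square `|G∇u|²`; the last term comes from the cutoff. -/
theorem energyDiv_eq (hu : ContDiffOn ℝ ∞ u (posTime d)) (hψ : ContDiff ℝ ∞ ψ)
    {z : ℝ × Vec d} (hz : z ∈ posTime d) :
    energyDiv u ψ z = ψ z.2 ^ 2 * ((∑ k, ∑ j, dx k (dx j u) z * dx k (genScore u j) z) + genSq u z)
      + 2 * ψ z.2 * fderiv ℝ ψ z.2
        (WithLp.toLp 2 fun k => ∑ j, dx k (dx j u) z * genScore u j z) := by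
  have hU := isOpen_posTime' (d := d)
  have hd : ∀ {f : ℝ × Vec d → ℝ}, ContDiffOn ℝ ∞ f (posTime d) → DifferentiableAt ℝ f z :=
    fun hf => differentiableAt_of_contDiffOn hU hf hz
  have s2 : ∀ i j, ContDiffOn ℝ ∞ (dx i (dx j u)) (posTime d) := fun i j =>
    contDiffOn_pd hU (contDiffOn_pd hU hu _) _
  have dg : ∀ j, DifferentiableAt ℝ (genScore u j) z := fun j => hd (contDiffOn_genScore hu j)
  have dψ := hd (contDiffOn_comp_snd hψ)
  have dm : ∀ k j, DifferentiableAt ℝ (fun z => dx k (dx j u) z * genScore u j z) z := fun k j =>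
    (hd (s2 k j)).fun_mul (dg j)
  have e1 : ∀ k, dx k (energyFlux u ψ k) z = 2 * ψ z.2 * fderiv ℝ ψ z.2 (unitVec k) *
      (∑ j, dx k (dx j u) z * genScore u j z) + ψ z.2 ^ 2 *
      ∑ j, (dx k (dx k (dx j u)) z * genScore u j z + dx k (dx j u) z * dx k (genScore u j) z) :=
    fun k => by
      unfold energyFlux
      rw [dx, pd_mul (dψ.fun_pow 2) (DifferentiableAt.fun_sum fun j _ => dm k j), pd_sq dψ,
        pd_comp_snd hψ, pd_sum fun j _ => dm k j]
      simp_rw [pd_mul (hd (s2 k _)) (dg _)]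
  have e2 : genSq u z = ∑ k, ∑ j, (dx k (dx k (dx j u)) z + dx k u z * dx k (dx j u) z) *
      genScore u j z := by
    rw [Finset.sum_comm]
    refine Finset.sum_congr rfl fun j _ => ?_
    rw [sq, ← Finset.sum_mul]
    rfl
  have e3 : fderiv ℝ ψ z.2 (WithLp.toLp 2 fun k => ∑ j, dx k (dx j u) z * genScore u j z) =
      ∑ k, (∑ j, dx k (dx j u) z * genScore u j z) * fderiv ℝ ψ z.2 (unitVec k) := by
    conv_lhs => rw [sum_smul_unitVec (WithLp.toLp 2 fun k => ∑ j, dx k (dx j u) z * genScore u j z)]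
    simp [map_sum, map_smul]
  rw [energyDiv, e2, e3]
  simp_rw [e1, energyFlux]
  rw [← Finset.sum_add_distrib, Finset.mul_sum, Finset.mul_sum, ← Finset.sum_add_distrib]
  refine Finset.sum_congr rfl fun k _ => ?_
  simp only [Finset.sum_add_distrib, add_mul, mul_add, Finset.mul_sum]
  have e4 : ∀ j, ψ z.2 ^ 2 * (dx k u z * dx k (dx j u) z * genScore u j z) =
      dx k u z * (ψ z.2 ^ 2 * (dx k (dx j u) z * genScore u j z)) := fun j => by ring
  simp_rw [e4]
  have e5 : ∑ j, 2 * ψ z.2 * fderiv ℝ ψ z.2 (unitVec k) * (dx k (dx j u) z * genScore u j z) =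
      2 * ψ z.2 * ((∑ j, dx k (dx j u) z * genScore u j z) * fderiv ℝ ψ z.2 (unitVec k)) := by
    rw [← Finset.mul_sum]; ring
  rw [e5]
  ring

theorem IsLogOU.flowDeriv_cutHess (h : IsLogOU u L a b) (hψ : ContDiff ℝ ∞ ψ)
    {z : ℝ × Vec d} (hz : z ∈ posTime d) :
    flowDeriv u (cutHess u ψ) z = 2 * ψ z.2 * fderiv ℝ ψ z.2 (ouField u z.1 z.2) * hessSq u z +
      ψ z.2 ^ 2 * (2 * (∑ k, ∑ j, dx k (dx j u) z * dx k (genScore u j) z) +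
      4 * hessSq u z + 2 * hessCube u z) := by
  have hU := isOpen_posTime' (d := d)
  have dψ := differentiableAt_of_contDiffOn hU (contDiffOn_comp_snd hψ) hz
  rw [← h.flowDeriv_hessSq hz, flowDeriv, flowDeriv]
  unfold cutHess
  rw [pd_mul (dψ.fun_pow 2) (differentiableAt_of_contDiffOn hU (contDiffOn_hessSq h.contDiffOn) hz),
    pd_sq dψ, pd_comp_snd hψ]

theorem IsCutoff.norm_fderiv_le' {ε R : ℝ} (hψ : IsCutoff ε R ψ) (x : Vec d) :
    ‖fderiv ℝ ψ x‖ ≤ ε := by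
  refine le_trans ?_ (hψ.norm_fderiv_le x)
  exact le_mul_of_one_le_right (norm_nonneg _) (by linarith [norm_nonneg x])

/-- The pointwise energy inequality. -/
theorem IsLogOU.sq_mul_genSq_le (h : IsLogOU u L a b) {ε R C : ℝ} (hψ : IsCutoff ε R ψ)
    (hε : 0 ≤ ε) (hC0 : 0 ≤ C)
    (hC : ∀ z : ℝ × Vec d, z.1 ∈ Icc a b → ‖ouField u z.1 z.2‖ ≤ C * (1 + ‖z.2‖))
    {z : ℝ × Vec d} (hz : z.1 ∈ Icc a b) :
    ψ z.2 ^ 2 * genSq u z ≤ 2 * energyDiv u ψ z - flowDeriv u (cutHess u ψ) z +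
      d * L ^ 2 * (4 + 2 * L + (4 * ε ^ 2 + 2 * ε * C)) := by
  have hzp := h.mem_posTime hz
  rw [energyDiv_eq h.contDiffOn hψ.contDiff hzp, h.flowDeriv_cutHess hψ.contDiff hzp]
  -- This pairing contains fourth derivatives of `u`. It occurs with coefficient `2 ψ²` both in
  -- twice the divergence and in the flow derivative, so it cancels in the difference and never has
  -- to be estimated.
  set X := ∑ k, ∑ j, dx k (dx j u) z * dx k (genScore u j) z
  set c : Vec d := WithLp.toLp 2 fun k => ∑ j, dx k (dx j u) z * genScore u j z with hc
  set Y := fderiv ℝ ψ z.2 c with hY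
  set q := hessSq u z with hq
  set Γ := genSq u z with hΓ
  have hΓ0 : 0 ≤ Γ := Finset.sum_nonneg fun _ _ => sq_nonneg _
  have hq0 : 0 ≤ q := hessSq_nonneg u z
  have hqd : q ≤ d * L ^ 2 := h.hessSq_le hz
  have hψ0 := hψ.nonneg z.2
  have hψ1 := hψ.le_one z.2
  have hcn : ‖c‖ ^ 2 ≤ q * Γ := by
    rw [norm_sq_eq_sum, hq, hessSq, Finset.sum_mul]
    refine Finset.sum_le_sum fun k _ => ?_
    exact Finset.sum_mul_sq_le_sq_mul_sq Finset.univ (fun j => dx k (dx j u) z)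
      (fun j => genScore u j z)
  have hYn : Y ^ 2 ≤ ε ^ 2 * (q * Γ) := by
    have h1 : |Y| ≤ ε * ‖c‖ := (ContinuousLinearMap.le_opNorm _ _).trans
      (mul_le_mul_of_nonneg_right (hψ.norm_fderiv_le' z.2) (norm_nonneg _))
    calc Y ^ 2 = |Y| ^ 2 := (sq_abs Y).symm
      _ ≤ (ε * ‖c‖) ^ 2 := by gcongr
      _ = ε ^ 2 * ‖c‖ ^ 2 := by ring
      _ ≤ _ := by gcongr
  -- Twice the divergence contains `2 ψ² Γ`. One copy is spent here, by the arithmetic-geometric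
  -- mean inequality, on the gradient of the cutoff; the other is the left side of the claim.
  have hY4 : |4 * ψ z.2 * Y| ≤ ψ z.2 ^ 2 * Γ + 4 * ε ^ 2 * q := by
    refine abs_le_of_sq_le_sq ?_ (by positivity)
    have : (4 * ψ z.2 * Y) ^ 2 ≤ 16 * ψ z.2 ^ 2 * (ε ^ 2 * (q * Γ)) := by
      rw [mul_pow, mul_pow]
      nlinarith [mul_le_mul_of_nonneg_left hYn (sq_nonneg (ψ z.2))]
    nlinarith [sq_nonneg (ψ z.2 ^ 2 * Γ - 4 * ε ^ 2 * q)]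
  have hv : |fderiv ℝ ψ z.2 (ouField u z.1 z.2)| ≤ ε * C := by
    refine ((fderiv ℝ ψ z.2).le_opNorm (ouField u z.1 z.2)).trans ?_
    calc _ ≤ ‖fderiv ℝ ψ z.2‖ * (C * (1 + ‖z.2‖)) := by gcongr; exact hC z hz
      _ = ‖fderiv ℝ ψ z.2‖ * (1 + ‖z.2‖) * C := by ring
      _ ≤ ε * C := by gcongr; exact hψ.norm_fderiv_le z.2
  have hR := (abs_le.1 (h.abs_hessCube_le hz)).2
  have b1 : 2 * ψ z.2 * fderiv ℝ ψ z.2 (ouField u z.1 z.2) * q ≤ 2 * ε * C * q := by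
    have : ψ z.2 * fderiv ℝ ψ z.2 (ouField u z.1 z.2) ≤ 1 * (ε * C) := by
      calc _ ≤ ψ z.2 * (ε * C) := by gcongr; exact (le_abs_self _).trans hv
        _ ≤ _ := by gcongr
    nlinarith [mul_le_mul_of_nonneg_right this hq0]
  have hψ2 : ψ z.2 ^ 2 ≤ 1 := pow_le_one₀ hψ0 hψ1
  have b2 : ψ z.2 ^ 2 * (4 * q + 2 * hessCube u z) ≤ 4 * q + 2 * (L * q) := by
    have hL : (0 : ℝ) ≤ L := L.2
    calc _ ≤ ψ z.2 ^ 2 * (4 * q + 2 * (L * q)) := by gcongr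
      _ ≤ 1 * (4 * q + 2 * (L * q)) := by gcongr
      _ = _ := one_mul _
  have b3 : q * (4 + 2 * L + (4 * ε ^ 2 + 2 * ε * C)) ≤
      d * L ^ 2 * (4 + 2 * L + (4 * ε ^ 2 + 2 * ε * C)) := by gcongr
  have := (abs_le.1 hY4).1
  nlinarith

end Pointwise

/-! ### Fisher information and space-time energy bounds -/

section IntegratedEnergy

/-- With lower Lebesgue integrals, a uniform bound on an exhausting sequence yields the global
bound. The energies thus need not be known to be finite beforehand. -/
theorem lintegral_le_of_forall_setLIntegral_le {α : Type} [MeasurableSpace α] {ρ : Measure α}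
    {f : α → ℝ≥0∞} {S : ℕ → Set α} (hS : Monotone S) (hU : ⋃ n, S n = univ) {c : ℝ≥0∞}
    (h : ∀ n, ∫⁻ x in S n, f x ∂ρ ≤ c) : ∫⁻ x, f x ∂ρ ≤ c := by
  rw [← setLIntegral_univ, ← hU, setLIntegral_iUnion_of_directed f hS.directed_le]
  exact iSup_le h

variable {d : ℕ} {u : ℝ × Vec d → ℝ} {L : ℝ≥0} {a b t : ℝ} {K : Set (Vec d)}
  {f : ℝ × Vec d → ℝ} {ψ : Vec d → ℝ}

/-- The squared norm of the spatial gradient. -/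
noncomputable def gradSq (u : ℝ × Vec d → ℝ) (z : ℝ × Vec d) : ℝ := ∑ j, dx j u z ^ 2

/-- The field whose weighted divergence gives the Fisher information. -/
noncomputable def gradFlux (u : ℝ × Vec d → ℝ) (ψ : Vec d → ℝ) (k : Fin d) (z : ℝ × Vec d) : ℝ :=
  ψ z.2 ^ 2 * dx k u z

/-- The divergence of `ψ² ∇u` with weight `exp u` is `ψ² (Δu + |∇u|²)` plus a cutoff term, and `Δu ≥
-dL`. Doubling it provides a spare `ψ² |∇u|²` that absorbs the cutoff term. -/
theorem IsLogOU.sq_mul_gradSq_le (h : IsLogOU u L a b) {ε R : ℝ} (hψ : IsCutoff ε R ψ)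
    {z : ℝ × Vec d} (hz : z.1 ∈ Icc a b) :
    ψ z.2 ^ 2 * gradSq u z ≤
      2 * ∑ k, (dx k (gradFlux u ψ k) z + dx k u z * gradFlux u ψ k z) +
        (2 * (d * L) + 4 * ε ^ 2) := by
  have hU := isOpen_posTime' (d := d)
  have hzp := h.mem_posTime hz
  have dψ := differentiableAt_of_contDiffOn hU (contDiffOn_comp_snd hψ.contDiff) hzp
  have du : ∀ k, DifferentiableAt ℝ (dx k u) z := fun k =>
    differentiableAt_of_contDiffOn hU (contDiffOn_pd hU h.contDiffOn _) hzp
  have e1 : ∀ k, dx k (gradFlux u ψ k) z = 2 * ψ z.2 * fderiv ℝ ψ z.2 (unitVec k) * dx k u z +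
      ψ z.2 ^ 2 * dx k (dx k u) z := fun k => by
    unfold gradFlux
    rw [dx, pd_mul (dψ.fun_pow 2) (du k), pd_sq dψ, pd_comp_snd hψ.contDiff]
  set Y := fderiv ℝ ψ z.2 (spaceGrad u z) with hY
  have e3 : Y = ∑ k, dx k u z * fderiv ℝ ψ z.2 (unitVec k) := by
    rw [hY]
    conv_lhs => rw [sum_smul_unitVec (spaceGrad u z)]
    simp [map_sum, map_smul]
  set Δ := ∑ k, dx k (dx k u) z with hΔ
  have e2 : ∑ k, (dx k (gradFlux u ψ k) z + dx k u z * gradFlux u ψ k z) =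
      2 * ψ z.2 * Y + ψ z.2 ^ 2 * Δ + ψ z.2 ^ 2 * gradSq u z := by
    rw [e3, hΔ, gradSq, Finset.mul_sum, Finset.mul_sum, Finset.mul_sum, ← Finset.sum_add_distrib,
      ← Finset.sum_add_distrib]
    refine Finset.sum_congr rfl fun k _ => ?_
    rw [e1, gradFlux]
    ring
  rw [e2]
  have hψ0 := hψ.nonneg z.2
  have hψ2 : ψ z.2 ^ 2 ≤ 1 := pow_le_one₀ hψ0 (hψ.le_one z.2)
  have hΔ' : |Δ| ≤ d * L := by
    refine (Finset.abs_sum_le_sum_abs _ _).trans ?_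
    calc _ ≤ ∑ _k : Fin d, (L : ℝ) := Finset.sum_le_sum fun k _ => h.abs_dx_dx_le hz k k
      _ = _ := by simp
  have b1 : -(d * L : ℝ) ≤ ψ z.2 ^ 2 * Δ := by
    have h1 : ψ z.2 ^ 2 * |Δ| ≤ 1 * (d * L) := by gcongr
    have h2 := mul_le_mul_of_nonneg_left (neg_abs_le Δ) (sq_nonneg (ψ z.2))
    linarith
  have hn : ‖spaceGrad u z‖ ^ 2 = gradSq u z := norm_sq_eq_sum _
  have hYn : Y ^ 2 ≤ ε ^ 2 * gradSq u z := by
    have h1 : |Y| ≤ ε * ‖spaceGrad u z‖ := (ContinuousLinearMap.le_opNorm _ _).trans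
      (mul_le_mul_of_nonneg_right (hψ.norm_fderiv_le' z.2) (norm_nonneg _))
    rw [← hn, ← sq_abs Y, ← mul_pow]
    gcongr
  have hg0 : 0 ≤ gradSq u z := Finset.sum_nonneg fun _ _ => sq_nonneg _
  have b2 : |4 * ψ z.2 * Y| ≤ ψ z.2 ^ 2 * gradSq u z + 4 * ε ^ 2 := by
    refine abs_le_of_sq_le_sq ?_ (by positivity)
    have : (4 * ψ z.2 * Y) ^ 2 ≤ 16 * ψ z.2 ^ 2 * (ε ^ 2 * gradSq u z) := by
      rw [mul_pow, mul_pow]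
      nlinarith [mul_le_mul_of_nonneg_left hYn (sq_nonneg (ψ z.2))]
    nlinarith [sq_nonneg (ψ z.2 ^ 2 * gradSq u z - 4 * ε ^ 2)]
  have := (abs_le.1 b2).1
  linarith

theorem continuousOn_dx (hu : ContDiffOn ℝ ∞ u (posTime d)) (k : Fin d) :
    ContinuousOn (dx k u) (posTime d) := (contDiffOn_pd isOpen_posTime' hu _).continuousOn

theorem IsTest.weightedDiv (hu : ContDiffOn ℝ ∞ u (posTime d)) (hK : IsClosed K)
    {F : Fin d → ℝ × Vec d → ℝ} (hF : ∀ k, ContDiffOn ℝ ∞ (F k) (posTime d))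
    (h0 : ∀ k, ∀ z, z.2 ∉ K → F k z = 0) :
    IsTest K fun z => ∑ k, (dx k (F k) z + dx k u z * F k z) :=
  .sum fun k _ => (IsTest.pd hK (hF k) (h0 k) _).add
    (IsTest.mul_left ⟨(hF k).continuousOn, h0 k⟩ (continuousOn_dx hu k))

theorem IsLogOU.integral_weightedDiv (h : IsLogOU u L a b) (ht : t ∈ Icc a b) (hK : IsCompact K)
    {F : Fin d → ℝ × Vec d → ℝ} (hF : ∀ k, ContDiffOn ℝ ∞ (F k) (posTime d))
    (h0 : ∀ k, ∀ z, z.2 ∉ K → F k z = 0) :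
    ∫ x, ∑ k, (dx k (F k) (t, x) + dx k u (t, x) * F k (t, x)) ∂(sliceLaw u t) = 0 := by
  have := h.isProbabilityMeasure t ht
  have ht0 := h.pos.trans_le ht.1
  rw [integral_finsetSum]
  · exact Finset.sum_eq_zero fun k _ => h.integral_dx_add_eq_zero ht hK (hF k) (h0 k) k
  · intro k _
    exact ((IsTest.pd hK.isClosed (hF k) (h0 k) _).add (IsTest.mul_left
      ⟨(hF k).continuousOn, h0 k⟩ (continuousOn_dx h.contDiffOn k))).integrable_slice hK ht0 _

theorem IsCutoff.eq_zero_of_notMem {ε R : ℝ} (_hψ : IsCutoff ε R ψ) {x : Vec d}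
    (hx : x ∉ tsupport ψ) : ψ x = 0 := image_eq_zero_of_notMem_tsupport hx

/-- The Fisher information bound. -/
theorem IsLogOU.lintegral_gradSq_le (h : IsLogOU u L a b) (ht : t ∈ Icc a b) :
    ∫⁻ x, ENNReal.ofReal (gradSq u (t, x)) ∂(sliceLaw u t) ≤ ENNReal.ofReal (2 * (d * L)) := by
  have := h.isProbabilityMeasure t ht
  have ht0 := h.pos.trans_le ht.1
  refine lintegral_le_of_forall_setLIntegral_le (S := fun n : ℕ => Metric.closedBall 0 n)
    (fun m n hmn => Metric.closedBall_subset_closedBall (by exact_mod_cast hmn))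
    (Metric.iUnion_closedBall_nat 0) fun n => ?_
  have key : ∀ ε : ℝ, 0 < ε → ∫⁻ x in Metric.closedBall 0 n,
      ENNReal.ofReal (gradSq u (t, x)) ∂(sliceLaw u t) ≤
        ENNReal.ofReal (2 * (d * L) + 4 * ε ^ 2) := by
    intro ε hε
    obtain ⟨ψ, hψ⟩ := exists_isCutoff d n hε
    have hK : IsCompact (tsupport ψ) := hψ.hasCompactSupport
    have hF : ∀ k, ContDiffOn ℝ ∞ (gradFlux u ψ k) (posTime d) := fun k =>
      ((contDiffOn_comp_snd hψ.contDiff).pow 2).mul (contDiffOn_pd isOpen_posTime' h.contDiffOn _)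
    have h0 : ∀ k, ∀ z : ℝ × Vec d, z.2 ∉ tsupport ψ → gradFlux u ψ k z = 0 := fun k z hz => by
      simp [gradFlux, hψ.eq_zero_of_notMem hz]
    have t1 := IsTest.weightedDiv h.contDiffOn hK.isClosed hF h0
    have t2 : IsTest (tsupport ψ) fun z : ℝ × Vec d => ψ z.2 ^ 2 * gradSq u z := by
      refine ⟨((contDiffOn_comp_snd hψ.contDiff).pow 2).continuousOn.mul
        (continuousOn_finsetSum _ fun k _ => (continuousOn_dx h.contDiffOn k).pow 2), fun z hz => ?_⟩
      simp [hψ.eq_zero_of_notMem hz]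
    have i1 := t1.integrable_slice hK ht0 (sliceLaw u t)
    have i2 := t2.integrable_slice hK ht0 (sliceLaw u t)
    have hg0 : ∀ z, 0 ≤ gradSq u z := fun z => Finset.sum_nonneg fun _ _ => sq_nonneg _
    calc ∫⁻ x in Metric.closedBall 0 n, ENNReal.ofReal (gradSq u (t, x)) ∂(sliceLaw u t)
        ≤ ∫⁻ x in Metric.closedBall 0 n, ENNReal.ofReal (ψ x ^ 2 * gradSq u (t, x))
            ∂(sliceLaw u t) := by
          refine setLIntegral_mono' Metric.isClosed_closedBall.measurableSet fun x hx => ?_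
          rw [hψ.eq_one x (mem_closedBall_zero_iff.1 hx)]
          simp
      _ ≤ ∫⁻ x, ENNReal.ofReal (ψ x ^ 2 * gradSq u (t, x)) ∂(sliceLaw u t) :=
          setLIntegral_le_lintegral _ _
      _ = ENNReal.ofReal (∫ x, ψ x ^ 2 * gradSq u (t, x) ∂(sliceLaw u t)) :=
          (ofReal_integral_eq_lintegral_ofReal i2
            (.of_forall fun x => mul_nonneg (sq_nonneg _) (hg0 _))).symm
      _ ≤ ENNReal.ofReal (∫ x, (2 * ∑ k, (dx k (gradFlux u ψ k) (t, x) +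
            dx k u (t, x) * gradFlux u ψ k (t, x)) + (2 * (d * L) + 4 * ε ^ 2))
            ∂(sliceLaw u t)) := by
          refine ENNReal.ofReal_le_ofReal (integral_mono i2
            ((i1.const_mul 2).add (integrable_const _)) fun x => ?_)
          exact h.sq_mul_gradSq_le hψ (z := (t, x)) ht
      _ = _ := by
          rw [integral_add (i1.const_mul 2) (integrable_const _), integral_const_mul,
            h.integral_weightedDiv ht hK hF h0]
          simp
  refine ENNReal.le_of_forall_pos_le_add fun η hη _ => ?_
  -- With this choice the cutoff error `4 ε²` equals `η`.
  refine (key (Real.sqrt η / 2) (by positivity)).trans ?_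
  rw [← ENNReal.ofReal_coe_nnreal, ← ENNReal.ofReal_add (by positivity) (by positivity)]
  refine ENNReal.ofReal_le_ofReal ?_
  rw [div_pow, Real.sq_sqrt (NNReal.coe_nonneg η)]
  linarith

/-- Time on `(a, b]` times the law at time `a`. -/
noncomputable abbrev timeLaw (u : ℝ × Vec d → ℝ) (a b : ℝ) : Measure (ℝ × Vec d) :=
  (volume.restrict (Ioc a b)).prod (sliceLaw u a)

namespace IsLogOU

variable (h : IsLogOU u L a b) (hab : a ≤ b) {Φ : ℝ → Vec d → Vec d} (hΦ : IsOUFlow u a b Φ)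

include h hab

theorem isFiniteMeasure_timeLaw : IsFiniteMeasure (timeLaw u a b) := by
  have := h.isProbabilityMeasure a (left_mem_Icc.2 hab)
  infer_instance

theorem ae_timeLaw_mem : ∀ᵐ z ∂(timeLaw u a b), z.1 ∈ Icc a b := by
  have := h.isProbabilityMeasure a (left_mem_Icc.2 hab)
  rw [timeLaw, ← Measure.restrict_univ (μ := sliceLaw u a), Measure.prod_restrict]
  filter_upwards [ae_restrict_mem (measurableSet_Ioc.prod MeasurableSet.univ)] with z hz
  exact Ioc_subset_Icc_self hz.1

include hΦ

theorem aestronglyMeasurable_flow (hf : ContinuousOn f (posTime d)) :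
    AEStronglyMeasurable (fun z : ℝ × Vec d => f (z.1, Φ z.1 z.2)) (timeLaw u a b) := by
  have := h.isProbabilityMeasure a (left_mem_Icc.2 hab)
  rw [timeLaw, ← Measure.restrict_univ (μ := sliceLaw u a), Measure.prod_restrict]
  refine ContinuousOn.aestronglyMeasurable ?_ (measurableSet_Ioc.prod MeasurableSet.univ)
  refine hf.comp (continuousOn_fst.prodMk ((h.continuousOn_flow hΦ).mono
    (prod_mono_left Ioc_subset_Icc_self))) fun z hz => ?_
  exact h.pos.trans hz.1.1

theorem integrable_flow (hf : IsTest K f) (hK : IsCompact K) :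
    Integrable (fun z : ℝ × Vec d => f (z.1, Φ z.1 z.2)) (timeLaw u a b) := by
  have := h.isFiniteMeasure_timeLaw hab
  obtain ⟨C, -, hC⟩ := hf.exists_bound (b := b) hK h.pos
  refine .of_bound (h.aestronglyMeasurable_flow hab hΦ hf.continuousOn) C ?_
  filter_upwards [h.ae_timeLaw_mem hab] with z hz
  exact hC _ hz

/-- On the left the base measure stays `p_a` and the flow moves the point. Invariance turns this at
each time into an integral against `p_t`, where integration by parts is available. -/
theorem integral_flow (hf : IsTest K f) (hK : IsCompact K) :
    ∫ z, f (z.1, Φ z.1 z.2) ∂(timeLaw u a b) =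
      ∫ t in Ioc a b, ∫ x, f (t, x) ∂(sliceLaw u t) := by
  have := h.isProbabilityMeasure a (left_mem_Icc.2 hab)
  rw [timeLaw, integral_prod _ (h.integrable_flow hab hΦ hf hK)]
  refine setIntegral_congr_fun measurableSet_Ioc fun t ht => ?_
  have ht' := Ioc_subset_Icc_self ht
  have hm := h.measurePreserving_flow hΦ ht'
  simp only
  rw [← hm.map_eq, integral_map hm.aemeasurable
    (hf.continuous_slice (h.pos.trans ht.1)).aestronglyMeasurable]

/-- The fundamental theorem of calculus is applied along each trajectory and then integrated over
starting points, so no integral against `p_t` has to be differentiated in time. -/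
theorem integral_flowDeriv (hf : ContDiffOn ℝ ∞ f (posTime d)) (hK : IsCompact K)
    (h0 : ∀ z, z.2 ∉ K → f z = 0) :
    ∫ z, flowDeriv u f (z.1, Φ z.1 z.2) ∂(timeLaw u a b) =
      ∫ x, (f (b, Φ b x) - f (a, x)) ∂(sliceLaw u a) := by
  have := h.isProbabilityMeasure a (left_mem_Icc.2 hab)
  have ht : IsTest K (flowDeriv u f) := by
    have t1 : IsTest K (fun z => dt f z + ∑ i, (ouField u z.1 z.2) i * dx i f z) := by
      refine (IsTest.pd hK.isClosed hf h0 _).add (.sum fun i _ => IsTest.mul_left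
        (IsTest.pd hK.isClosed hf h0 _) ?_)
      exact ((EuclideanSpace.proj (𝕜 := ℝ) i).continuous.comp_continuousOn
        (contDiffOn_ouField h.contDiffOn).continuousOn)
    convert t1 using 1
    ext z
    rw [flowDeriv, pd_eq_dt_add_sum_dx, one_mul]
  have hi := h.integrable_flow hab hΦ ht hK
  rw [timeLaw, integral_prod_symm _ hi]
  refine integral_congr_ae ?_
  filter_upwards [hi.prod_left_ae] with x hx
  have hder : ∀ t ∈ Icc a b, HasDerivWithinAt (fun t => f (t, Φ t x))
      (flowDeriv u f (t, Φ t x)) (Icc a b) t := fun t ht => by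
    have := hasDerivWithinAt_comp_curve (y := fun t => Φ t x)
      (differentiableAt_of_contDiffOn isOpen_posTime' hf
        (prodMk_mem_posTime (h.pos.trans_le ht.1) (Φ t x))) (hΦ.curve x t ht)
    rw [flowDeriv, pd_eq_dt_add_sum_dx, one_mul]
    exact this
  have hint : IntervalIntegrable (fun t => flowDeriv u f (t, Φ t x)) volume a b :=
    (intervalIntegrable_iff_integrableOn_Ioc_of_le hab).2 hx
  have := intervalIntegral.integral_eq_sub_of_hasDerivAt_of_le hab
    (fun t ht => (hder t ht).continuousWithinAt)
    (fun t ht => (hder t (Ioo_subset_Icc_self ht)).hasDerivAt (Icc_mem_nhds ht.1 ht.2)) hint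
  rw [intervalIntegral.integral_of_le hab] at this
  rw [this, hΦ.init]

/-- In the integrated pointwise inequality the divergence vanishes at every time, and the flow
derivative leaves the difference of the localized `|∇²u|²` at the two ends. The final value is
nonnegative and the initial one is at most `d L²`. -/
theorem integral_sq_mul_genSq_le {ε R C : ℝ} (hψ : IsCutoff ε R ψ)
    (hε : 0 ≤ ε) (hC0 : 0 ≤ C)
    (hC : ∀ z : ℝ × Vec d, z.1 ∈ Icc a b → ‖ouField u z.1 z.2‖ ≤ C * (1 + ‖z.2‖)) :
    ∫⁻ z, ENNReal.ofReal (ψ (Φ z.1 z.2) ^ 2 * genSq u (z.1, Φ z.1 z.2)) ∂(timeLaw u a b) ≤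
      ENNReal.ofReal (d * L ^ 2 * (1 + (b - a) * (4 + 2 * L + (4 * ε ^ 2 + 2 * ε * C)))) := by
  have := h.isProbabilityMeasure a (left_mem_Icc.2 hab)
  have := h.isFiniteMeasure_timeLaw hab
  have hK : IsCompact (tsupport ψ) := hψ.hasCompactSupport
  have hF : ∀ k, ContDiffOn ℝ ∞ (energyFlux u ψ k) (posTime d) :=
    contDiffOn_energyFlux h.contDiffOn hψ.contDiff
  have h0 : ∀ k, ∀ z : ℝ × Vec d, z.2 ∉ tsupport ψ → energyFlux u ψ k z = 0 := fun k z hz => by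
    simp [energyFlux, hψ.eq_zero_of_notMem hz]
  have h0' : ∀ z : ℝ × Vec d, z.2 ∉ tsupport ψ → cutHess u ψ z = 0 := fun z hz => by
    simp [cutHess, hψ.eq_zero_of_notMem hz]
  have t1 : IsTest (tsupport ψ) (energyDiv u ψ) :=
    IsTest.weightedDiv h.contDiffOn hK.isClosed hF h0
  have t2 : IsTest (tsupport ψ) fun z : ℝ × Vec d => ψ z.2 ^ 2 * genSq u z := by
    refine ⟨((contDiffOn_comp_snd hψ.contDiff).pow 2).continuousOn.mul (continuousOn_finsetSum _
      fun k _ => (contDiffOn_genScore h.contDiffOn k).continuousOn.pow 2), fun z hz => ?_⟩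
    simp [hψ.eq_zero_of_notMem hz]
  have hcut := contDiffOn_cutHess h.contDiffOn hψ.contDiff
  have t3 : IsTest (tsupport ψ) (flowDeriv u (cutHess u ψ)) := by
    refine ⟨?_, fun z hz => pd_eq_zero_of_eq_zero hK.isClosed h0' hz _⟩
    rw [show flowDeriv u (cutHess u ψ) = fun z => dt (cutHess u ψ) z +
      ∑ i, (ouField u z.1 z.2) i * dx i (cutHess u ψ) z from funext fun z => by
        rw [flowDeriv, pd_eq_dt_add_sum_dx, one_mul]]
    refine (contDiffOn_pd isOpen_posTime' hcut _).continuousOn.add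
      (continuousOn_finsetSum _ fun i _ => ContinuousOn.mul ?_ (continuousOn_dx hcut i))
    exact ((EuclideanSpace.proj (𝕜 := ℝ) i).continuous.comp_continuousOn
      (contDiffOn_ouField h.contDiffOn).continuousOn)
  have i1 := h.integrable_flow hab hΦ t1 hK
  have i2 := h.integrable_flow hab hΦ t2 hK
  have i3 := h.integrable_flow hab hΦ t3 hK
  have hg0 : ∀ z, 0 ≤ genSq u z := fun z => Finset.sum_nonneg fun _ _ => sq_nonneg _
  rw [← ofReal_integral_eq_lintegral_ofReal i2
    (.of_forall fun z => mul_nonneg (sq_nonneg _) (hg0 _))]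
  refine ENNReal.ofReal_le_ofReal ?_
  set c : ℝ := d * L ^ 2 * (4 + 2 * L + (4 * ε ^ 2 + 2 * ε * C)) with hc
  have e1 : ∫ z, energyDiv u ψ (z.1, Φ z.1 z.2) ∂(timeLaw u a b) = 0 := by
    rw [h.integral_flow hab hΦ t1 hK]
    refine setIntegral_eq_zero_of_forall_eq_zero fun t ht => ?_
    exact h.integral_weightedDiv (Ioc_subset_Icc_self ht) hK hF h0
  have e2 : -(d * L ^ 2 : ℝ) ≤ ∫ z, flowDeriv u (cutHess u ψ) (z.1, Φ z.1 z.2) ∂(timeLaw u a b) := by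
    rw [h.integral_flowDeriv hab hΦ hcut hK h0']
    have hle : ∀ x, -(d * L ^ 2 : ℝ) ≤ cutHess u ψ (b, Φ b x) - cutHess u ψ (a, x) := fun x => by
      have p1 : 0 ≤ cutHess u ψ (b, Φ b x) := mul_nonneg (sq_nonneg _) (hessSq_nonneg _ _)
      have p2 : cutHess u ψ (a, x) ≤ 1 * (d * L ^ 2) :=
        mul_le_mul (pow_le_one₀ (hψ.nonneg _) (hψ.le_one _))
          (h.hessSq_le (z := (a, x)) (left_mem_Icc.2 hab)) (hessSq_nonneg _ _) zero_le_one
      linarith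
    have t4 : IsTest (tsupport ψ) (cutHess u ψ) := ⟨hcut.continuousOn, h0'⟩
    obtain ⟨C', -, hC'⟩ := t4.exists_bound (b := b) hK h.pos
    have hbm := right_mem_Icc.2 hab
    have j1 : Integrable (fun x => cutHess u ψ (b, Φ b x)) (sliceLaw u a) :=
      .of_bound ((t4.continuous_slice (h.pos.trans_le hab)).comp
        (h.continuous_flow hΦ hbm)).aestronglyMeasurable C' (.of_forall fun x => hC' _ hbm)
    have j2 := t4.integrable_slice hK h.pos (sliceLaw u a)
    calc -(d * L ^ 2 : ℝ) = ∫ _x, -(d * L ^ 2 : ℝ) ∂(sliceLaw u a) := by simp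
      _ ≤ _ := integral_mono (integrable_const _) (j1.sub j2) hle
  have e3 : ∫ z, ψ (Φ z.1 z.2) ^ 2 * genSq u (z.1, Φ z.1 z.2) ∂(timeLaw u a b) ≤
      ∫ z, (2 * energyDiv u ψ (z.1, Φ z.1 z.2) - flowDeriv u (cutHess u ψ) (z.1, Φ z.1 z.2) + c)
        ∂(timeLaw u a b) := by
    refine integral_mono_ae i2 (((i1.const_mul 2).sub i3).add (integrable_const c)) ?_
    filter_upwards [h.ae_timeLaw_mem hab] with z hz
    exact h.sq_mul_genSq_le hψ hε hC0 hC (z := (z.1, Φ z.1 z.2)) hz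
  have i13 : Integrable (fun z => 2 * energyDiv u ψ (z.1, Φ z.1 z.2) -
      flowDeriv u (cutHess u ψ) (z.1, Φ z.1 z.2)) (timeLaw u a b) := (i1.const_mul 2).sub i3
  rw [integral_add i13 (integrable_const c),
    integral_sub (i1.const_mul 2) i3, integral_const_mul, e1, integral_const] at e3
  have e4 : (timeLaw u a b).real univ = b - a := by
    rw [Measure.real, timeLaw, ← univ_prod_univ, Measure.prod_prod]
    simp [hab]
  rw [e4, smul_eq_mul] at e3
  calc _ ≤ _ := e3
    _ ≤ _ := by rw [hc]; linarith

/-- The space-time energy bound. -/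
theorem lintegral_genSq_le :
    ∫⁻ z, ENNReal.ofReal (genSq u (z.1, Φ z.1 z.2)) ∂(timeLaw u a b) ≤
      ENNReal.ofReal (d * L ^ 2 * (1 + (b - a) * (4 + 2 * L))) := by
  obtain ⟨C, hC0, hC⟩ := h.exists_bound_ouField
  have hba := sub_nonneg.2 hab
  refine lintegral_le_of_forall_setLIntegral_le
    -- The exhaustion is by the position at time `t`, not the starting point, because that is where
    -- the cutoff is evaluated.
    (S := fun n : ℕ => {z : ℝ × Vec d | ‖Φ z.1 z.2‖ ≤ n})
    (fun m n hmn z hz => le_trans (α := ℝ) hz (by exact_mod_cast hmn))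
    (eq_univ_of_forall fun z => mem_iUnion.2 (exists_nat_ge ‖Φ z.1 z.2‖)) fun n => ?_
  have key : ∀ ε : ℝ, 0 < ε → ∫⁻ z in {z : ℝ × Vec d | ‖Φ z.1 z.2‖ ≤ n},
      ENNReal.ofReal (genSq u (z.1, Φ z.1 z.2)) ∂(timeLaw u a b) ≤
      ENNReal.ofReal (d * L ^ 2 * (1 + (b - a) * (4 + 2 * L + (4 * ε ^ 2 + 2 * ε * C)))) := by
    intro ε hε
    obtain ⟨ψ, hψ⟩ := exists_isCutoff d n hε
    refine le_trans ?_ (h.integral_sq_mul_genSq_le hab hΦ hψ hε.le hC0 hC)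
    refine le_trans ?_ (setLIntegral_le_lintegral {z : ℝ × Vec d | ‖Φ z.1 z.2‖ ≤ n} _)
    have hm : NullMeasurableSet {z : ℝ × Vec d | ‖Φ z.1 z.2‖ ≤ n} (timeLaw u a b) := by
      have h1 := h.aestronglyMeasurable_flow hab hΦ (f := fun z => ‖z.2‖)
        (continuous_snd.norm.continuousOn)
      exact nullMeasurableSet_le h1.aemeasurable aemeasurable_const
    refine lintegral_mono_ae ?_
    filter_upwards [ae_restrict_mem₀ hm] with z hz
    rw [hψ.eq_one _ hz]
    simp
  have hlim : Filter.Tendsto (fun ε : ℝ => ENNReal.ofReal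
      (d * L ^ 2 * (1 + (b - a) * (4 + 2 * L + (4 * ε ^ 2 + 2 * ε * C))))) (𝓝[>] 0)
      (𝓝 (ENNReal.ofReal (d * L ^ 2 * (1 + (b - a) * (4 + 2 * L))))) := by
    have hc : Continuous fun ε : ℝ => ENNReal.ofReal
      (d * L ^ 2 * (1 + (b - a) * (4 + 2 * L + (4 * ε ^ 2 + 2 * ε * C)))) :=
      ENNReal.continuous_ofReal.comp (by fun_prop)
    have := (hc.tendsto 0).mono_left (nhdsWithin_le_nhds (s := Ioi 0))
    simpa using this
  refine ge_of_tendsto hlim ?_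
  filter_upwards [self_mem_nhdsWithin] with ε hε
  exact key ε hε

/-- The squared norm of the velocity of the score along the flow. -/
theorem lintegral_speedSq_le (hL : 1 ≤ L) :
    ∫⁻ z, ENNReal.ofReal (∑ j, (genScore u j (z.1, Φ z.1 z.2) + dx j u (z.1, Φ z.1 z.2)) ^ 2)
        ∂(timeLaw u a b) ≤
      ENNReal.ofReal (2 * (d * L ^ 2) + 16 * ((b - a) * (d * L ^ 3))) := by
  have := h.isProbabilityMeasure a (left_mem_Icc.2 hab)
  have hba := sub_nonneg.2 hab
  have hL' : (1 : ℝ) ≤ L := by exact_mod_cast hL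
  have hG : ContinuousOn (gradSq u) (posTime d) :=
    continuousOn_finsetSum _ fun k _ => (continuousOn_dx h.contDiffOn k).pow 2
  have hmG := (h.aestronglyMeasurable_flow hab hΦ hG).aemeasurable.ennreal_ofReal
  have e1 : ∫⁻ z, ENNReal.ofReal (gradSq u (z.1, Φ z.1 z.2)) ∂(timeLaw u a b) ≤
      ENNReal.ofReal ((b - a) * (2 * (d * L))) := by
    rw [timeLaw, lintegral_prod _ hmG]
    calc _ ≤ ∫⁻ _t in Ioc a b, ENNReal.ofReal (2 * (d * L)) := by
          refine setLIntegral_mono' measurableSet_Ioc fun t ht => ?_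
          have ht' := Ioc_subset_Icc_self ht
          have hm := h.measurePreserving_flow hΦ ht'
          refine le_trans (le_of_eq ?_) (h.lintegral_gradSq_le ht')
          have hc : Continuous fun x => gradSq u (t, x) := by
            refine continuous_iff_continuousAt.2 fun x => ?_
            have := hG.continuousAt (isOpen_posTime'.mem_nhds
              (prodMk_mem_posTime (h.pos.trans ht.1) x))
            exact this.comp (f := fun x => (t, x)) (by fun_prop)
          exact hm.lintegral_comp hc.measurable.ennreal_ofReal
      _ = _ := by
          rw [setLIntegral_const, Real.volume_Ioc, mul_comm, ← ENNReal.ofReal_mul hba]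
  calc _ ≤ ∫⁻ z, (2 * ENNReal.ofReal (genSq u (z.1, Φ z.1 z.2)) +
          2 * ENNReal.ofReal (gradSq u (z.1, Φ z.1 z.2))) ∂(timeLaw u a b) := by
        refine lintegral_mono fun z => ?_
        have h2 : (2 : ℝ≥0∞) = ENNReal.ofReal 2 := by simp
        rw [h2, ← ENNReal.ofReal_mul zero_le_two, ← ENNReal.ofReal_mul zero_le_two,
          ← ENNReal.ofReal_add]
        · refine ENNReal.ofReal_le_ofReal ?_
          rw [genSq, gradSq, Finset.mul_sum, Finset.mul_sum, ← Finset.sum_add_distrib]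
          refine Finset.sum_le_sum fun j _ => ?_
          nlinarith [sq_nonneg (genScore u j (z.1, Φ z.1 z.2) - dx j u (z.1, Φ z.1 z.2))]
        · exact mul_nonneg zero_le_two (Finset.sum_nonneg fun _ _ => sq_nonneg _)
        · exact mul_nonneg zero_le_two (Finset.sum_nonneg fun _ _ => sq_nonneg _)
    _ = 2 * ∫⁻ z, ENNReal.ofReal (genSq u (z.1, Φ z.1 z.2)) ∂(timeLaw u a b) +
          2 * ∫⁻ z, ENNReal.ofReal (gradSq u (z.1, Φ z.1 z.2)) ∂(timeLaw u a b) := by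
        rw [lintegral_add_right' _ (hmG.const_mul 2), lintegral_const_mul' _ _ (by simp),
          lintegral_const_mul' _ _ (by simp)]
    _ ≤ ENNReal.ofReal 2 * ENNReal.ofReal (d * L ^ 2 * (1 + (b - a) * (4 + 2 * L))) +
          ENNReal.ofReal 2 * ENNReal.ofReal ((b - a) * (2 * (d * L))) := by
        have h2 : (2 : ℝ≥0∞) ≤ ENNReal.ofReal 2 := by simp
        exact add_le_add (mul_le_mul' h2 (h.lintegral_genSq_le hab hΦ)) (mul_le_mul' h2 e1)
    _ ≤ _ := by
        rw [← ENNReal.ofReal_mul zero_le_two, ← ENNReal.ofReal_mul zero_le_two,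
          ← ENNReal.ofReal_add (by positivity) (by positivity)]
        refine ENNReal.ofReal_le_ofReal ?_
        -- For `L ≥ 1` the contributions `8 L²`, `4 L³` and `4 L` per unit of time and dimension
        -- merge into `16 L³`.
        have p1 : (L : ℝ) ^ 2 ≤ L ^ 3 := pow_le_pow_right₀ hL' (by norm_num)
        have p2 : (L : ℝ) ≤ L ^ 3 := le_self_pow₀ hL' (by norm_num)
        have q : 0 ≤ (b - a) * d := by positivity
        nlinarith [mul_le_mul_of_nonneg_left p1 q, mul_le_mul_of_nonneg_left p2 q]

end IsLogOU

end IntegratedEnergy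

/-! ### The local error of the exponential integrator -/

section OneStep

variable {d : ℕ} {u : ℝ × Vec d → ℝ} {L : ℝ≥0} {a b s s' τ : ℝ}

/-- The velocity of the score along the probability flow. -/
noncomputable def scoreSpeed (u : ℝ × Vec d → ℝ) (z : ℝ × Vec d) : Vec d :=
  WithLp.toLp 2 fun j => genScore u j z + dx j u z

theorem enorm_sq_eq_ofReal (x : Vec d) : ‖x‖ₑ ^ 2 = ENNReal.ofReal (∑ j, x j ^ 2) := by
  rw [← norm_sq_eq_sum, ENNReal.ofReal_pow (norm_nonneg _), ofReal_norm]

theorem contDiffOn_scoreSpeed (hu : ContDiffOn ℝ ∞ u (posTime d)) :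
    ContDiffOn ℝ ∞ (scoreSpeed u) (posTime d) := by
  rw [contDiffOn_piLp]
  exact fun i => (contDiffOn_genScore hu i).add (contDiffOn_pd isOpen_posTime' hu _)

theorem eLpNorm_two_eq {α E : Type} [MeasurableSpace α] [NormedAddCommGroup E] (f : α → E)
    (μ : Measure α) : eLpNorm f 2 μ = (∫⁻ x, ‖f x‖ₑ ^ 2 ∂μ) ^ (1 / 2 : ℝ) := by
  rw [eLpNorm_eq_lintegral_rpow_enorm_toReal (by simp) (by simp)]
  simp

theorem eLpNorm_two_sq {α E : Type} [MeasurableSpace α] [NormedAddCommGroup E] (f : α → E)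
    (μ : Measure α) : eLpNorm f 2 μ ^ 2 = ∫⁻ x, ‖f x‖ₑ ^ 2 ∂μ := by
  rw [eLpNorm_two_eq, ← ENNReal.rpow_natCast, ← ENNReal.rpow_mul]
  simp

theorem eLpNorm_two_le_ofReal {α E : Type} [MeasurableSpace α] [NormedAddCommGroup E] {f : α → E}
    {μ : Measure α} {c : ℝ} (hc : 0 ≤ c) (h : ∫⁻ x, ‖f x‖ₑ ^ 2 ∂μ ≤ ENNReal.ofReal (c ^ 2)) :
    eLpNorm f 2 μ ≤ ENNReal.ofReal c := by
  rw [← eLpNorm_two_sq, ENNReal.ofReal_pow hc] at h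
  exact (ENNReal.pow_le_pow_left_iff two_ne_zero).1 h

theorem lintegral_sq_le {α : Type} [MeasurableSpace α] {μ : Measure α} {f : α → ℝ≥0∞}
    (hf : AEMeasurable f μ) : (∫⁻ x, f x ∂μ) ^ 2 ≤ μ univ * ∫⁻ x, f x ^ 2 ∂μ := by
  have h := ENNReal.lintegral_mul_le_Lp_mul_Lq μ (p := 2) (q := 2)
    (Real.HolderConjugate.two_two) (aemeasurable_const (b := (1 : ℝ≥0∞))) hf
  simp only [Pi.mul_apply, one_mul, ENNReal.one_rpow, lintegral_const] at h
  calc _ ≤ ((μ univ) ^ (1 / 2 : ℝ) * (∫⁻ x, f x ^ (2 : ℝ) ∂μ) ^ (1 / 2 : ℝ)) ^ 2 := by gcongr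
    _ = _ := by
      rw [mul_pow, ← ENNReal.rpow_natCast, ← ENNReal.rpow_natCast, ← ENNReal.rpow_mul,
        ← ENNReal.rpow_mul]
      simp

/-- The mean square of the velocity of the score over the time interval `(s, s']`. -/
noncomputable def stepEnergy (u : ℝ × Vec d → ℝ) (a b : ℝ)
    (Φ : ℝ → Vec d → Vec d) (s s' : ℝ) : ℝ≥0∞ :=
  ∫⁻ z in Ioc s s' ×ˢ univ, ‖scoreSpeed u (z.1, Φ z.1 z.2)‖ₑ ^ 2 ∂(timeLaw u a b)

namespace IsLogOU

theorem mono (h : IsLogOU u L a b) {b' : ℝ} (hb : b' ≤ b) : IsLogOU u L a b' :=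
  ⟨h.pos, h.contDiffOn, h.dt_eq, fun t ht => h.lipschitz t ⟨ht.1, ht.2.trans hb⟩,
    fun t ht => h.isProbabilityMeasure t ⟨ht.1, ht.2.trans hb⟩⟩

variable (h : IsLogOU u L a b) {Φ : ℝ → Vec d → Vec d} (hΦ : IsOUFlow u a b Φ)

include h hΦ

theorem hasDerivWithinAt_score (x : Vec d) (hτ : τ ∈ Icc a b) :
    HasDerivWithinAt (fun t => spaceGrad u (t, Φ t x)) (scoreSpeed u (τ, Φ τ x)) (Icc a b) τ := by
  rw [hasDerivWithinAt_iff_hasFDerivWithinAt, hasFDerivWithinAt_euclidean]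
  intro j
  have hz := prodMk_mem_posTime (h.pos.trans_le hτ.1) (Φ τ x)
  have e := hasDerivWithinAt_comp_curve (y := fun t => Φ t x)
    (differentiableAt_of_contDiffOn isOpen_posTime' (contDiffOn_pd isOpen_posTime' h.contDiffOn
      (0, unitVec j)) hz) (hΦ.curve x τ hτ)
  refine e.congr_deriv ?_
  have e2 := h.flowDeriv_dx j hz
  rw [flowDeriv, pd_eq_dt_add_sum_dx, one_mul] at e2
  exact e2

theorem continuousOn_scoreSpeed_flow (x : Vec d) :
    ContinuousOn (fun t => scoreSpeed u (t, Φ t x)) (Icc a b) :=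
  (contDiffOn_scoreSpeed h.contDiffOn).continuousOn.comp
    (continuousOn_id.prodMk fun t ht => (hΦ.curve x t ht).continuousWithinAt)
    fun _ ht => h.pos.trans_le ht.1

theorem norm_score_sub_le (x : Vec d) (has : a ≤ s) (hs'b : s' ≤ b) (hτ : τ ∈ Icc s s') :
    ‖spaceGrad u (s', Φ s' x) - spaceGrad u (τ, Φ τ x)‖ ≤
      ∫ r in Ioc s s', ‖scoreSpeed u (r, Φ r x)‖ := by
  have hss : Icc s s' ⊆ Icc a b := Icc_subset_Icc has hs'b
  have hsτ : Icc τ s' ⊆ Icc a b := (Icc_subset_Icc_left hτ.1).trans hss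
  have hc := h.continuousOn_scoreSpeed_flow hΦ x
  have e := intervalIntegral.integral_eq_sub_of_hasDerivAt_of_le hτ.2
    (f := fun t => spaceGrad u (t, Φ t x)) (f' := fun t => scoreSpeed u (t, Φ t x))
    (fun r hr => ((h.hasDerivWithinAt_score hΦ x (hsτ hr)).continuousWithinAt).mono hsτ)
    (fun r hr => (h.hasDerivWithinAt_score hΦ x (hsτ (Ioo_subset_Icc_self hr))).hasDerivAt
      (Icc_mem_nhds ((has.trans hτ.1).trans_lt hr.1) (hr.2.trans_le hs'b)))
    ((hc.mono hsτ).intervalIntegrable_of_Icc hτ.2)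
  rw [← e, intervalIntegral.integral_of_le hτ.2]
  refine (norm_integral_le_integral_norm _).trans ?_
  refine setIntegral_mono_set (((hc.mono hss).norm.integrableOn_Icc).mono_set Ioc_subset_Icc_self)
    (.of_forall fun _ => norm_nonneg _) (Ioc_subset_Ioc_left hτ.1).eventuallyLE

/-- The local error of the exponential integrator with the exact score. -/
theorem norm_sub_expStep_le (x : Vec d) (has : a ≤ s) (hs : s ≤ s') (hs'b : s' ≤ b) :
    ‖(Real.exp (s' - s) • Φ s' x + (Real.exp (s' - s) - 1) • spaceGrad u (s', Φ s' x)) - Φ s x‖ ≤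
      (s' - s) * Real.exp (s' - s) * ∫ r in Ioc s s', ‖scoreSpeed u (r, Φ r x)‖ := by
  set S := spaceGrad u (s', Φ s' x) with hS
  set J := ∫ r in Ioc s s', ‖scoreSpeed u (r, Φ r x)‖ with hJ
  have hss : Icc s s' ⊆ Icc a b := Icc_subset_Icc has hs'b
  -- With the integrating factor `e^{τ - s}` and the score frozen at its value `S` at `s'`, the
  -- increment of this function over the step is exactly the integrator error. Its derivative only
  -- sees the deviation of the score from `S`.
  have hd : ∀ τ ∈ Icc s s', HasDerivWithinAt (fun τ => Real.exp (τ - s) • (Φ τ x + S))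
      (Real.exp (τ - s) • (S - spaceGrad u (τ, Φ τ x))) (Icc s s') τ := fun τ hτ => by
    have h1 : HasDerivWithinAt (fun τ => Real.exp (τ - s)) (Real.exp (τ - s)) (Icc s s') τ := by
      simpa using ((hasDerivWithinAt_id τ (Icc s s')).sub_const s).exp
    have h2 := ((hΦ.curve x τ (hss hτ)).mono hss).add_const S
    refine (h1.smul h2).congr_deriv ?_
    rw [ouField, ← smul_add]
    congr 1
    abel
  have hb : ∀ τ ∈ Icc s s', ‖Real.exp (τ - s) • (S - spaceGrad u (τ, Φ τ x))‖ ≤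
      Real.exp (s' - s) * J := fun τ hτ => by
    rw [norm_smul, Real.norm_of_nonneg (Real.exp_nonneg _)]
    gcongr
    · exact hτ.2
    · exact h.norm_score_sub_le hΦ x has hs'b hτ
  have := (convex_Icc s s').norm_image_sub_le_of_norm_hasDerivWithin_le hd hb
    (left_mem_Icc.2 hs) (right_mem_Icc.2 hs)
  rw [Real.norm_of_nonneg (sub_nonneg.2 hs), sub_self, Real.exp_zero, one_smul] at this
  calc _ = _ := by congr 1; module
    _ ≤ _ := this
    _ = _ := by ring

/-- The pathwise bound is squared, Cauchy–Schwarz in time costs one more factor `s' - s`, and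
Tonelli identifies the result with the energy of the step. -/
theorem lintegral_sub_expStep_le (has : a ≤ s) (hs : s ≤ s') (hs'b : s' ≤ b) :
    ∫⁻ x, ‖(Real.exp (s' - s) • Φ s' x + (Real.exp (s' - s) - 1) • spaceGrad u (s', Φ s' x))
        - Φ s x‖ₑ ^ 2 ∂(sliceLaw u a) ≤
      ENNReal.ofReal (((s' - s) * Real.exp (s' - s)) ^ 2 * (s' - s)) *
        stepEnergy u a b Φ s s' := by
  have hab := has.trans (hs.trans hs'b)
  have := h.isProbabilityMeasure a (left_mem_Icc.2 hab)
  have hη := sub_nonneg.2 hs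
  have hsub : Ioc s s' ⊆ Ioc a b := Ioc_subset_Ioc has hs'b
  have hss : Icc s s' ⊆ Icc a b := Icc_subset_Icc has hs'b
  set c := (s' - s) * Real.exp (s' - s) with hc
  have hc0 : 0 ≤ c := by positivity
  have hm := ((h.aestronglyMeasurable_flow hab hΦ
    (f := fun z => ‖scoreSpeed u z‖) (contDiffOn_scoreSpeed h.contDiffOn).continuousOn.norm
    ).aemeasurable.ennreal_ofReal.pow_const 2)
  simp only [ofReal_norm] at hm
  have hA : stepEnergy u a b Φ s s' = ∫⁻ x, ∫⁻ r in Ioc s s',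
      ‖scoreSpeed u (r, Φ r x)‖ₑ ^ 2 ∂volume ∂(sliceLaw u a) := by
    have e : (timeLaw u a b).restrict (Ioc s s' ×ˢ univ) =
        (volume.restrict (Ioc s s')).prod (sliceLaw u a) := by
      rw [timeLaw, ← Measure.prod_restrict, Measure.restrict_restrict measurableSet_Ioc,
        inter_eq_left.2 hsub, Measure.restrict_univ]
    rw [stepEnergy, e, lintegral_prod_symm]
    rw [← e]
    exact hm.restrict
  rw [hA, ← lintegral_const_mul' _ _ ENNReal.ofReal_ne_top]
  refine lintegral_mono fun x => ?_
  have hcont := (h.continuousOn_scoreSpeed_flow hΦ x).mono hss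
  have hint : Integrable (fun r => scoreSpeed u (r, Φ r x)) (volume.restrict (Ioc s s')) :=
    hcont.integrableOn_Icc.mono_set Ioc_subset_Icc_self
  have e1 := h.norm_sub_expStep_le hΦ x has hs hs'b
  have e2 := ENNReal.ofReal_le_ofReal e1
  rw [ofReal_norm, ENNReal.ofReal_mul hc0,
    ofReal_integral_norm_eq_lintegral_enorm hint] at e2
  have e3 := lintegral_sq_le hint.aestronglyMeasurable.enorm
  rw [Measure.restrict_apply_univ, Real.volume_Ioc] at e3
  calc _ ≤ (ENNReal.ofReal c * ∫⁻ r in Ioc s s', ‖scoreSpeed u (r, Φ r x)‖ₑ) ^ 2 := by gcongr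
    _ ≤ ENNReal.ofReal c ^ 2 * (ENNReal.ofReal (s' - s) *
        ∫⁻ r in Ioc s s', ‖scoreSpeed u (r, Φ r x)‖ₑ ^ 2) := by rw [mul_pow]; gcongr
    _ = _ := by rw [← mul_assoc, ← ENNReal.ofReal_pow hc0, ← ENNReal.ofReal_mul (sq_nonneg _)]

/-- The energies over disjoint steps add up to at most the total energy. -/
theorem sum_stepEnergy_le (hL : 1 ≤ L) (hab : a ≤ b) {t : ℕ → ℝ} {m n : ℕ}
    (ht : MonotoneOn t (Set.Icc m n)) :
    ∑ k ∈ Finset.Ico m n, stepEnergy u a b Φ (t k) (t (k + 1)) ≤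
      ENNReal.ofReal (2 * (d * L ^ 2) + 16 * ((b - a) * (d * L ^ 3))) := by
  unfold stepEnergy
  rw [← lintegral_biUnion_finset]
  · refine (setLIntegral_le_lintegral _ _).trans ?_
    refine le_trans (le_of_eq ?_) (h.lintegral_speedSq_le hab hΦ hL)
    exact lintegral_congr fun z => enorm_sq_eq_ofReal _
  · intro i hi j hj hij
    simp only [Finset.coe_Ico, mem_Ico] at hi hj
    refine Set.disjoint_left.2 fun z hz hz' => hij ?_
    -- A time in two half-open steps forces the indices to be ordered both ways. Disjointness is
    -- what lets all steps share one total energy.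
    have key : ∀ i j : ℕ, m ≤ i → j < n → z.1 ≤ t (i + 1) → t j < z.1 → j ≤ i := by
      intro i j hi hj h1 h2
      by_contra hlt
      have := ht ⟨by omega, by omega⟩ ⟨by omega, by omega⟩ (show i + 1 ≤ j by omega)
      linarith
    exact le_antisymm (key j i hj.1 hi.2 hz'.1.2 hz.1.1) (key i j hi.1 hj.2 hz.1.2 hz'.1.1)
  · exact fun _ _ => measurableSet_Ioc.prod MeasurableSet.univ

end IsLogOU

end OneStep

/-! ### Propagation of the error over one step -/

section Recursion

variable {d : ℕ} {u : ℝ × Vec d → ℝ} {L Lf : ℝ≥0} {a b s s' H εsc εcm : ℝ}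

theorem exp_sub_one_le_mul_exp (x : ℝ) : Real.exp x - 1 ≤ x * Real.exp x := by
  have h := mul_le_mul_of_nonneg_right (Real.add_one_le_exp (-x)) (Real.exp_pos x).le
  rw [← Real.exp_add, neg_add_cancel, Real.exp_zero] at h
  linarith

theorem measurable_linearCombination {α : Type} [MeasurableSpace α] {f g : α → Vec d}
    (hf : Measurable f) (hg : Measurable g) (c c' : ℝ) :
    Measurable fun x => c • f x + c' • g x := by
  have h : Continuous fun q : Vec d × Vec d => c • q.1 + c' • q.2 := by fun_prop
  exact h.measurable.comp (hf.prodMk hg)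

theorem eLpNorm_two_sub_le {α : Type} [MeasurableSpace α] {μ : Measure α} {f g k : α → Vec d}
    (hf : Measurable f) (hg : Measurable g) (hk : Measurable k) :
    eLpNorm (fun x => f x - k x) 2 μ ≤
      eLpNorm (fun x => f x - g x) 2 μ + eLpNorm (fun x => g x - k x) 2 μ := by
  have e : (fun x => f x - k x) = (fun x => f x - g x) + fun x => g x - k x := by
    ext1 x; simp
  have h1 : AEStronglyMeasurable (fun x => f x - g x) μ := (hf.sub hg).aestronglyMeasurable
  have h2 : AEStronglyMeasurable (fun x => g x - k x) μ := (hg.sub hk).aestronglyMeasurable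
  rw [e]
  exact eLpNorm_add_le h1 h2 (by norm_num)

/-- One step of the error recursion for the consistency model. -/
theorem IsLogOU.eLpNorm_step_le (h : IsLogOU u L a b) {Φ : ℝ → Vec d → Vec d}
    (hΦ : IsOUFlow u a b Φ) (has : a ≤ s) (hs : s ≤ s') (hs'b : s' ≤ b) (hH : s' - s ≤ H)
    {g g' σ : Vec d → Vec d} (hg : LipschitzWith Lf g) (hg' : Continuous g') (hσ : Measurable σ)
    (hεsc : 0 ≤ εsc) (hεcm : 0 ≤ εcm)
    (hsc : ∫⁻ x, ‖σ x - spaceGrad u (s', x)‖ₑ ^ 2 ∂(sliceLaw u s') ≤ ENNReal.ofReal (εsc ^ 2))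
    (hcm : ∫⁻ x, ‖g' x - g (Real.exp (s' - s) • x + (Real.exp (s' - s) - 1) • σ x)‖ₑ ^ 2
      ∂(sliceLaw u s') ≤ ENNReal.ofReal (εcm ^ 2 * (s' - s) ^ 2)) :
    eLpNorm (fun x => g' (Φ s' x) - x) 2 (sliceLaw u a) ≤
      eLpNorm (fun x => g (Φ s x) - x) 2 (sliceLaw u a) + (ENNReal.ofReal (εcm * (s' - s)) +
        Lf * (ENNReal.ofReal ((s' - s) * Real.exp H * εsc) +
          ENNReal.ofReal ((s' - s) * Real.exp H * √(s' - s)) *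
            stepEnergy u a b Φ s s' ^ (1 / 2 : ℝ))) := by
  have hη := sub_nonneg.2 hs
  have hsm : s ∈ Icc a b := ⟨has, hs.trans hs'b⟩
  have hs'm : s' ∈ Icc a b := ⟨has.trans hs, hs'b⟩
  have hP := h.measurePreserving_flow hΦ hs'm
  have cs := h.continuous_flow hΦ hsm
  have cs' := h.continuous_flow hΦ hs'm
  have hexp : Real.exp (s' - s) ≤ Real.exp H := Real.exp_le_exp.2 hH
  have hG : Continuous fun x => spaceGrad u (s', x) := (h.lipschitz s' hs'm).continuous
  set η := s' - s with hηdef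
  -- `X` is the integrator step with the learned score and `Y` the one with the exact score, both
  -- started from the exact trajectory at `s'`. The comparison runs from `g' ∘ Φ_{s'}` to `g ∘ X` to
  -- `g ∘ Φ_s`, with `Y` between `X` and `Φ_s`.
  let X : Vec d → Vec d := fun x => Real.exp η • Φ s' x + (Real.exp η - 1) • σ (Φ s' x)
  let Y : Vec d → Vec d := fun x =>
    Real.exp η • Φ s' x + (Real.exp η - 1) • spaceGrad u (s', Φ s' x)
  have mσ : Measurable fun x => σ (Φ s' x) := hσ.comp cs'.measurable
  have mX : Measurable X := measurable_linearCombination cs'.measurable mσ _ _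
  have mY : Measurable Y :=
    measurable_linearCombination cs'.measurable (hG.comp cs').measurable _ _
  have mg : Measurable g := hg.continuous.measurable
  have e1 : eLpNorm (fun x => g' (Φ s' x) - g (X x)) 2 (sliceLaw u a) ≤
      ENNReal.ofReal (εcm * η) := by
    refine eLpNorm_two_le_ofReal (by positivity) ?_
    rw [mul_pow]
    refine le_trans (le_of_eq ?_) hcm
    refine hP.lintegral_comp (f := fun x =>
      ‖g' x - g (Real.exp η • x + (Real.exp η - 1) • σ x)‖ₑ ^ 2) ?_
    exact ((hg'.measurable.sub (mg.comp
      (measurable_linearCombination measurable_id hσ _ _))).enorm).pow_const 2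
  have e2 : eLpNorm (fun x => X x - Y x) 2 (sliceLaw u a) ≤
      ENNReal.ofReal (η * Real.exp H * εsc) := by
    have e : (fun x => X x - Y x) = fun x =>
        (Real.exp η - 1) • (σ (Φ s' x) - spaceGrad u (s', Φ s' x)) := by
      ext1 x; simp only [X, Y]; module
    have h1 : eLpNorm (fun x => σ (Φ s' x) - spaceGrad u (s', Φ s' x)) 2 (sliceLaw u a) ≤
        ENNReal.ofReal εsc := by
      refine eLpNorm_two_le_ofReal hεsc ?_
      refine le_trans (le_of_eq ?_) hsc
      exact hP.lintegral_comp (f := fun x => ‖σ x - spaceGrad u (s', x)‖ₑ ^ 2)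
        ((hσ.sub hG.measurable).enorm.pow_const 2)
    have h0 : 0 ≤ Real.exp η - 1 := by linarith [Real.add_one_le_exp η]
    have h2 : Real.exp η - 1 ≤ η * Real.exp H :=
      (exp_sub_one_le_mul_exp η).trans (mul_le_mul_of_nonneg_left hexp hη)
    rw [e]
    refine (eLpNorm_const_smul_le (c := Real.exp η - 1)
      (f := fun x => σ (Φ s' x) - spaceGrad u (s', Φ s' x))).trans ?_
    rw [← ofReal_norm, Real.norm_of_nonneg h0, ENNReal.ofReal_mul (by positivity)]
    gcongr
  have e3 : eLpNorm (fun x => Y x - Φ s x) 2 (sliceLaw u a) ≤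
      ENNReal.ofReal (η * Real.exp H * √η) * stepEnergy u a b Φ s s' ^ (1 / 2 : ℝ) := by
    rw [eLpNorm_two_eq]
    refine (ENNReal.rpow_le_rpow (h.lintegral_sub_expStep_le hΦ has hs hs'b)
      (by norm_num)).trans ?_
    rw [ENNReal.mul_rpow_of_nonneg _ _ (by norm_num), ENNReal.ofReal_rpow_of_nonneg
      (by positivity) (by norm_num), ← Real.sqrt_eq_rpow, Real.sqrt_mul (sq_nonneg _),
      Real.sqrt_sq (by positivity)]
    gcongr
  have e4 : eLpNorm (fun x => g (X x) - g (Φ s x)) 2 (sliceLaw u a) ≤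
      Lf * (ENNReal.ofReal (η * Real.exp H * εsc) + ENNReal.ofReal (η * Real.exp H * √η) *
        stepEnergy u a b Φ s s' ^ (1 / 2 : ℝ)) := by
    have h1 : eLpNorm (fun x => g (X x) - g (Φ s x)) 2 (sliceLaw u a) ≤
        Lf * eLpNorm (fun x => X x - Φ s x) 2 (sliceLaw u a) := by
      have := eLpNorm_le_nnreal_smul_eLpNorm_of_ae_le_mul (μ := sliceLaw u a)
        (f := fun x => g (X x) - g (Φ s x)) (g := fun x => X x - Φ s x) (c := Lf)
        (.of_forall fun x => hg.norm_sub_le (X x) (Φ s x)) 2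
      simpa [ENNReal.smul_def] using this
    refine h1.trans ?_
    gcongr
    exact (eLpNorm_two_sub_le mX mY cs.measurable).trans (add_le_add e2 e3)
  have mgX : Measurable fun x => g (X x) := mg.comp mX
  have mgs : Measurable fun x => g (Φ s x) := mg.comp cs.measurable
  have mg's : Measurable fun x => g' (Φ s' x) := hg'.measurable.comp cs'.measurable
  calc _ ≤ _ := eLpNorm_two_sub_le mg's mgs measurable_id
    _ ≤ _ := add_le_add_left ((eLpNorm_two_sub_le mg's mgX mgs).trans (add_le_add e1 e4)) _
    _ = _ := add_comm _ _

end Recursion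

/-! ### The backward map as the inverse of the flow -/

section BackwardMap

variable {d : ℕ} {p : Vec d → ℝ} {Ls : ℝ≥0} {T δ b : ℝ}

namespace IsDataDensity

variable (hp : IsDataDensity p Ls T) (hδ : 0 < δ) (hδb : δ ≤ b) (hbT : b ≤ T)
  {Φ : ℝ → Vec d → Vec d} (hΦ : IsOUFlow (logDensity (dataLaw p)) δ b Φ)

include hp hδ hδb hbT hΦ

/-- On `[δ, b]` the time is positive, so the two vector fields coincide, and uniqueness for the
Lipschitz field identifies any solution with the trajectory through its value at `δ`. -/
theorem isBackwardValue_iff {x z : Vec d} :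
    IsBackwardValue (exactField p) δ b x z ↔ Φ b z = x := by
  have hf : ∀ s ∈ Icc δ b, ∀ y, exactField p y s = ouField (logDensity (dataLaw p)) s y :=
    fun s hs y => by rw [exactField, ouField, hp.score_eq (hδ.trans_le hs.1)]
  have hL := ((hp.isLogOU hδ).mono hbT).isLipschitzField
  have hb : b ∈ Icc δ b := right_mem_Icc.2 hδb
  constructor
  · rintro ⟨y, hy, rfl, rfl⟩
    have hc : IsIntegralCurveOn y (ouField (logDensity (dataLaw p))) (Icc δ b) := fun s hs => by
      have := hy s hs
      rwa [hf s hs] at this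
    have := hL.dist_le (hΦ.curve (y δ)) hc hb
    simpa [hΦ.init] using this
  · rintro rfl
    refine ⟨fun s => Φ s z, fun s hs => ?_, rfl, hΦ.init z⟩
    rw [hf s hs]
    exact hΦ.curve z s hs

theorem existsUnique_isBackwardValue (x : Vec d) :
    ∃! z, IsBackwardValue (exactField p) δ b x z := by
  simp_rw [hp.isBackwardValue_iff hδ hδb hbT hΦ]
  exact (((hp.isLogOU hδ).mono hbT).bijective_flow hΦ (right_mem_Icc.2 hδb)).existsUnique x

theorem backwardMap_flow (z : Vec d) : backwardMap (exactField p) δ (Φ b z) b = z := by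
  have h1 := (hp.isBackwardValue_iff hδ hδb hbT hΦ (x := Φ b z) (z := z)).2 rfl
  have h2 : IsBackwardValue (exactField p) δ b (Φ b z) (backwardMap (exactField p) δ (Φ b z) b) :=
    Classical.epsilon_spec (p := IsBackwardValue (exactField p) δ b (Φ b z)) ⟨z, h1⟩
  exact (hp.existsUnique_isBackwardValue hδ hδb hbT hΦ (Φ b z)).unique h2 h1

/-- The flow is a measurable embedding, being continuous and injective. Hence the transfer holds for
every `F`, and measurability of the backward map is not at issue. -/
theorem lintegral_backwardMap (F : Vec d → Vec d → ℝ≥0∞) :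
    ∫⁻ x, F x (backwardMap (exactField p) δ x b) ∂(ouLaw p b) =
      ∫⁻ z, F (Φ b z) z ∂(sliceLaw (logDensity (dataLaw p)) δ) := by
  have h := (hp.isLogOU hδ).mono hbT
  have hb : b ∈ Icc δ b := right_mem_Icc.2 hδb
  have he := (h.continuous_flow hΦ hb).measurableEmbedding (h.bijective_flow hΦ hb).1
  rw [hp.ouLaw_eq (hδ.trans_le hδb), ← (h.measurePreserving_flow hΦ hb).lintegral_comp_emb he]
  simp_rw [hp.backwardMap_flow hδ hδb hbT hΦ]

end IsDataDensity

end BackwardMap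

/-! ### Step sizes and summation of the discretization errors -/

section Schedule

variable {N N₁ : ℕ} {δ T h : ℝ} {t : ℕ → ℝ}

namespace IsSchedule

variable (ht : IsSchedule N N₁ δ T h t)

include ht

theorem step_size_pos : 0 < h := by
  have := ht.number_uniform
  linarith

theorem monotoneOn : MonotoneOn t (Icc 1 N) := by
  intro i hi j hj hij
  induction j, hij using Nat.le_induction with
  | base => exact le_rfl
  | succ k hk ih =>
    have hk' : k < N := Nat.lt_of_succ_le hj.2
    exact (ih ⟨hi.1.trans hk, hk'.le⟩).trans (ht.lt_succ k (hi.1.trans hk) hk').le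

theorem sub_eq_of_uniform {k : ℕ} (hk : N₁ ≤ k) (hkN : k ≤ N) :
    t k - t N₁ = ((k : ℝ) - N₁) * h := by
  induction k, hk using Nat.le_induction with
  | base => simp
  | succ k hk ih =>
    have := ht.step_uniform k hk hkN
    have := ih (Nat.le_of_succ_le hkN)
    push_cast
    linarith

/-- A step before `t N₁` fits between `δ > 0` and `t N₁`, and the number of uniform steps forces `t
N₁ = T - (N - N₁) h ≤ h`. -/
theorem step_le {k : ℕ} (hk : 1 ≤ k) (hkN : k < N) : t (k + 1) - t k ≤ h := by
  rcases le_or_gt N₁ k with hk₁ | hk₁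
  · exact (ht.step_uniform k hk₁ hkN).le
  · have h1 := ht.monotoneOn ⟨by omega, by omega⟩ ⟨ht.one_le, ht.le⟩ (show k + 1 ≤ N₁ from hk₁)
    have h2 := ht.sub_eq_of_uniform ht.le le_rfl
    have h3 := ht.monotoneOn ⟨le_rfl, by omega⟩ ⟨hk, hkN.le⟩ hk
    have h4 := ht.number_uniform.2
    rw [ht.t_last] at h2
    rw [ht.t_one] at h3
    linarith [ht.delta_pos]

end IsSchedule

/-- The accumulated discretization error. -/
theorem sum_step_error_le {d : ℕ} {L : ℝ} {n : ℕ} {r : ℕ → ℝ} {δ h : ℝ} {t : ℕ → ℝ}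
    (hL : 0 ≤ L) (hn : 1 ≤ n) (hδ : 0 ≤ δ) (h1 : t 1 = δ)
    (h0 : ∀ k ∈ Finset.Ico 1 n, 0 ≤ t (k + 1) - t k)
    (hh : ∀ k ∈ Finset.Ico 1 n, t (k + 1) - t k ≤ h) (hr : ∀ k, 0 ≤ r k) (hhn : 0 ≤ h)
    (hδn : δ ≤ t n)
    (hsum : ∑ k ∈ Finset.Ico 1 n, r k ≤ 2 * (d * L ^ 2) + 16 * ((t n - δ) * (d * L ^ 3))) :
    ∑ k ∈ Finset.Ico 1 n, (t (k + 1) - t k) * (√(t (k + 1) - t k) * √(r k)) ≤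
      2 * (√(t n) * (L * √d) * h) + 4 * (t n * (L ^ (3 / 2 : ℝ) * √d) * h) := by
  have htn : 0 ≤ t n := hδ.trans hδn
  have hs : ∑ k ∈ Finset.Ico 1 n, (t (k + 1) - t k) ≤ t n := by
    rw [Finset.sum_Ico_sub t hn, h1]
    linarith
  have hL3 : √(L ^ 3) = L ^ (3 / 2 : ℝ) := by
    rw [Real.sqrt_eq_rpow, ← Real.rpow_natCast, ← Real.rpow_mul hL]
    norm_num
  have hB : √(∑ k ∈ Finset.Ico 1 n, r k) ≤
      2 * (L * √d) + 4 * (√(t n) * (L ^ (3 / 2 : ℝ) * √d)) := by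
    rw [← hL3]
    refine Real.sqrt_le_iff.2 ⟨by positivity, hsum.trans ?_⟩
    have e1 := Real.sq_sqrt (Nat.cast_nonneg (α := ℝ) d)
    have e2 := Real.sq_sqrt htn
    have e3 := Real.sq_sqrt (pow_nonneg hL 3)
    have e4 : (2 * (L * √d) + 4 * (√(t n) * (√(L ^ 3) * √d))) ^ 2 =
        4 * (L ^ 2 * √d ^ 2) + 16 * (√(t n) ^ 2 * (√(L ^ 3) ^ 2 * √d ^ 2)) +
          16 * ((L * √d) * (√(t n) * (√(L ^ 3) * √d))) := by ring
    rw [e4, e1, e2, e3]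
    have p1 : 0 ≤ (L * √d) * (√(t n) * (√(L ^ 3) * √d)) := by positivity
    have p2 : 0 ≤ δ * (d * L ^ 3) := by positivity
    have p3 : 0 ≤ d * L ^ 2 := by positivity
    linarith
  calc _ ≤ ∑ k ∈ Finset.Ico 1 n, h * (√(t (k + 1) - t k) * √(r k)) := by
        refine Finset.sum_le_sum fun k hk => ?_
        exact mul_le_mul_of_nonneg_right (hh k hk) (by positivity)
    _ = h * ∑ k ∈ Finset.Ico 1 n, √(t (k + 1) - t k) * √(r k) := by rw [Finset.mul_sum]
    _ ≤ h * (√(t n) * (2 * (L * √d) + 4 * (√(t n) * (L ^ (3 / 2 : ℝ) * √d)))) := by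
        refine mul_le_mul_of_nonneg_left ?_ hhn
        -- One factor of each step length has already been replaced by `h`. Cauchy–Schwarz over the
        -- steps separates the remaining square roots into the total time, at most `t n`, and the
        -- total energy.
        have cs : ∑ k ∈ Finset.Ico 1 n, √(t (k + 1) - t k) * √(r k) ≤
            √(∑ k ∈ Finset.Ico 1 n, (t (k + 1) - t k)) * √(∑ k ∈ Finset.Ico 1 n, r k) := by
          have := Real.sum_mul_le_sqrt_mul_sqrt (Finset.Ico 1 n) (fun k => √(t (k + 1) - t k))
            (fun k => √(r k))
          rw [Finset.sum_congr rfl fun k hk => Real.sq_sqrt (h0 k hk),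
            Finset.sum_congr rfl fun k _ => Real.sq_sqrt (hr k)] at this
          exact this
        exact cs.trans (mul_le_mul (Real.sqrt_le_sqrt hs) hB (Real.sqrt_nonneg _)
          (Real.sqrt_nonneg _))
    _ = 2 * (√(t n) * (L * √d) * h) + 4 * ((√(t n) * √(t n)) * (L ^ (3 / 2 : ℝ) * √d) * h) := by
        ring
    _ = _ := by rw [Real.mul_self_sqrt htn]

end Schedule

/-! ### Summing the recursion -/

section ErrorBound

variable {d : ℕ} {u : ℝ × Vec d → ℝ} {L Lf : ℝ≥0} {H h εsc εcm : ℝ} {t : ℕ → ℝ} {n : ℕ}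

/-- The error of the consistency model, in terms of the flow. -/
theorem IsLogOU.eLpNorm_error_le (hu : IsLogOU u L (t 1) (t n)) {Φ : ℝ → Vec d → Vec d}
    (hΦ : IsOUFlow u (t 1) (t n) Φ) (hL : 1 ≤ L) (hn : 1 ≤ n) (ht : MonotoneOn t (Icc 1 n))
    (hH : h ≤ H) (hh0 : 0 ≤ h) (hh : ∀ k, 1 ≤ k → k < n → t (k + 1) - t k ≤ h)
    {s f : Vec d → ℝ → Vec d} (hεsc : 0 ≤ εsc) (hεcm : 0 ≤ εcm)
    (hs : ∀ k, 1 ≤ k → k ≤ n → Measurable fun x => s x (t k))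
    (hsc : ∀ k, 1 ≤ k → k ≤ n → ∫⁻ x, ‖s x (t k) - spaceGrad u (t k, x)‖ₑ ^ 2
      ∂(sliceLaw u (t k)) ≤ ENNReal.ofReal (εsc ^ 2))
    (hcm : ∀ k, 1 ≤ k → k < n → ∫⁻ x, ‖f x (t (k + 1)) -
        f (expIntegrator s x (t (k + 1)) (t k)) (t k)‖ₑ ^ 2 ∂(sliceLaw u (t (k + 1))) ≤
      ENNReal.ofReal (εcm ^ 2 * (t (k + 1) - t k) ^ 2))
    (hf : ∀ k, 1 ≤ k → k ≤ n → LipschitzWith Lf fun x => f x (t k))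
    (hf1 : ∀ x, f x (t 1) = x) :
    eLpNorm (fun x => f (Φ (t n) x) (t n) - x) 2 (sliceLaw u (t 1)) ≤
      ENNReal.ofReal (4 * Real.exp H *
        (t n * (εcm + Lf * εsc + Lf * (L : ℝ) ^ (3 / 2 : ℝ) * (d : ℝ) ^ (1 / 2 : ℝ) * h)
          + (t n) ^ (1 / 2 : ℝ) * Lf * L * (d : ℝ) ^ (1 / 2 : ℝ) * h)) := by
  have hmem : ∀ k, 1 ≤ k → k ≤ n → t k ∈ Icc (t 1) (t n) := fun k h1 hk =>
    ⟨ht ⟨le_rfl, hn⟩ ⟨h1, hk⟩ h1, ht ⟨h1, hk⟩ ⟨hn, le_rfl⟩ hk⟩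
  have h1n := (hmem 1 le_rfl hn).2
  have hstep : ∀ k, 1 ≤ k → k < n → t k ≤ t (k + 1) := fun k h1 hk =>
    ht ⟨h1, hk.le⟩ ⟨by omega, hk⟩ (Nat.le_succ k)
  have hH0 : 0 ≤ H := hh0.trans hH
  have hexp : 1 ≤ Real.exp H := Real.one_le_exp hH0
  set A : ℕ → ℝ≥0∞ := fun k => stepEnergy u (t 1) (t n) Φ (t k) (t (k + 1)) with hA
  have hsumA := hu.sum_stepEnergy_le hΦ hL h1n ht
  have hAfin : ∀ k ∈ Finset.Ico 1 n, A k ≠ ⊤ := fun k hk =>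
    ((Finset.single_le_sum (f := A) (fun _ _ => zero_le) hk).trans
      hsumA).trans_lt ENNReal.ofReal_lt_top |>.ne
  set r : ℕ → ℝ := fun k => (A k).toReal with hr
  have hsumr : ∑ k ∈ Finset.Ico 1 n, r k ≤
      2 * (d * (L : ℝ) ^ 2) + 16 * ((t n - t 1) * (d * (L : ℝ) ^ 3)) := by
    rw [hr, ← ENNReal.toReal_sum hAfin]
    refine ENNReal.toReal_le_of_le_ofReal ?_ hsumA
    have := sub_nonneg.2 h1n
    positivity
  set c : ℕ → ℝ := fun k => εcm * (t (k + 1) - t k) + Lf * ((t (k + 1) - t k) * Real.exp H * εsc +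
    (t (k + 1) - t k) * Real.exp H * √(t (k + 1) - t k) * √(r k)) with hc
  have hη : ∀ k ∈ Finset.Ico 1 n, 0 ≤ t (k + 1) - t k := fun k hk => by
    rw [Finset.mem_Ico] at hk
    exact sub_nonneg.2 (hstep k hk.1 hk.2)
  have hc0 : ∀ k ∈ Finset.Ico 1 n, 0 ≤ c k := fun k hk => by
    have := hη k hk
    positivity
  have hrec : ∀ m, 1 ≤ m → m ≤ n → eLpNorm (fun x => f (Φ (t m) x) (t m) - x) 2
      (sliceLaw u (t 1)) ≤ ∑ k ∈ Finset.Ico 1 m, ENNReal.ofReal (c k) := by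
    intro m hm
    induction m, hm using Nat.le_induction with
    -- At time `t 1` both the model and the flow are the identity, so the recursion starts from zero
    -- error.
    | base => simp [hf1, hΦ.init]
    | succ k hk ih =>
      intro hkn
      have hkm : k ∈ Finset.Ico 1 n := Finset.mem_Ico.2 ⟨hk, hkn⟩
      have hη' := hη k hkm
      rw [Finset.sum_Ico_succ_top hk]
      refine (hu.eLpNorm_step_le hΦ (hmem k hk (by omega)).1 (hstep k hk hkn)
        (hmem (k + 1) (by omega) hkn).2 ((hh k hk hkn).trans hH) (hf k hk (by omega))
        (hf (k + 1) (by omega) hkn).continuous (hs (k + 1) (by omega) hkn) hεsc hεcm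
        (hsc (k + 1) (by omega) hkn) (hcm k hk hkn)).trans ?_
      refine add_le_add (ih (by omega)) (le_of_eq ?_)
      have e : stepEnergy u (t 1) (t n) Φ (t k) (t (k + 1)) = ENNReal.ofReal (r k) :=
        (ENNReal.ofReal_toReal (hAfin k hkm)).symm
      have hrk : 0 ≤ r k := ENNReal.toReal_nonneg
      rw [e, ENNReal.ofReal_rpow_of_nonneg hrk (by norm_num), ← Real.sqrt_eq_rpow,
        ← ENNReal.ofReal_coe_nnreal, ← ENNReal.ofReal_mul (by positivity),
        ← ENNReal.ofReal_add (by positivity) (by positivity), ← ENNReal.ofReal_mul (by positivity),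
        ← ENNReal.ofReal_add (by positivity) (by positivity)]
  refine (hrec n hn le_rfl).trans ?_
  rw [← ENNReal.ofReal_sum_of_nonneg hc0]
  refine ENNReal.ofReal_le_ofReal ?_
  have htn : 0 ≤ t n := hu.pos.le.trans h1n
  have hsumη : ∑ k ∈ Finset.Ico 1 n, (t (k + 1) - t k) ≤ t n := by
    rw [Finset.sum_Ico_sub t hn]
    linarith [hu.pos]
  have hE := sum_step_error_le (d := d) (L := L) (r := r) (h := h) L.coe_nonneg hn hu.pos.le rfl hη
    (fun k hk => hh k (Finset.mem_Ico.1 hk).1 (Finset.mem_Ico.1 hk).2)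
    (fun _ => ENNReal.toReal_nonneg) hh0 h1n hsumr
  have e : ∑ k ∈ Finset.Ico 1 n, c k =
      (εcm + Lf * Real.exp H * εsc) * ∑ k ∈ Finset.Ico 1 n, (t (k + 1) - t k) +
      Lf * Real.exp H *
        ∑ k ∈ Finset.Ico 1 n, (t (k + 1) - t k) * (√(t (k + 1) - t k) * √(r k)) := by
    rw [Finset.mul_sum, Finset.mul_sum, ← Finset.sum_add_distrib]
    refine Finset.sum_congr rfl fun k _ => ?_
    simp only [hc]
    ring
  rw [← Real.sqrt_eq_rpow, ← Real.sqrt_eq_rpow, e]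
  set M := (L : ℝ) ^ (3 / 2 : ℝ) with hM
  have hM0 : 0 ≤ M := by positivity
  calc _ ≤ (Real.exp H * εcm + Lf * Real.exp H * εsc) * t n + Lf * Real.exp H *
          (2 * (√(t n) * (L * √d) * h) + 4 * (t n * (M * √d) * h)) := by
        refine add_le_add (mul_le_mul ?_ hsumη (Finset.sum_nonneg hη) (by positivity))
          (mul_le_mul_of_nonneg_left hE (by positivity))
        linarith [le_mul_of_one_le_left hεcm hexp]
    _ ≤ _ := by
        have q1 : 0 ≤ Real.exp H * (t n * εcm) := by positivity
        have q2 : 0 ≤ Real.exp H * (t n * (Lf * εsc)) := by positivity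
        have q3 : 0 ≤ Real.exp H * (√(t n) * Lf * L * √d * h) := by positivity
        linarith

end ErrorBound

end ConsistencyModel

/-! ### The error bound for the consistency model -/

theorem mainTheorem2 :
    ∀ H : ℝ, 0 < H → ∃ C : ℝ, 0 < C ∧
      ∀ (d : ℕ) (p : ConsistencyModel.Vec d → ℝ) (Ls Lf : ℝ≥0) (εsc εcm : ℝ)
        (N N₁ : ℕ) (δ T h : ℝ) (t : ℕ → ℝ)
        (sφ fθ : ConsistencyModel.Vec d → ℝ → ConsistencyModel.Vec d),
        -- the data distribution and the smoothness of its scores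
        1 ≤ Ls → ConsistencyModel.IsDataDensity p Ls T →
        -- the time-step schedule
        ConsistencyModel.IsSchedule N N₁ δ T h t → h ≤ H →
        -- the score error
        0 ≤ εsc →
        (∀ k, 1 ≤ k → k ≤ N → Measurable fun x => sφ x (t k)) →
        (∀ k, 1 ≤ k → k ≤ N →
          ∫⁻ x, ‖sφ x (t k) - ConsistencyModel.score p (t k) x‖ₑ ^ 2
            ∂(ConsistencyModel.ouLaw p (t k)) ≤ ENNReal.ofReal (εsc ^ 2)) →
        -- the consistency error, with the exponential integrator
        0 ≤ εcm →
        (∀ k, 1 ≤ k → k ≤ N - 1 →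
          ∫⁻ x, ‖fθ x (t (k + 1))
              - fθ (ConsistencyModel.expIntegrator sφ x (t (k + 1)) (t k)) (t k)‖ₑ ^ 2
            ∂(ConsistencyModel.ouLaw p (t (k + 1)))
            ≤ ENNReal.ofReal (εcm ^ 2 * (t (k + 1) - t k) ^ 2)) →
        -- the consistency model: Lipschitz, with the boundary condition at time `δ`
        1 < Lf →
        (∀ k, 1 ≤ k → k ≤ N → LipschitzWith Lf fun x => fθ x (t k)) →
        (∀ x, fθ x δ = x) →
        -- conclusion
        ∀ n, 1 ≤ n → n ≤ N - 1 →
          -- the exact backward map is well defined at time `t n`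
          (∀ x, ∃! z,
            ConsistencyModel.IsBackwardValue (ConsistencyModel.exactField p) δ (t n) x z) ∧
          (∫⁻ x, ‖fθ x (t n)
              - ConsistencyModel.backwardMap (ConsistencyModel.exactField p) δ x (t n)‖ₑ ^ 2
            ∂(ConsistencyModel.ouLaw p (t n))) ^ (1 / 2 : ℝ)
            ≤ ENNReal.ofReal (C *
              (t n * (εcm + Lf * εsc + Lf * (Ls : ℝ) ^ (3 / 2 : ℝ) * (d : ℝ) ^ (1 / 2 : ℝ) * h)
                + (t n) ^ (1 / 2 : ℝ) * Lf * Ls * (d : ℝ) ^ (1 / 2 : ℝ) * h)) := by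
  intro H _
  -- The factor `e^H` bounds the growth `e^{h_k}` over one step, and `4` is the larger coefficient
  -- in `sum_step_error_le`.
  refine ⟨4 * Real.exp H, by positivity, ?_⟩
  intro d p Ls Lf εsc εcm N N₁ δ T h t sφ fθ hLs hp hS hhH hεsc hs hsc hεcm hcm hLf hf hfδ n hn hnN
  have hnN' : n < N := by omega
  have hδ := hS.delta_pos
  have h1 := hS.t_one
  have hmono := hS.monotoneOn
  have hδn : δ ≤ t n := h1 ▸ hmono ⟨le_rfl, by omega⟩ ⟨hn, hnN'.le⟩ hn
  have hnT : t n ≤ T := hS.t_last ▸ hmono ⟨hn, hnN'.le⟩ ⟨by omega, le_rfl⟩ hnN'.le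
  -- The flow is run only up to `t n`, so that the energy and the resulting bound scale with `t n`
  -- instead of `T`.
  have hu := (hp.isLogOU hδ).mono hnT
  have hpos : ∀ k, 1 ≤ k → k ≤ N → 0 < t k := fun k hk hkN =>
    hδ.trans_le (h1 ▸ hmono ⟨le_rfl, by omega⟩ ⟨hk, hkN⟩ hk)
  obtain ⟨Φ, hΦ⟩ := hu.exists_flow hδn
  refine ⟨hp.existsUnique_isBackwardValue hδ hδn hnT hΦ, ?_⟩
  rw [hp.lintegral_backwardMap hδ hδn hnT hΦ (fun x z => ‖fθ x (t n) - z‖ₑ ^ 2),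
    ← ConsistencyModel.eLpNorm_two_eq (fun z => fθ (Φ (t n) z) (t n) - z)]
  rw [← h1] at hu hΦ hfδ ⊢
  refine hu.eLpNorm_error_le hΦ hLs hn (hmono.mono (Icc_subset_Icc_right hnN'.le)) hhH
    hS.step_size_pos.le (fun k hk hkn => hS.step_le hk (hkn.trans hnN')) hεsc hεcm
    (fun k hk hkn => hs k hk (hkn.trans hnN'.le)) (fun k hk hkn => ?_) (fun k hk hkn => ?_)
    (fun k hk hkn => hf k hk (hkn.trans hnN'.le)) hfδ
  · have := hsc k hk (hkn.trans hnN'.le)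
    have hk0 := hpos k hk (hkn.trans hnN'.le)
    simp_rw [hp.score_eq hk0] at this
    rwa [hp.ouLaw_eq hk0] at this
  · have := hcm k hk (by omega)
    rwa [hp.ouLaw_eq (hpos (k + 1) (by omega) (by omega))] at this
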